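/- Let $\lambda\ge 1$ be an integer, $k=2(\lambda+1)$, and $u_0\in H^1(\mathbb R)\cap W^{1,k}(\mathbb R)$. Let $x_0:\mathbb R\to\mathbb R$ be the inverse of the increasing bijection $x\mapsto\int_0^x(1+(u_0)_x^2)^{k/2}\,ds$. For functions $u,v,\xi$ of $Y\in\mathbb R$ put $$\mathcal K(Y,Y')=\exp\Big(-\Big|\int_Y^{Y'}\cos^k\tfrac{v(s)}2\,\xi(s)\,ds\Big|\Big),$$ $$f=\Big[\tfrac{2\lambda+1}{2}u^\lambda\sin^2\tfrac v2\cos^{k-2}\tfrac v2+u^{\lambda+2}\cos^k\tfrac v2\Big]\xi,\qquad g=u^{\lambda-1}\sin^3\tfrac v2\cos^{k-3}\tfrac v2\;\xi,$$ $$P(Y)=\tfrac12\int_{-\infty}^{\infty}\mathcal K(Y,Y')f(Y')\,dY',\qquad P_x(Y)=\tfrac12\Big(\int_Y^{\infty}-\int_{-\infty}^Y\Big)\mathcal K(Y,Y')f(Y')\,dY',$$ $$Q(Y)=\tfrac\lambda4\int_{-\infty}^{\infty}\mathcal K(Y,Y')g(Y')\,dY',\qquad Q_x(Y)=\tfrac\lambda4\Big(\int_Y^{\infty}-\int_{-\infty}^Y\Big)\mathcal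 K(Y,Y')g(Y')\,dY'.$$ Consider the Cauchy problem for $(u,v,\xi)(T,Y)$, in which $P,P_x,Q,Q_x$ are evaluated at $(u,v,\xi)(T,\cdot)$: $$\begin{cases}u_T=-P_x-Q,\\ v_T=-u^\lambda\sin^2\frac v2+2u^{\lambda+2}\cos^2\frac v2-2\cos^2\frac v2\,(P+Q_x),\\ \xi_T=\frac{\lambda+1}2u^\lambda\xi\sin v+(\lambda+1)u^{\lambda+2}\xi\sin v-(\lambda+1)\xi\sin v\,(P+Q_x),\end{cases}$$ $$u(0,Y)=u_0(x_0(Y)),\qquad v(0,Y)=2\arctan\big((u_0)_x(x_0(Y))\big),\qquad \xi(0,Y)=1.$$ Let $X=\big(H^1(\mathbb R)\cap W^{1,k}(\mathbb R)\big)\times\big(L^2(\mathbb R)\cap L^\infty(\mathbb R)\big)\times L^\infty(\mathbb R)$, with norm $\|u\|_{H^1}+\|u\|_{W^{1,k}}+\|v\|_{L^2}+\|v\|_{L^\infty}+\|\xi\|_{L^\infty}$. A solution on $[0,\mathcal T_0]$ is a triple $(u,v,\xi)$ of real-valued functions on $[0,\mathcal T_0]\times\mathbb R$ such that $T\mapsto(u,v,\xi)(T,\cdot)$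 is continuous from $[0,\mathcal T_0]$ to $X$, the initial conditions hold for almost every $Y$, and for almost every $Y$ the three differential equations hold at every $T\in[0,\mathcal T_0]$ (with one-sided derivatives at the endpoints). Then there exists $\mathcal T_0>0$ such that the Cauchy problem has a solution on $[0,\mathcal T_0]$, and any two solutions on $[0,\mathcal T_0]$ coincide: for every $T\in[0,\mathcal T_0]$ they agree for almost every $Y$. -/

import Mathlib

open MeasureTheory Set Filter Topology
open scoped ENNReal ContDiff

noncomputable section

namespace LambdaFamily

/-- `g` is a weak derivative of `f` on the real line: both are locally integrable and
`∫ f φ' = - ∫ g φ` for every smooth compactly supported test function `φ`. -/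
def IsWeakDeriv (f g : ℝ → ℝ) : Prop :=
  LocallyIntegrable f volume ∧ LocallyIntegrable g volume ∧
    ∀ φ : ℝ → ℝ, ContDiff ℝ ∞ φ → HasCompactSupport φ →
      ∫ x, f x * deriv φ x = - ∫ x, g x * φ x

open Classical in
/-- The weak derivative of `f`, well defined up to a null set when it exists
(see `IsWeakDeriv.ae_eq`); it is `0` when there is none. -/
def weakDeriv (f : ℝ → ℝ) : ℝ → ℝ :=
  if h : ∃ g, IsWeakDeriv f g then h.choose else 0

/-- Membership in the Sobolev space `W^{1,p}(ℝ)`; the space `H^1(ℝ)` is the case `p = 2`. -/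
def MemW1 (p : ℝ≥0∞) (f : ℝ → ℝ) : Prop :=
  MemLp f p volume ∧ ∃ g, IsWeakDeriv f g ∧ MemLp g p volume

/-- The norm `‖f‖_{L^p} + ‖f_x‖_{L^p}` of `W^{1,p}(ℝ)` (meaningful for `f` in that space). -/
def normW1 (p : ℝ≥0∞) (f : ℝ → ℝ) : ℝ≥0∞ :=
  eLpNorm f p volume + eLpNorm (weakDeriv f) p volume

/-- The exponent `k = 2 (lam + 1)`. -/
def expo (lam : ℕ) : ℕ := 2 * (lam + 1)

/-- Membership of a profile `(u, v, ξ)` in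
`X = (H^1(ℝ) ∩ W^{1,k}(ℝ)) × (L^2(ℝ) ∩ L^∞(ℝ)) × L^∞(ℝ)`. -/
def MemX (lam : ℕ) (u v ξ : ℝ → ℝ) : Prop :=
  (MemW1 2 u ∧ MemW1 (expo lam) u) ∧
    (MemLp v 2 volume ∧ MemLp v ∞ volume) ∧ MemLp ξ ∞ volume

/-- The norm of `X`. -/
def normX (lam : ℕ) (u v ξ : ℝ → ℝ) : ℝ≥0∞ :=
  (normW1 2 u + normW1 (expo lam) u) +
    (eLpNorm v 2 volume + eLpNorm v ∞ volume) + eLpNorm ξ ∞ volume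

/-- The kernel `exp (- |∫_Y^{Y'} cos^k (v(s)/2) ξ(s) ds|)`. -/
def kernel (lam : ℕ) (v ξ : ℝ → ℝ) (Y Y' : ℝ) : ℝ :=
  Real.exp (-|∫ s in Y..Y', Real.cos (v s / 2) ^ expo lam * ξ s|)

/-- The density integrated in `P` and `P_x`:
`[(2 lam + 1)/2 u^lam sin²(v/2) cos^{k-2}(v/2) + u^{lam+2} cos^k(v/2)] ξ`. -/
def densP (lam : ℕ) (u v ξ : ℝ → ℝ) (Y : ℝ) : ℝ :=
  ((2 * (lam : ℝ) + 1) / 2 * u Y ^ lam * Real.sin (v Y / 2) ^ 2 *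
      Real.cos (v Y / 2) ^ (expo lam - 2) +
    u Y ^ (lam + 2) * Real.cos (v Y / 2) ^ expo lam) * ξ Y

/-- The density integrated in `Q` and `Q_x`: `u^{lam-1} sin³(v/2) cos^{k-3}(v/2) ξ`
(used for `1 ≤ lam`, so that the exponents are genuine). -/
def densQ (lam : ℕ) (u v ξ : ℝ → ℝ) (Y : ℝ) : ℝ :=
  u Y ^ (lam - 1) * Real.sin (v Y / 2) ^ 3 * Real.cos (v Y / 2) ^ (expo lam - 3) * ξ Y

/-- The nonlocal term `P` in the characteristic coordinate. -/
def opP (lam : ℕ) (u v ξ : ℝ → ℝ) (Y : ℝ) : ℝ :=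
  1 / 2 * ∫ Y', kernel lam v ξ Y Y' * densP lam u v ξ Y'

/-- The nonlocal term `P_x` in the characteristic coordinate. -/
def opPx (lam : ℕ) (u v ξ : ℝ → ℝ) (Y : ℝ) : ℝ :=
  1 / 2 * ((∫ Y' in Ioi Y, kernel lam v ξ Y Y' * densP lam u v ξ Y') -
    ∫ Y' in Iio Y, kernel lam v ξ Y Y' * densP lam u v ξ Y')

/-- The nonlocal term `Q` in the characteristic coordinate. -/
def opQ (lam : ℕ) (u v ξ : ℝ → ℝ) (Y : ℝ) : ℝ :=
  (lam : ℝ) / 4 * ∫ Y', kernel lam v ξ Y Y' * densQ lam u v ξ Y'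

/-- The nonlocal term `Q_x` in the characteristic coordinate. -/
def opQx (lam : ℕ) (u v ξ : ℝ → ℝ) (Y : ℝ) : ℝ :=
  (lam : ℝ) / 4 * ((∫ Y' in Ioi Y, kernel lam v ξ Y Y' * densQ lam u v ξ Y') -
    ∫ Y' in Iio Y, kernel lam v ξ Y Y' * densQ lam u v ξ Y')

/-- Right-hand side of the equation for `u_T`. -/
def rhsU (lam : ℕ) (u v ξ : ℝ → ℝ) (Y : ℝ) : ℝ :=
  - opPx lam u v ξ Y - opQ lam u v ξ Y

/-- Right-hand side of the equation for `v_T`. -/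
def rhsV (lam : ℕ) (u v ξ : ℝ → ℝ) (Y : ℝ) : ℝ :=
  - u Y ^ lam * Real.sin (v Y / 2) ^ 2 + 2 * u Y ^ (lam + 2) * Real.cos (v Y / 2) ^ 2 -
    2 * Real.cos (v Y / 2) ^ 2 * (opP lam u v ξ Y + opQx lam u v ξ Y)

/-- Right-hand side of the equation for `ξ_T`. -/
def rhsXi (lam : ℕ) (u v ξ : ℝ → ℝ) (Y : ℝ) : ℝ :=
  ((lam : ℝ) + 1) / 2 * u Y ^ lam * ξ Y * Real.sin (v Y) +
    ((lam : ℝ) + 1) * u Y ^ (lam + 2) * ξ Y * Real.sin (v Y) -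
    ((lam : ℝ) + 1) * ξ Y * Real.sin (v Y) * (opP lam u v ξ Y + opQx lam u v ξ Y)

/-- The characteristic coordinate at time zero, `x ↦ ∫_0^x (1 + (u₀)_x²)^{k/2}`,
where `k / 2 = lam + 1`. -/
def label (lam : ℕ) (u₀ : ℝ → ℝ) (x : ℝ) : ℝ :=
  ∫ s in (0 : ℝ)..x, (1 + weakDeriv u₀ s ^ 2) ^ (lam + 1)

/-- The inverse `Y ↦ x₀(Y)` of the bijection `label lam u₀` (see `label_bijective`). -/
def x₀ (lam : ℕ) (u₀ : ℝ → ℝ) : ℝ → ℝ :=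
  Function.invFun (label lam u₀)

/-- `(u, v, ξ)`, functions of `(T, Y)`, solve on `[0, T₀]` the Cauchy problem of the semilinear
system with data `u(0, Y) = u₀(x₀(Y))`, `v(0, Y) = 2 arctan ((u₀)_x (x₀(Y)))`, `ξ(0, Y) = 1`:
they form a continuous curve in `X`, and for almost every `Y` the three equations hold at every
time `T ∈ [0, T₀]` (with one-sided derivatives at the endpoints). -/
structure IsSolution (lam : ℕ) (u₀ : ℝ → ℝ) (T₀ : ℝ) (u v ξ : ℝ → ℝ → ℝ) : Prop where
  mem : ∀ T ∈ Icc 0 T₀, MemX lam (u T) (v T) (ξ T)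
  cont : ∀ T ∈ Icc 0 T₀,
    Tendsto (fun S => normX lam (u S - u T) (v S - v T) (ξ S - ξ T)) (𝓝[Icc 0 T₀] T) (𝓝 0)
  eq_u : ∀ᵐ Y, ∀ T ∈ Icc 0 T₀,
    HasDerivWithinAt (fun t => u t Y) (rhsU lam (u T) (v T) (ξ T) Y) (Icc 0 T₀) T
  eq_v : ∀ᵐ Y, ∀ T ∈ Icc 0 T₀,
    HasDerivWithinAt (fun t => v t Y) (rhsV lam (u T) (v T) (ξ T) Y) (Icc 0 T₀) T
  eq_ξ : ∀ᵐ Y, ∀ T ∈ Icc 0 T₀,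
    HasDerivWithinAt (fun t => ξ t Y) (rhsXi lam (u T) (v T) (ξ T) Y) (Icc 0 T₀) T
  init_u : ∀ᵐ Y, u 0 Y = u₀ (x₀ lam u₀ Y)
  init_v : ∀ᵐ Y, v 0 Y = 2 * Real.arctan (weakDeriv u₀ (x₀ lam u₀ Y))
  init_ξ : ∀ᵐ Y, ξ 0 Y = 1

theorem IsWeakDeriv.ae_eq {f g h : ℝ → ℝ} (hg : IsWeakDeriv f g) (hh : IsWeakDeriv f h) :
    g =ᵐ[volume] h := by
  refine ae_eq_of_integral_contDiff_smul_eq hg.2.1 hh.2.1 fun φ hφ hc => ?_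
  have := (hg.2.2 φ hφ hc).symm.trans (hh.2.2 φ hφ hc)
  simpa [mul_comm] using this

theorem weakDeriv_spec {f g : ℝ → ℝ} (hg : IsWeakDeriv f g) : IsWeakDeriv f (weakDeriv f) := by
  have h : ∃ g, IsWeakDeriv f g := ⟨g, hg⟩
  rw [weakDeriv, dif_pos h]
  exact h.choose_spec

theorem label_bijective {lam : ℕ} {u₀ : ℝ → ℝ} (h : MemW1 (expo lam) u₀) :
    Function.Bijective (label lam u₀) := by
  obtain ⟨-, g, hg, hgp⟩ := h
  have hd : MemLp (weakDeriv u₀) (expo lam) volume :=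
    hgp.ae_eq (hg.ae_eq (weakDeriv_spec hg))
  set w := weakDeriv u₀ with hw
  set F : ℝ → ℝ := fun s => (1 + w s ^ 2) ^ (lam + 1) with hF
  have hone : ∀ s, 1 ≤ F s := fun s => one_le_pow₀ (by nlinarith [sq_nonneg (w s)])
  have hpow : Integrable (fun s => w s ^ expo lam) volume := by
    have h1 := hd.integrable_norm_pow (by simp [expo])
    refine h1.congr (Eventually.of_forall fun s => ?_)
    have : Even (expo lam) := ⟨lam + 1, by simp [expo]; ring⟩
    simp [this.pow_abs]
  have hint : ∀ a b, IntervalIntegrable F volume a b := by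
    intro a b
    have hdom : IntervalIntegrable (fun s => 2 ^ lam * (1 + w s ^ expo lam)) volume a b :=
      (intervalIntegrable_const.add hpow.intervalIntegrable).const_mul _
    refine hdom.mono_fun ?_ (Eventually.of_forall fun s => ?_)
    · have : AEStronglyMeasurable w volume := hd.1
      exact ((((this.pow 2).const_add 1)).pow (lam + 1)).restrict
    · have h2 := add_pow_le (zero_le_one' ℝ) (sq_nonneg (w s)) (lam + 1)
      have h3 : (w s ^ 2) ^ (lam + 1) = w s ^ expo lam := by rw [← pow_mul]; rfl
      have h0 : 0 ≤ F s := zero_le_one.trans (hone s)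
      change ‖F s‖ ≤ ‖_‖
      rw [Real.norm_of_nonneg h0]
      refine le_trans ?_ (le_abs_self _)
      simpa [h3] using h2
  have hdiff : ∀ a b, a ≤ b → b - a ≤ label lam u₀ b - label lam u₀ a := by
    intro a b hab
    have h1 : label lam u₀ b - label lam u₀ a = ∫ s in a..b, F s :=
      intervalIntegral.integral_interval_sub_left (hint 0 b) (hint 0 a)
    rw [h1]
    have := intervalIntegral.integral_mono_on hab intervalIntegrable_const (hint a b)
      fun s _ => hone s
    simpa using this
  have hmono : StrictMono (label lam u₀) := fun a b hab => by
    have := hdiff a b hab.le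
    linarith
  have h0 : label lam u₀ 0 = 0 := by simp [label]
  have hcont : Continuous (label lam u₀) := intervalIntegral.continuous_primitive hint 0
  refine ⟨hmono.injective, hcont.surjective ?_ ?_⟩
  · refine tendsto_atTop_mono' _ ?_ tendsto_id
    filter_upwards [eventually_ge_atTop 0] with x hx
    have := hdiff 0 x hx
    simp only [id]; linarith
  · refine tendsto_atBot_mono' _ ?_ tendsto_id
    filter_upwards [eventually_le_atBot 0] with x hx
    have := hdiff x 0 hx
    simp only [id]; linarith

end LambdaFamily

end

/-! In the characteristic coordinate the system is an ordinary differential equation for the profile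
`w = (u, v, ξ)`, so the theorem follows from a Lipschitz estimate for the right-hand side in a
suitable norm. Differences of profiles are measured pointwise against a positive weight `ρ`: the
size of `w - w'` is the least `d` with `‖w Y - w' Y‖ ≤ d * ρ Y`. All pointwise nonlinear terms are
harmless in such a sup norm, and only the nonlocal terms need work.

The kernel decays because `ξ ≥ m > 0` and `cos^k (v/2) ≥ 2^{-k} (1 - v²)`: since `v` lies in `L²`,
the integral of the density over an interval is at least a multiple of its length minus a constant.
If the convolution of `exp (-r |·|)` with `ρ` is at most `A ρ`, the nonlocal terms are then bounded
by `ρ` and Lipschitz relative to it (`exists_nonloc_bound`, `exists_field_bound`).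

Existence: `exists_weight` gives a bounded weight in `L²` that dominates the data, and
Picard–Lindelöf is applied to `(w - w₀) / ρ` in a space of bounded functions defined at every point
(`exists_weighted_solution`), so that the equations hold for every `Y`. It remains to see that `u`
stays in `H¹ ∩ W^{1,k}`. The function `sin (v/2) cos^{k-1} (v/2) ξ` evolves exactly as the
`Y`-derivative of `u` should, and equals it at time zero, so it is that derivative at all times
(`LocalFlow.hasACDeriv_fst`). It is bounded by a multiple of `ρ`, which yields membership in `X` and
continuity in time.

Uniqueness: a solution in `X` is bounded, and its equation for `ξ` is linear in `ξ` with bounded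
coefficient, which keeps `ξ` away from zero (`IsSolution.exists_adm`). The same Lipschitz estimate
with the weight `1` is then iterated in time (`IsSolution.ae_eq`). -/

noncomputable section

namespace LambdaFamily

/-! ### Absolutely continuous functions and weak derivatives on the line. -/

/-- `f` is locally absolutely continuous with almost everywhere derivative `g`. -/
def HasACDeriv (f g : ℝ → ℝ) : Prop :=
  (∀ a b, AbsolutelyContinuousOnInterval f a b) ∧ ∀ᵐ x, HasDerivAt f (g x) x

namespace HasACDeriv

variable {f g f₁ g₁ : ℝ → ℝ}

theorem deriv_ae_eq (h : HasACDeriv f g) : deriv f =ᵐ[volume] g :=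
  h.2.mono fun _ hx => hx.deriv

theorem intervalIntegrable (h : HasACDeriv f g) (a b : ℝ) : IntervalIntegrable g volume a b :=
  (h.1 a b).intervalIntegrable_deriv.congr_ae (ae_restrict_of_ae h.deriv_ae_eq)

theorem integral_eq_sub (h : HasACDeriv f g) (a b : ℝ) : ∫ x in a..b, g x = f b - f a := by
  rw [← (h.1 a b).integral_deriv_eq_sub]
  exact intervalIntegral.integral_congr_ae (h.deriv_ae_eq.mono fun x hx _ => hx.symm)

theorem continuous (h : HasACDeriv f g) : Continuous f := by
  refine continuous_iff_continuousAt.2 fun x => ?_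
  refine (h.1 (x - 1) (x + 1)).continuousOn.continuousAt ?_
  rw [uIcc_of_le (by linarith)]
  exact Icc_mem_nhds (by linarith) (by linarith)

theorem congr_deriv (h : HasACDeriv f g) (hg : g =ᵐ[volume] g₁) : HasACDeriv f g₁ :=
  ⟨h.1, by filter_upwards [h.2, hg] with x hx hgx; rwa [← hgx]⟩

theorem of_primitive (hg : ∀ a b, IntervalIntegrable g volume a b)
    (h : ∀ x, f x - f 0 = ∫ t in (0 : ℝ)..x, g t) : HasACDeriv f g := by
  have hf : f = fun x => f 0 + ∫ t in (0 : ℝ)..x, g t := by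
    funext x; rw [← h x]; ring
  have hl : LocallyIntegrable g volume := by
    refine locallyIntegrable_iff.2 fun K hK => ?_
    obtain ⟨a, ha⟩ := hK.bddBelow
    obtain ⟨b, hb⟩ := hK.bddAbove
    by_cases hab : a ≤ b
    · refine ((intervalIntegrable_iff_integrableOn_Icc_of_le hab).1 (hg a b)).mono_set ?_
      exact fun x hx => ⟨ha hx, hb hx⟩
    · have : K = ∅ := by
        refine eq_empty_of_forall_notMem fun x hx => hab ((ha hx).trans (hb hx))
      simp [this]
  constructor
  · intro a b
    rw [hf]
    -- The interval is enlarged to contain the base point `0` of the primitive, then restricted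
    -- back.
    have h1 : AbsolutelyContinuousOnInterval (fun x => ∫ t in (0 : ℝ)..x, g t)
        (min 0 (min a b)) (max 0 (max a b)) := by
      refine (hg _ _).absolutelyContinuousOnInterval_intervalIntegral ?_
      rw [uIcc_of_le (by simp)]
      simp
    have h2 : AbsolutelyContinuousOnInterval (fun _ : ℝ => f 0) a b :=
      (LipschitzWith.const (f 0)).lipschitzOnWith.absolutelyContinuousOnInterval
    have h3 := h1.mono (c := a) (d := b) (by
      rw [uIcc_of_le (show min 0 (min a b) ≤ max 0 (max a b) by simp)]
      exact Icc_subset_Icc (min_le_right _ _) (le_max_right _ _))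
    exact h2.fun_add h3
  · filter_upwards [_root_.LocallyIntegrable.ae_hasDerivAt_integral hl] with x hx
    rw [hf]
    exact (hx 0).const_add _

theorem primitive (hg : ∀ a b, IntervalIntegrable g volume a b) (c : ℝ) :
    HasACDeriv (fun x => ∫ t in c..x, g t) g := by
  refine of_primitive hg fun x => ?_
  rw [intervalIntegral.integral_symm 0 c, sub_neg_eq_add, add_comm]
  exact intervalIntegral.integral_add_adjacent_intervals (hg _ _) (hg _ _)

theorem add (h : HasACDeriv f g) (h₁ : HasACDeriv f₁ g₁) :
    HasACDeriv (fun x => f x + f₁ x) (fun x => g x + g₁ x) :=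
  ⟨fun a b => (h.1 a b).fun_add (h₁.1 a b), by
    filter_upwards [h.2, h₁.2] with x hx hx₁ using hx.add hx₁⟩

theorem const_mul (h : HasACDeriv f g) (c : ℝ) :
    HasACDeriv (fun x => c * f x) (fun x => c * g x) :=
  ⟨fun a b => (h.1 a b).const_mul c, by filter_upwards [h.2] with x hx using hx.const_mul c⟩

theorem mul (h : HasACDeriv f g) (h₁ : HasACDeriv f₁ g₁) :
    HasACDeriv (fun x => f x * f₁ x) (fun x => g x * f₁ x + f x * g₁ x) :=
  ⟨fun a b => (h.1 a b).fun_mul (h₁.1 a b), by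
    filter_upwards [h.2, h₁.2] with x hx hx₁ using hx.mul hx₁⟩

theorem neg (h : HasACDeriv f g) : HasACDeriv (fun x => - f x) (fun x => - g x) := by
  simpa using h.const_mul (-1)

theorem sub (h : HasACDeriv f g) (h₁ : HasACDeriv f₁ g₁) :
    HasACDeriv (fun x => f x - f₁ x) (fun x => g x - g₁ x) := by
  simpa [sub_eq_add_neg] using h.add h₁.neg

theorem comp_contDiff (h : HasACDeriv f g) {φ : ℝ → ℝ} (hφ : ContDiff ℝ 1 φ) :
    HasACDeriv (fun x => φ (f x)) (fun x => deriv φ (f x) * g x) := by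
  constructor
  · intro a b
    obtain ⟨C, hC⟩ := (h.1 a b).exists_bound
    obtain ⟨K, hK⟩ := hφ.contDiffOn.exists_lipschitzOnWith (s := Icc (-C) C) one_ne_zero
      (convex_Icc _ _) isCompact_Icc
    have hac := h.1 a b
    rw [absolutelyContinuousOnInterval_iff] at hac ⊢
    intro ε hε
    -- On the range of `f`, contained in `[-C, C]`, `φ` is `K`-Lipschitz; the `+ 1` covers the case
    -- `K = 0`.
    obtain ⟨δ, hδ, H⟩ := hac (ε / (K + 1)) (by positivity)
    refine ⟨δ, hδ, fun E hE hlt => ?_⟩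
    have h1 := H E hE hlt
    have h2 : ∑ i ∈ Finset.range E.1, dist (φ (f (E.2 i).1)) (φ (f (E.2 i).2)) ≤
        ∑ i ∈ Finset.range E.1, K * dist (f (E.2 i).1) (f (E.2 i).2) := by
      refine Finset.sum_le_sum fun i hi => hK.dist_le_mul _ ?_ _ ?_
      · exact abs_le.1 (hC _ (hE.1 i hi).1)
      · exact abs_le.1 (hC _ (hE.1 i hi).2)
    rw [← Finset.mul_sum] at h2
    have h3 : (0 : ℝ) ≤ ∑ i ∈ Finset.range E.1, dist (f (E.2 i).1) (f (E.2 i).2) :=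
      Finset.sum_nonneg fun i _ => dist_nonneg
    rw [lt_div_iff₀ (by positivity)] at h1
    nlinarith
  · filter_upwards [h.2] with x hx
    exact ((hφ.differentiable one_ne_zero).differentiableAt.hasDerivAt).comp x hx

/-- Integration by parts on an interval `[-R, R]` outside which the test function vanishes. -/
theorem isWeakDeriv (h : HasACDeriv f g) : IsWeakDeriv f g := by
  refine ⟨h.continuous.locallyIntegrable, ?_, ?_⟩
  · refine locallyIntegrable_iff.2 fun K hK => ?_
    obtain ⟨R, hR⟩ := hK.isBounded.subset_closedBall 0
    refine IntegrableOn.mono_set ?_ hR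
    rw [Real.closedBall_eq_Icc]
    by_cases hab : 0 - R ≤ 0 + R
    · exact (intervalIntegrable_iff_integrableOn_Icc_of_le hab).1 (h.intervalIntegrable _ _)
    · rw [Icc_eq_empty hab]; exact integrableOn_empty
  · intro φ hφ hc
    obtain ⟨R, hR, hsupp⟩ : ∃ R, 0 < R ∧ tsupport φ ⊆ Ioo (-R) R := by
      obtain ⟨R, hR⟩ := hc.isBounded.subset_ball 0
      refine ⟨max R 1, by simp, hR.trans ?_⟩
      rw [Real.ball_eq_Ioo]
      exact Ioo_subset_Ioo (by simp) (by simp)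
    have hφ1 : ContDiff ℝ 1 φ := hφ.of_le (by exact_mod_cast le_top)
    have hφac : HasACDeriv φ (deriv φ) := by
      refine ⟨fun a b => hφ1.contDiffOn.absolutelyContinuousOnInterval,
        Eventually.of_forall fun x => ?_⟩
      exact (hφ1.differentiable one_ne_zero).differentiableAt.hasDerivAt
    have hzero : ∀ x, x ∉ Ioo (-R) R → φ x = 0 := fun x hx =>
      image_eq_zero_of_notMem_tsupport fun h' => hx (hsupp h')
    have hzero' : ∀ x, x ∉ Ioo (-R) R → deriv φ x = 0 := fun x hx =>
      image_eq_zero_of_notMem_tsupport fun h' => hx (hsupp (tsupport_deriv_subset h'))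
    have key := (h.mul hφac).integral_eq_sub (-R) R
    rw [hzero R (by simp), hzero (-R) (by simp), mul_zero, mul_zero, sub_zero,
      intervalIntegral.integral_add
        ((h.intervalIntegrable _ _).mul_continuousOn hφac.continuous.continuousOn)
        ((hφac.intervalIntegrable _ _).continuousOn_mul h.continuous.continuousOn)] at key
    have conv : ∀ F : ℝ → ℝ, (∀ x, x ∉ Ioo (-R) R → F x = 0) →
        ∫ x, F x = ∫ x in (-R)..R, F x := by
      intro F hF
      rw [intervalIntegral.integral_of_le (by linarith), setIntegral_eq_integral_of_forall_compl_eq_zero]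
      exact fun x hx => hF x fun h' => hx ⟨h'.1, h'.2.le⟩
    rw [conv _ fun x hx => by rw [hzero' x hx, mul_zero],
      conv (fun x => g x * φ x) fun x hx => by rw [hzero x hx, mul_zero]]
    linarith

/-- A locally absolutely continuous function that is square integrable together with its
derivative is bounded. -/
theorem abs_le_of_integrable_sq (h : HasACDeriv f g) (hf : Integrable fun x => f x ^ 2)
    (hg : Integrable fun x => g x ^ 2) (x : ℝ) :
    |f x| ≤ 2 + (∫ x, f x ^ 2) + ∫ x, g x ^ 2 := by
  -- The bound `|f x| ≤ |f y| + ∫ |g|` is averaged over `y` in the unit interval `[x, x + 1]`. The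
  -- inequality `|t| ≤ 1 + t²`, used once for `f` and once for `g`, produces the constant `2`.
  have hle : x ≤ x + 1 := by linarith
  have hint : ∀ F : ℝ → ℝ, Integrable (fun x => F x ^ 2) → ∀ y ∈ Icc x (x + 1),
      AEStronglyMeasurable F volume →
      ∫ t in x..y, |F t| ≤ 1 + ∫ t, F t ^ 2 := by
    intro F hF y hy hm
    have hdom : IntervalIntegrable (fun t => 1 + F t ^ 2) volume x y :=
      intervalIntegrable_const.add hF.intervalIntegrable
    have hi : IntervalIntegrable (fun t => |F t|) volume x y := by
      refine hdom.mono_fun hm.norm.restrict (Eventually.of_forall fun t => ?_)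
      change ‖|F t|‖ ≤ ‖1 + F t ^ 2‖
      rw [Real.norm_eq_abs, abs_abs, Real.norm_eq_abs,
        abs_of_nonneg (show 0 ≤ 1 + F t ^ 2 by positivity)]
      nlinarith [sq_abs (F t), sq_nonneg (|F t| - 1), abs_nonneg (F t)]
    have h1 := intervalIntegral.integral_mono_on hy.1 hi hdom fun t _ => by
      show |F t| ≤ 1 + F t ^ 2
      nlinarith [sq_abs (F t), sq_nonneg (|F t| - 1), abs_nonneg (F t)]
    rw [intervalIntegral.integral_add intervalIntegrable_const hF.intervalIntegrable,
      intervalIntegral.integral_const] at h1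
    have h2 : ∫ t in x..y, F t ^ 2 ≤ ∫ t, F t ^ 2 := by
      rw [intervalIntegral.integral_of_le hy.1]
      exact setIntegral_le_integral hF (Eventually.of_forall fun t => sq_nonneg _)
    have h3 := hy.2
    simp only [smul_eq_mul, mul_one] at h1
    linarith
  have hgm : AEStronglyMeasurable g volume :=
    (h.isWeakDeriv.2.1).aestronglyMeasurable
  have hpt : ∀ y ∈ Icc x (x + 1), |f x| ≤ |f y| + (1 + ∫ t, g t ^ 2) := by
    intro y hy
    have h1 := h.integral_eq_sub x y
    have h2 : |∫ t in x..y, g t| ≤ ∫ t in x..y, |g t| :=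
      intervalIntegral.abs_integral_le_integral_abs hy.1
    have h3 := hint g hg y hy hgm
    rw [h1] at h2
    have h4 := abs_sub_abs_le_abs_sub (f x) (f y)
    rw [abs_sub_comm] at h4
    linarith
  have hci : ∀ c : ℝ, IntervalIntegrable (fun y => |f y| + c) volume x (x + 1) := fun c =>
    (h.continuous.abs.add continuous_const).intervalIntegrable _ _
  have h1 := intervalIntegral.integral_mono_on hle (intervalIntegrable_const (μ := volume)) (hci _) hpt
  rw [intervalIntegral.integral_add (h.continuous.abs.intervalIntegrable _ _)
    intervalIntegrable_const] at h1
  have h2 := hint f hf (x + 1) ⟨hle, le_rfl⟩ h.continuous.aestronglyMeasurable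
  simp at h1
  linarith

end HasACDeriv

/-- A function with weak derivative `0` is almost everywhere constant. -/
theorem IsWeakDeriv.ae_eq_const {f : ℝ → ℝ} (h : IsWeakDeriv f 0) :
    ∃ c, f =ᵐ[volume] fun _ => c := by
  let ψ : ContDiffBump (0 : ℝ) := default
  set ρ : ℝ → ℝ := ψ.normed volume
  have hρ : ContDiff ℝ ∞ ρ := ψ.contDiff_normed
  have hρc : HasCompactSupport ρ := ψ.hasCompactSupport_normed
  have hρ1 : ∫ x, ρ x = 1 := ψ.integral_normed
  refine ⟨∫ x, f x * ρ x, ae_eq_of_integral_contDiff_smul_eq h.1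
    (locallyIntegrable_const _) fun φ hφ hc => ?_⟩
  set m := ∫ x, φ x
  -- Subtracting a multiple of a bump of mass one gives a function of mean zero, whose primitive has
  -- compact support and is therefore an admissible test function.
  set θ : ℝ → ℝ := fun x => φ x - m * ρ x with hθ
  have hθd : ContDiff ℝ ∞ θ := hφ.sub (contDiff_const.mul hρ)
  have hθc : HasCompactSupport θ := hc.sub hρc.mul_left
  have hφi : Integrable φ := hφ.continuous.integrable_of_hasCompactSupport hc
  have hρi : Integrable ρ := hρ.continuous.integrable_of_hasCompactSupport hρc
  have hθi : Integrable θ := hφi.sub (hρi.const_mul _)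
  have hθ0 : ∫ x, θ x = 0 := by
    rw [hθ, integral_sub hφi (hρi.const_mul _), integral_const_mul, hρ1]; simp [m]
  obtain ⟨R, hR⟩ : ∃ R, tsupport θ ⊆ Ioo (-R) R := by
    obtain ⟨R, hR⟩ := hθc.isBounded.subset_ball 0
    refine ⟨R, hR.trans ?_⟩
    rw [Real.ball_eq_Ioo]
    simp
  have hz : ∀ x, x ∉ Ioo (-R) R → θ x = 0 := fun x hx =>
    image_eq_zero_of_notMem_tsupport fun h' => hx (hR h')
  set Θ : ℝ → ℝ := fun x => ∫ t in (-R)..x, θ t with hΘ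
  have hΘd : ∀ x, HasDerivAt Θ (θ x) x := fun x =>
    intervalIntegral.integral_hasDerivAt_right (hθd.continuous.intervalIntegrable _ _)
      hθd.continuous.stronglyMeasurable.stronglyMeasurableAtFilter hθd.continuous.continuousAt
  have hΘder : deriv Θ = θ := funext fun x => (hΘd x).deriv
  have hΘc : ContDiff ℝ ∞ Θ := by
    rw [contDiff_infty_iff_deriv, hΘder]
    exact ⟨fun x => (hΘd x).differentiableAt, hθd⟩
  have hΘs : HasCompactSupport Θ := by
    refine HasCompactSupport.intro (isCompact_Icc (a := -R) (b := R)) fun x hx => ?_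
    rcases lt_or_ge x (-R) with h1 | h1
    · show ∫ t in (-R)..x, θ t = 0
      rw [intervalIntegral.integral_symm, intervalIntegral.integral_zero_ae, neg_zero]
      refine Eventually.of_forall fun t ht => hz t fun h' => ?_
      rw [uIoc_of_le h1.le] at ht
      linarith [h'.1, ht.2]
    · have hxR : R < x := by
        by_contra hcon
        exact hx ⟨h1, not_lt.1 hcon⟩
      show ∫ t in (-R)..x, θ t = 0
      rw [intervalIntegral.integral_of_le h1, setIntegral_eq_integral_of_forall_compl_eq_zero, hθ0]
      exact fun t ht => hz t fun h' => ht ⟨h'.1, (h'.2.trans hxR).le⟩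
  have key := h.2.2 Θ hΘc hΘs
  have hfφ : Integrable fun x => f x * φ x := by
    simpa [mul_comm] using h.1.integrable_smul_left_of_hasCompactSupport hφ.continuous hc
  have hfρ : Integrable fun x => f x * ρ x := by
    simpa [mul_comm] using h.1.integrable_smul_left_of_hasCompactSupport hρ.continuous hρc
  rw [hΘder] at key
  have h2 : ∫ x, f x * θ x = (∫ x, f x * φ x) - m * ∫ x, f x * ρ x := by
    rw [← integral_const_mul, ← integral_sub hfφ (hfρ.const_mul _)]
    exact integral_congr_ae (Eventually.of_forall fun x => by simp only [hθ]; ring)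
  rw [h2] at key
  simp only [Pi.zero_apply, zero_mul, integral_zero, neg_zero] at key
  simp only [smul_eq_mul]
  rw [integral_mul_const, show (∫ x, φ x * f x) = ∫ x, f x * φ x by simp_rw [mul_comm]]
  linarith

theorem IsWeakDeriv.sub {f g f₁ g₁ : ℝ → ℝ} (h : IsWeakDeriv f g) (h₁ : IsWeakDeriv f₁ g₁) :
    IsWeakDeriv (f - f₁) (g - g₁) := by
  refine ⟨h.1.sub h₁.1, h.2.1.sub h₁.2.1, fun φ hφ hc => ?_⟩
  have hφ' : Continuous (deriv φ) := hφ.continuous_deriv (by exact_mod_cast le_top)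
  have i1 : ∀ F : ℝ → ℝ, LocallyIntegrable F → Integrable fun x => F x * deriv φ x := fun F hF => by
    simpa [mul_comm] using hF.integrable_smul_left_of_hasCompactSupport hφ' hc.deriv
  have i2 : ∀ F : ℝ → ℝ, LocallyIntegrable F → Integrable fun x => F x * φ x := fun F hF => by
    simpa [mul_comm] using hF.integrable_smul_left_of_hasCompactSupport hφ.continuous hc
  simp only [Pi.sub_apply, sub_mul]
  rw [integral_sub (i1 _ h.1) (i1 _ h₁.1), integral_sub (i2 _ h.2.1) (i2 _ h₁.2.1),
    h.2.2 φ hφ hc, h₁.2.2 φ hφ hc]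
  ring

/-- `f` minus a primitive of `g` has weak derivative zero, hence is almost everywhere constant. -/
theorem IsWeakDeriv.exists_hasACDeriv {f g : ℝ → ℝ} (h : IsWeakDeriv f g) :
    ∃ F, HasACDeriv F g ∧ f =ᵐ[volume] F := by
  have hg : ∀ a b, IntervalIntegrable g volume a b := fun a b =>
    intervalIntegrable_iff.2 ((h.2.1.integrableOn_isCompact isCompact_uIcc).mono_set uIoc_subset_uIcc)
  have hF := HasACDeriv.primitive hg 0
  have h0 := h.sub hF.isWeakDeriv
  rw [sub_self] at h0
  obtain ⟨c, hc⟩ := h0.ae_eq_const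
  refine ⟨fun x => c + ∫ t in (0 : ℝ)..x, g t, HasACDeriv.of_primitive hg fun x => ?_, ?_⟩
  · simp
  · filter_upwards [hc] with x hx
    simp only [Pi.sub_apply] at hx
    linarith

theorem HasACDeriv.weakDeriv_ae_eq {f g : ℝ → ℝ} (h : HasACDeriv f g) :
    weakDeriv f =ᵐ[volume] g :=
  (weakDeriv_spec h.isWeakDeriv).ae_eq h.isWeakDeriv

end LambdaFamily
end

/-! ### Integrals against the exponential kernel, estimated relative to a weight. -/

noncomputable section

namespace LambdaFamily

/-- The kernel `exp (- |∫_Y^{Y'} q|)` with density `q`. -/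
def expKer (q : ℝ → ℝ) (Y Y' : ℝ) : ℝ := Real.exp (-|∫ s in Y..Y', q s|)

/-- The integral of `f` against the kernel with density `q` over the set `s`. -/
def kint (s : Set ℝ) (q f : ℝ → ℝ) (Y : ℝ) : ℝ := ∫ Y' in s, expKer q Y Y' * f Y'

/-- Bounded densities whose integrals over long intervals grow at rate at least `c`. -/
structure Coercive (c C : ℝ) (q : ℝ → ℝ) : Prop where
  intervalIntegrable : ∀ a b, IntervalIntegrable q volume a b
  lower : ∀ a b, a ≤ b → c * (b - a) - C ≤ ∫ s in a..b, q s

/-- Positive weights that are almost subsolutions of convolution with `exp (-r |·|)`. -/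
structure Weight (r A : ℝ) (ρ : ℝ → ℝ) : Prop where
  pos : ∀ Y, 0 < ρ Y
  aesm : AEStronglyMeasurable ρ volume
  integrable : ∀ Y, Integrable (fun Y' => Real.exp (-(r * |Y' - Y|)) * ρ Y')
  le : ∀ Y, ∫ Y', Real.exp (-(r * |Y' - Y|)) * ρ Y' ≤ A * ρ Y

variable {c C r A : ℝ} {q q' f f' ρ : ℝ → ℝ}

theorem expKer_pos (q : ℝ → ℝ) (Y Y' : ℝ) : 0 < expKer q Y Y' := Real.exp_pos _

theorem expKer_le_one (q : ℝ → ℝ) (Y Y' : ℝ) : expKer q Y Y' ≤ 1 := by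
  simp [expKer]

namespace Coercive

theorem lower_abs (h : Coercive c C q) (Y Y' : ℝ) :
    c * |Y' - Y| - C ≤ |∫ s in Y..Y', q s| := by
  rcases le_total Y Y' with hY | hY
  · rw [abs_of_nonneg (sub_nonneg.2 hY)]
    exact (h.lower _ _ hY).trans (le_abs_self _)
  · rw [abs_of_nonpos (sub_nonpos.2 hY), intervalIntegral.integral_symm, abs_neg, neg_sub]
    exact (h.lower _ _ hY).trans (le_abs_self _)

theorem expKer_le (h : Coercive c C q) (Y Y' : ℝ) :
    expKer q Y Y' ≤ Real.exp C * Real.exp (-(c * |Y' - Y|)) := by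
  rw [← Real.exp_add]
  exact Real.exp_le_exp.2 (by linarith [h.lower_abs Y Y'])

theorem continuous_expKer (h : Coercive c C q) (Y : ℝ) : Continuous (expKer q Y) := by
  have := intervalIntegral.continuous_primitive h.intervalIntegrable Y
  exact Real.continuous_exp.comp this.abs.neg

end Coercive

theorem abs_exp_neg_sub_exp_neg_le {x y m : ℝ} (hx : m ≤ x) (hy : m ≤ y) :
    |Real.exp (-x) - Real.exp (-y)| ≤ Real.exp (-m) * |x - y| := by
  wlog hxy : x ≤ y generalizing x y
  · rw [abs_sub_comm, abs_sub_comm x y]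
    exact this hy hx (le_of_not_ge hxy)
  have h1 : Real.exp (-y) ≤ Real.exp (-x) := Real.exp_le_exp.2 (by linarith)
  rw [abs_of_nonneg (by linarith), abs_of_nonpos (by linarith)]
  have h2 : Real.exp (-y) = Real.exp (-x) * Real.exp (-(y - x)) := by
    rw [← Real.exp_add]; ring_nf
  have h3 := Real.add_one_le_exp (-(y - x))
  have h4 : Real.exp (-x) ≤ Real.exp (-m) := Real.exp_le_exp.2 (by linarith)
  have h5 := Real.exp_pos (-x)
  rw [h2]
  nlinarith

/-- A linear factor is absorbed by giving up half of the decay rate. This is why the weights below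
have rate `c / 2` when the kernel decays at rate `c`. -/
theorem mul_exp_neg_le (hc : 0 < c) {t : ℝ} :
    t * Real.exp (-(c * t)) ≤ 2 / c * Real.exp (-(c / 2 * t)) := by
  have h1 : Real.exp (-(c * t)) = Real.exp (-(c / 2 * t)) * Real.exp (-(c / 2 * t)) := by
    rw [← Real.exp_add]; ring_nf
  have h2 := Real.add_one_le_exp (c / 2 * t)
  have h3 : Real.exp (c / 2 * t) * Real.exp (-(c / 2 * t)) = 1 := by
    rw [← Real.exp_add]; simp
  have h4 := Real.exp_pos (-(c / 2 * t))
  have h5 : c / 2 * t * Real.exp (-(c / 2 * t)) ≤ 1 := by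
    rw [← h3]; exact mul_le_mul_of_nonneg_right (by linarith) h4.le
  have h6 : t * Real.exp (-(c / 2 * t)) ≤ 2 / c := by
    rw [le_div_iff₀ hc]; linarith
  rw [h1, ← mul_assoc]
  exact mul_le_mul_of_nonneg_right h6 h4.le

/-- The two exponents differ by at most `d |Y' - Y|`, and each is at least `c |Y' - Y| - C`; the
mean value inequality leaves a linear factor, which `mul_exp_neg_le` absorbs. -/
theorem Coercive.abs_expKer_sub_le (hc : 0 < c) (h : Coercive c C q) (h' : Coercive c C q')
    {d : ℝ} (hd : ∀ᵐ s, |q s - q' s| ≤ d) (Y Y' : ℝ) :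
    |expKer q Y Y' - expKer q' Y Y'| ≤
      Real.exp C * (2 / c) * d * Real.exp (-(c / 2 * |Y' - Y|)) := by
  have hd0 : 0 ≤ d := by
    obtain ⟨s, hs⟩ := hd.exists
    exact (abs_nonneg _).trans hs
  have h1 := abs_exp_neg_sub_exp_neg_le (h.lower_abs Y Y') (h'.lower_abs Y Y')
  have h2 : |(|∫ s in Y..Y', q s|) - (|∫ s in Y..Y', q' s|)| ≤ d * |Y' - Y| := by
    refine (abs_abs_sub_abs_le _ _).trans ?_
    rw [← intervalIntegral.integral_sub (h.intervalIntegrable _ _) (h'.intervalIntegrable _ _)]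
    exact intervalIntegral.norm_integral_le_of_norm_le_const_ae
      (f := fun s => q s - q' s) (hd.mono fun x hx _ => hx)
  have h3 : Real.exp (-(c * |Y' - Y| - C)) = Real.exp C * Real.exp (-(c * |Y' - Y|)) := by
    rw [← Real.exp_add]; ring_nf
  have h4 := mul_exp_neg_le hc (t := |Y' - Y|)
  have h5 := Real.exp_pos C
  rw [h3] at h1
  calc _ ≤ _ := h1
    _ ≤ Real.exp C * Real.exp (-(c * |Y' - Y|)) * (d * |Y' - Y|) := by gcongr
    _ = Real.exp C * d * (|Y' - Y| * Real.exp (-(c * |Y' - Y|))) := by ring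
    _ ≤ Real.exp C * d * (2 / c * Real.exp (-(c / 2 * |Y' - Y|))) := by gcongr
    _ = _ := by ring

namespace Weight

theorem nonneg_const (hρ : Weight r A ρ) : 0 ≤ A := by
  have h := hρ.le 0
  have h0 : 0 ≤ ∫ Y', Real.exp (-(r * |Y' - 0|)) * ρ Y' :=
    integral_nonneg fun Y' => mul_nonneg (Real.exp_pos _).le (hρ.pos _).le
  by_contra hA
  nlinarith [hρ.pos 0]

theorem integrable_of_le (hρ : Weight r A ρ) {F : ℝ → ℝ} (hF : AEStronglyMeasurable F volume)
    {B Y : ℝ} (hB : ∀ᵐ Y', |F Y'| ≤ B * (Real.exp (-(r * |Y' - Y|)) * ρ Y')) : Integrable F :=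
  ((hρ.integrable Y).const_mul B).mono' hF hB

theorem abs_integral_le (hρ : Weight r A ρ) {F : ℝ → ℝ} {B Y : ℝ} (hB0 : 0 ≤ B)
    (hB : ∀ᵐ Y', |F Y'| ≤ B * (Real.exp (-(r * |Y' - Y|)) * ρ Y')) (s : Set ℝ) :
    |∫ Y' in s, F Y'| ≤ B * A * ρ Y := by
  have hi := (hρ.integrable Y).const_mul B
  calc |∫ Y' in s, F Y'| ≤ ∫ Y' in s, B * (Real.exp (-(r * |Y' - Y|)) * ρ Y') :=
        norm_integral_le_of_norm_le (f := F) hi.integrableOn (ae_restrict_of_ae hB)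
    _ ≤ ∫ Y', B * (Real.exp (-(r * |Y' - Y|)) * ρ Y') :=
        setIntegral_le_integral hi (Eventually.of_forall fun Y' =>
          mul_nonneg hB0 (mul_nonneg (Real.exp_pos _).le (hρ.pos _).le))
    _ ≤ B * (A * ρ Y) := by
        rw [integral_const_mul]; exact mul_le_mul_of_nonneg_left (hρ.le Y) hB0
    _ = _ := by ring

end Weight

theorem Coercive.abs_expKer_mul_le (hc : 0 < c) (h : Coercive c C q)
    {F : ℝ} (hf : ∀ᵐ s, |f s| ≤ F * ρ s) (Y : ℝ) :
    ∀ᵐ Y', |expKer q Y Y' * f Y'| ≤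
      Real.exp C * F * (Real.exp (-(c / 2 * |Y' - Y|)) * ρ Y') := by
  filter_upwards [hf] with Y' hY'
  have h1 := h.expKer_le Y Y'
  have h2 : Real.exp (-(c * |Y' - Y|)) ≤ Real.exp (-(c / 2 * |Y' - Y|)) :=
    Real.exp_le_exp.2 (by nlinarith [abs_nonneg (Y' - Y)])
  rw [abs_mul, abs_of_pos (expKer_pos _ _ _)]
  calc expKer q Y Y' * |f Y'|
      ≤ (Real.exp C * Real.exp (-(c / 2 * |Y' - Y|))) * (F * ρ Y') := by
        gcongr
        exact h1.trans (by gcongr)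
    _ = _ := by ring

theorem Coercive.integrable_expKer_mul (hc : 0 < c) (hρ : Weight (c / 2) A ρ) (h : Coercive c C q)
    (hfm : AEStronglyMeasurable f volume) {F : ℝ} (hf : ∀ᵐ s, |f s| ≤ F * ρ s) (Y : ℝ) :
    Integrable fun Y' => expKer q Y Y' * f Y' :=
  hρ.integrable_of_le ((h.continuous_expKer Y).aestronglyMeasurable.mul hfm)
    (h.abs_expKer_mul_le hc hf Y)

theorem Coercive.abs_kint_le (hc : 0 < c) (hρ : Weight (c / 2) A ρ) (h : Coercive c C q)
    {F : ℝ} (hF : 0 ≤ F) (hf : ∀ᵐ s, |f s| ≤ F * ρ s) (s : Set ℝ) (Y : ℝ) :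
    |kint s q f Y| ≤ Real.exp C * F * A * ρ Y :=
  hρ.abs_integral_le (by positivity) (h.abs_expKer_mul_le hc hf Y) s

/-- The integrand is split as `(K - K') f + K' (f - f')`, where `K`, `K'` are the two kernels. -/
theorem Coercive.abs_kint_sub_le (hc : 0 < c) (hρ : Weight (c / 2) A ρ) (h : Coercive c C q)
    (h' : Coercive c C q') (hfm : AEStronglyMeasurable f volume)
    (hfm' : AEStronglyMeasurable f' volume) {F d D : ℝ} (hF : 0 ≤ F)
    (hf : ∀ᵐ s, |f s| ≤ F * ρ s) (hf' : ∀ᵐ s, |f' s| ≤ F * ρ s)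
    (hd : ∀ᵐ s, |q s - q' s| ≤ d) (hD0 : 0 ≤ D)
    (hD : ∀ᵐ s, |f s - f' s| ≤ D * ρ s) (s : Set ℝ) (Y : ℝ) :
    |kint s q f Y - kint s q' f' Y| ≤ Real.exp C * (2 / c * d * F + D) * A * ρ Y := by
  have hd0 : 0 ≤ d := by
    obtain ⟨s, hs⟩ := hd.exists
    exact (abs_nonneg _).trans hs
  rw [kint, kint, ← integral_sub (h.integrable_expKer_mul hc hρ hfm hf Y).integrableOn
    (h'.integrable_expKer_mul hc hρ hfm' hf' Y).integrableOn]
  refine hρ.abs_integral_le (by positivity) ?_ s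
  filter_upwards [hf, h'.abs_expKer_mul_le hc hD Y] with Y' h1 h2
  have h3 := h.abs_expKer_sub_le hc h' hd Y Y'
  have h4 : expKer q Y Y' * f Y' - expKer q' Y Y' * f' Y' =
      (expKer q Y Y' - expKer q' Y Y') * f Y' + expKer q' Y Y' * (f Y' - f' Y') := by ring
  rw [h4]
  refine (abs_add_le _ _).trans ?_
  have h5 : |(expKer q Y Y' - expKer q' Y Y') * f Y'| ≤
      (Real.exp C * (2 / c) * d * Real.exp (-(c / 2 * |Y' - Y|))) * (F * ρ Y') := by
    rw [abs_mul]
    gcongr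
  refine (add_le_add h5 h2).trans (le_of_eq ?_)
  ring

/-- For a nonnegative density the absolute value in the exponent disappears and the kernel
factorises. A half-line integral becomes an exponential times a primitive, which can be
differentiated by the product rule. -/
theorem Coercive.expKer_eq_of_le (h : Coercive c C q) (hq : ∀ᵐ s, 0 ≤ q s) {Y Y' : ℝ}
    (hY : Y ≤ Y') : expKer q Y Y' =
      Real.exp (∫ s in (0 : ℝ)..Y, q s) * Real.exp (-∫ s in (0 : ℝ)..Y', q s) := by
  rw [expKer, ← Real.exp_add, abs_of_nonneg
    (intervalIntegral.integral_nonneg_of_ae hY hq),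
    ← intervalIntegral.integral_add_adjacent_intervals
      (h.intervalIntegrable 0 Y) (h.intervalIntegrable Y Y')]
  ring_nf

theorem expKer_comm (q : ℝ → ℝ) (Y Y' : ℝ) : expKer q Y Y' = expKer q Y' Y := by
  rw [expKer, expKer, intervalIntegral.integral_symm, abs_neg]

/-- For a nonnegative density the right-sided integral satisfies a linear equation. -/
theorem Coercive.hasACDeriv_kint_Ioi (hc : 0 < c) (hρ : Weight (c / 2) A ρ) (h : Coercive c C q)
    (hq : ∀ᵐ s, 0 ≤ q s) (hfm : AEStronglyMeasurable f volume) {F : ℝ}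
    (hf : ∀ᵐ s, |f s| ≤ F * ρ s) :
    HasACDeriv (fun Y => kint (Ioi Y) q f Y) (fun Y => q Y * kint (Ioi Y) q f Y - f Y) := by
  set Q : ℝ → ℝ := fun Y => ∫ s in (0 : ℝ)..Y, q s with hQ
  have hQac : HasACDeriv Q q := HasACDeriv.primitive h.intervalIntegrable 0
  set e : ℝ → ℝ := fun Y => Real.exp (-Q Y) * f Y with he
  have hker : ∀ Y Y', Y ≤ Y' → expKer q Y Y' * f Y' = Real.exp (Q Y) * e Y' := fun Y Y' hY => by
    rw [h.expKer_eq_of_le hq hY, he, mul_assoc]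
  have hi : ∀ Y, IntegrableOn e (Ioi Y) := fun Y => by
    have h1 := ((h.integrable_expKer_mul hc hρ hfm hf Y).const_mul
      (Real.exp (-Q Y))).integrableOn (s := Ioi Y)
    refine h1.congr_fun (fun Y' hY' => ?_) measurableSet_Ioi
    simp only
    rw [hker Y Y' (le_of_lt hY'), ← mul_assoc, ← Real.exp_add]
    simp
  have hei : ∀ a b, IntervalIntegrable e volume a b := fun a b => by
    rw [intervalIntegrable_iff]
    exact (hi (min a b)).mono_set fun x hx => hx.1
  have hE : HasACDeriv (fun Y => ∫ s in Ioi Y, e s) (fun Y => - e Y) := by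
    refine HasACDeriv.of_primitive (fun a b => (hei a b).neg) fun x => ?_
    rw [intervalIntegral.integral_neg, intervalIntegral.integral_Ioi_sub_Ioi' (hi x) (hi 0),
      intervalIntegral.integral_symm]
  have hexp : HasACDeriv (fun Y => Real.exp (Q Y)) (fun Y => Real.exp (Q Y) * q Y) := by
    simpa using hQac.comp_contDiff Real.contDiff_exp
  have hfun : (fun Y => kint (Ioi Y) q f Y) = fun Y => Real.exp (Q Y) * ∫ s in Ioi Y, e s := by
    funext Y
    rw [kint, ← integral_const_mul]
    exact setIntegral_congr_fun measurableSet_Ioi fun Y' hY' => hker Y Y' (le_of_lt hY')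
  have hmul := hexp.mul hE
  rw [← hfun] at hmul
  refine hmul.congr_deriv (Eventually.of_forall fun Y => ?_)
  have h1 : kint (Ioi Y) q f Y = _ := congrFun hfun Y
  simp only [h1, he]
  have h2 : Real.exp (Q Y) * Real.exp (-Q Y) = 1 := by rw [← Real.exp_add]; simp
  linear_combination (-f Y) * h2

theorem Coercive.hasACDeriv_kint_Iio (hc : 0 < c) (hρ : Weight (c / 2) A ρ) (h : Coercive c C q)
    (hq : ∀ᵐ s, 0 ≤ q s) (hfm : AEStronglyMeasurable f volume) {F : ℝ}
    (hf : ∀ᵐ s, |f s| ≤ F * ρ s) :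
    HasACDeriv (fun Y => kint (Iio Y) q f Y) (fun Y => - (q Y * kint (Iio Y) q f Y) + f Y) := by
  set Q : ℝ → ℝ := fun Y => ∫ s in (0 : ℝ)..Y, q s with hQ
  have hQac : HasACDeriv Q q := HasACDeriv.primitive h.intervalIntegrable 0
  set e : ℝ → ℝ := fun Y => Real.exp (Q Y) * f Y with he
  have hker : ∀ Y Y', Y' ≤ Y → expKer q Y Y' * f Y' = Real.exp (-Q Y) * e Y' := fun Y Y' hY => by
    rw [expKer_comm, h.expKer_eq_of_le hq hY, he]
    ring
  have hi : ∀ Y, IntegrableOn e (Iic Y) := fun Y => by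
    have h1 := ((h.integrable_expKer_mul hc hρ hfm hf Y).const_mul
      (Real.exp (Q Y))).integrableOn (s := Iic Y)
    refine h1.congr_fun (fun Y' hY' => ?_) measurableSet_Iic
    simp only
    rw [hker Y Y' hY', ← mul_assoc, ← Real.exp_add]
    simp
  have hei : ∀ a b, IntervalIntegrable e volume a b := fun a b => by
    rw [intervalIntegrable_iff]
    exact (hi (max a b)).mono_set fun x hx => hx.2
  have hE : HasACDeriv (fun Y => ∫ s in Iic Y, e s) e :=
    HasACDeriv.of_primitive hei fun x => intervalIntegral.integral_Iic_sub_Iic (hi 0) (hi x)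
  have hexp : HasACDeriv (fun Y => Real.exp (-Q Y)) (fun Y => Real.exp (-Q Y) * -q Y) := by
    simpa using hQac.neg.comp_contDiff Real.contDiff_exp
  have hfun : (fun Y => kint (Iio Y) q f Y) = fun Y => Real.exp (-Q Y) * ∫ s in Iic Y, e s := by
    funext Y
    rw [kint, ← integral_const_mul, integral_Iic_eq_integral_Iio]
    exact setIntegral_congr_fun measurableSet_Iio fun Y' hY' => hker Y Y' (le_of_lt hY')
  have hmul := hexp.mul hE
  rw [← hfun] at hmul
  refine hmul.congr_deriv (Eventually.of_forall fun Y => ?_)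
  have h1 : kint (Iio Y) q f Y = _ := congrFun hfun Y
  simp only [h1, he]
  have h2 : Real.exp (Q Y) * Real.exp (-Q Y) = 1 := by rw [← Real.exp_add]; simp
  linear_combination (f Y) * h2

end LambdaFamily
end

/-! ### Bounds and Lipschitz estimates for the right-hand side. -/

noncomputable section

namespace LambdaFamily

/-- The values of `(u, v, ξ)` at a point. -/
abbrev State : Type := ℝ × ℝ × ℝ

/-- The density of the kernel as a function of the state. -/
def ptW (lam : ℕ) (x : State) : ℝ := Real.cos (x.2.1 / 2) ^ expo lam * x.2.2

/-- The density of `P` as a function of the state. -/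
def ptP (lam : ℕ) (x : State) : ℝ :=
  ((2 * (lam : ℝ) + 1) / 2 * x.1 ^ lam * Real.sin (x.2.1 / 2) ^ 2 *
      Real.cos (x.2.1 / 2) ^ (expo lam - 2) +
    x.1 ^ (lam + 2) * Real.cos (x.2.1 / 2) ^ expo lam) * x.2.2

/-- The density of `Q` as a function of the state. -/
def ptQ (lam : ℕ) (x : State) : ℝ :=
  x.1 ^ (lam - 1) * Real.sin (x.2.1 / 2) ^ 3 * Real.cos (x.2.1 / 2) ^ (expo lam - 3) * x.2.2

/-- The right-hand side as a function of the state and of the two nonlocal terms `P + Q_x` and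
`P_x + Q`. -/
def ptRhs (lam : ℕ) (y : State × ℝ × ℝ) : State :=
  (- y.2.2,
    - y.1.1 ^ lam * Real.sin (y.1.2.1 / 2) ^ 2 +
      2 * y.1.1 ^ (lam + 2) * Real.cos (y.1.2.1 / 2) ^ 2 -
      2 * Real.cos (y.1.2.1 / 2) ^ 2 * y.2.1,
    ((lam : ℝ) + 1) / 2 * y.1.1 ^ lam * y.1.2.2 * Real.sin y.1.2.1 +
      ((lam : ℝ) + 1) * y.1.1 ^ (lam + 2) * y.1.2.2 * Real.sin y.1.2.1 -
      ((lam : ℝ) + 1) * y.1.2.2 * Real.sin y.1.2.1 * y.2.1)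

theorem contDiff_ptW (lam : ℕ) : ContDiff ℝ 1 (ptW lam) := by
  unfold ptW; fun_prop

theorem contDiff_ptP (lam : ℕ) : ContDiff ℝ 1 (ptP lam) := by
  unfold ptP; fun_prop

theorem contDiff_ptQ (lam : ℕ) : ContDiff ℝ 1 (ptQ lam) := by
  unfold ptQ; fun_prop

theorem contDiff_ptRhs (lam : ℕ) : ContDiff ℝ 1 (ptRhs lam) := by
  unfold ptRhs; fun_prop

/-- The nonlocal term `P + Q_x`. -/
def nonlocV (lam : ℕ) (w : ℝ → State) (Y : ℝ) : ℝ :=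
  opP lam (fun y => (w y).1) (fun y => (w y).2.1) (fun y => (w y).2.2) Y +
    opQx lam (fun y => (w y).1) (fun y => (w y).2.1) (fun y => (w y).2.2) Y

/-- The nonlocal term `P_x + Q`. -/
def nonlocU (lam : ℕ) (w : ℝ → State) (Y : ℝ) : ℝ :=
  opPx lam (fun y => (w y).1) (fun y => (w y).2.1) (fun y => (w y).2.2) Y +
    opQ lam (fun y => (w y).1) (fun y => (w y).2.1) (fun y => (w y).2.2) Y

/-- The right-hand side of the semilinear system. -/
def field (lam : ℕ) (w : ℝ → State) (Y : ℝ) : State :=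
  (rhsU lam (fun y => (w y).1) (fun y => (w y).2.1) (fun y => (w y).2.2) Y,
    rhsV lam (fun y => (w y).1) (fun y => (w y).2.1) (fun y => (w y).2.2) Y,
    rhsXi lam (fun y => (w y).1) (fun y => (w y).2.1) (fun y => (w y).2.2) Y)

theorem field_eq (lam : ℕ) (w : ℝ → State) (Y : ℝ) :
    field lam w Y = ptRhs lam (w Y, nonlocV lam w Y, nonlocU lam w Y) := by
  simp only [field, ptRhs, nonlocV, nonlocU, rhsU, rhsV, rhsXi, Prod.mk.injEq, and_true]
  ring

theorem nonlocV_eq (lam : ℕ) (w : ℝ → State) (Y : ℝ) :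
    nonlocV lam w Y = 1 / 2 * kint univ (fun y => ptW lam (w y)) (fun y => ptP lam (w y)) Y +
      (lam : ℝ) / 4 * (kint (Ioi Y) (fun y => ptW lam (w y)) (fun y => ptQ lam (w y)) Y -
        kint (Iio Y) (fun y => ptW lam (w y)) (fun y => ptQ lam (w y)) Y) := by
  simp only [kint, Measure.restrict_univ]
  rfl

theorem nonlocU_eq (lam : ℕ) (w : ℝ → State) (Y : ℝ) :
    nonlocU lam w Y = 1 / 2 * (kint (Ioi Y) (fun y => ptW lam (w y)) (fun y => ptP lam (w y)) Y -
        kint (Iio Y) (fun y => ptW lam (w y)) (fun y => ptP lam (w y)) Y) +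
      (lam : ℝ) / 4 * kint univ (fun y => ptW lam (w y)) (fun y => ptQ lam (w y)) Y := by
  simp only [kint, Measure.restrict_univ]
  rfl

/-- A state is bounded relative to the weight value `t`. -/
def PtBound (M t : ℝ) (x : State) : Prop :=
  |x.1| ≤ M * t ∧ |x.2.1| ≤ M * t ∧ |x.2.2| ≤ M

theorem PtBound.norm_le {M t R : ℝ} {x : State} (h : PtBound M t x) (hM : 0 ≤ M) (ht : t ≤ R)
    (hR : 0 ≤ R) : ‖x‖ ≤ M * (R + 1) := by
  have h1 : M * t ≤ M * R := mul_le_mul_of_nonneg_left ht hM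
  have h2 : M * R ≤ M * (R + 1) := by nlinarith
  have h3 : M ≤ M * (R + 1) := by nlinarith
  refine max_le ?_ (max_le ?_ ?_)
  · exact h.1.trans (h1.trans h2)
  · exact h.2.1.trans (h1.trans h2)
  · exact h.2.2.trans h3

theorem exists_lipschitz_bound {E G : Type*} [NormedAddCommGroup E] [NormedSpace ℝ E]
    [FiniteDimensional ℝ E] [NormedAddCommGroup G] [NormedSpace ℝ G] {p : E → G}
    (hp : ContDiff ℝ 1 p) (K : ℝ) :
    ∃ L, 0 ≤ L ∧ ∀ x y, ‖x‖ ≤ K → ‖y‖ ≤ K → ‖p x - p y‖ ≤ L * ‖x - y‖ := by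
  obtain ⟨L, hL⟩ := hp.contDiffOn.exists_lipschitzOnWith (s := Metric.closedBall 0 K) one_ne_zero
    (convex_closedBall _ _) (isCompact_closedBall _ _)
  refine ⟨L, L.2, fun x y hx hy => ?_⟩
  rw [← dist_eq_norm, ← dist_eq_norm]
  exact hL.dist_le_mul x (by simpa using hx) y (by simpa using hy)

/-- If `|v| ≤ 1`, then `cos (v/2) ≥ 1/2`; otherwise the left side is nonpositive and the even power
on the right is nonnegative. The form of the lower bound is chosen so that it can be integrated when
`v` is only known to be in `L²`. -/
theorem half_pow_mul_le_cos_pow (lam : ℕ) (v : ℝ) :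
    (1 / 2 : ℝ) ^ expo lam * (1 - v ^ 2) ≤ Real.cos (v / 2) ^ expo lam := by
  have he : Even (expo lam) := ⟨lam + 1, by simp [expo]; ring⟩
  rcases le_total (v ^ 2) 1 with h | h
  · have h1 := Real.one_sub_sq_div_two_le_cos (x := v / 2)
    have h2 : (1 / 2 : ℝ) ≤ Real.cos (v / 2) := by nlinarith
    calc (1 / 2 : ℝ) ^ expo lam * (1 - v ^ 2) ≤ (1 / 2 : ℝ) ^ expo lam * 1 := by
          gcongr; nlinarith [sq_nonneg v]
      _ ≤ Real.cos (v / 2) ^ expo lam := by rw [mul_one]; gcongr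
  · have h1 : 0 ≤ Real.cos (v / 2) ^ expo lam := he.pow_nonneg _
    have h2 : (0 : ℝ) < (1 / 2 : ℝ) ^ expo lam := by positivity
    nlinarith

/-- The rate of decay of the kernel when `ξ ≥ m`. -/
def rate (lam : ℕ) (m : ℝ) : ℝ := m * (1 / 2) ^ expo lam

theorem rate_pos (lam : ℕ) {m : ℝ} (hm : 0 < m) : 0 < rate lam m := by
  unfold rate; positivity

/-- Profiles that are bounded relative to the weight `ρ`, with `ξ` bounded below by `m` and
`v` bounded in `L²`. -/
structure Adm (ρ : ℝ → ℝ) (M m B : ℝ) (w : ℝ → State) : Prop where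
  aesm : AEStronglyMeasurable w volume
  bound : ∀ᵐ Y, PtBound M (ρ Y) (w Y)
  lower : ∀ᵐ Y, m ≤ (w Y).2.2
  integrable_sq : Integrable fun Y => (w Y).2.1 ^ 2
  integral_sq_le : ∫ Y, (w Y).2.1 ^ 2 ≤ B

variable {lam : ℕ} {ρ : ℝ → ℝ} {M m B A R : ℝ} {w w' : ℝ → State}

/-- By `half_pow_mul_le_cos_pow` and `ξ ≥ m` the density is at least `rate lam m * (1 - v²)`; the
integral of `v²` costs at most `rate lam m * B`, on any interval. -/
theorem Adm.coercive (hm : 0 < m) (h : Adm ρ M m B w) :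
    Coercive (rate lam m) (rate lam m * B) (fun y => ptW lam (w y)) := by
  have he : Even (expo lam) := ⟨lam + 1, by simp [expo]; ring⟩
  have hi : ∀ a b, IntervalIntegrable (fun y => ptW lam (w y)) volume a b := by
    intro a b
    refine (intervalIntegrable_const (c := M)).mono_fun
      (((contDiff_ptW lam).continuous.comp_aestronglyMeasurable h.aesm).restrict)
      (ae_restrict_of_ae ?_)
    filter_upwards [h.bound] with Y hY
    have h1 : |Real.cos ((w Y).2.1 / 2) ^ expo lam| ≤ 1 := by
      rw [abs_pow]
      exact pow_le_one₀ (abs_nonneg _) (Real.abs_cos_le_one _)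
    rw [ptW, norm_mul, Real.norm_eq_abs, Real.norm_eq_abs]
    calc _ ≤ 1 * M := mul_le_mul h1 hY.2.2 (abs_nonneg _) zero_le_one
      _ ≤ ‖M‖ := by rw [one_mul]; exact le_abs_self M
  refine ⟨hi, fun a b hab => ?_⟩
  have hr := rate_pos lam hm
  have hi2 : IntervalIntegrable (fun y => rate lam m * (1 - (w y).2.1 ^ 2)) volume a b :=
    (intervalIntegrable_const.sub h.integrable_sq.intervalIntegrable).const_mul _
  have h1 : ∫ y in a..b, rate lam m * (1 - (w y).2.1 ^ 2) ≤ ∫ y in a..b, ptW lam (w y) := by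
    refine intervalIntegral.integral_mono_ae hab hi2 (hi a b) ?_
    filter_upwards [h.lower] with Y hY
    have h2 := half_pow_mul_le_cos_pow lam (w Y).2.1
    have h3 : 0 ≤ Real.cos ((w Y).2.1 / 2) ^ expo lam := he.pow_nonneg _
    rw [ptW, rate]
    nlinarith
  rw [intervalIntegral.integral_const_mul, intervalIntegral.integral_sub intervalIntegrable_const
    h.integrable_sq.intervalIntegrable, intervalIntegral.integral_const] at h1
  have h4 : ∫ y in a..b, (w y).2.1 ^ 2 ≤ B := by
    rw [intervalIntegral.integral_of_le hab]
    exact (setIntegral_le_integral h.integrable_sq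
      (Eventually.of_forall fun t => sq_nonneg _)).trans h.integral_sq_le
  simp only [smul_eq_mul, mul_one] at h1
  nlinarith

/-- Comparing `x` with the state `(0, 0, x.2.2)`, where `p` vanishes, turns the local Lipschitz
bound into a bound by the weight, although `ξ` itself does not decay. -/
theorem exists_density_bound {p : State → ℝ} (hp : ContDiff ℝ 1 p) (hp0 : ∀ x, p (0, 0, x) = 0)
    (hM : 0 ≤ M) (hR : 0 ≤ R) :
    ∃ L, 0 ≤ L ∧ (∀ t x, 0 ≤ t → t ≤ R → PtBound M t x → |p x| ≤ L * t) ∧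
      ∀ t x y, t ≤ R → PtBound M t x → PtBound M t y → |p x - p y| ≤ L * ‖x - y‖ := by
  obtain ⟨L, hL0, hL⟩ := exists_lipschitz_bound hp (M * (R + 1))
  refine ⟨L * (M + 1), by positivity, fun t x ht0 ht hx => ?_, fun t x y ht hx hy => ?_⟩
  · have hx0 : PtBound M t (0, 0, x.2.2) := ⟨by simpa using by positivity,
      by simpa using by positivity, hx.2.2⟩
    have h1 := hL x (0, 0, x.2.2) (hx.norm_le hM ht hR) (hx0.norm_le hM ht hR)
    rw [hp0, sub_zero] at h1
    have h2 : ‖x - (0, 0, x.2.2)‖ ≤ M * t := by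
      refine max_le ?_ (max_le ?_ ?_)
      · simpa using hx.1
      · simpa using hx.2.1
      · simpa using by positivity
    calc |p x| ≤ L * ‖x - (0, 0, x.2.2)‖ := h1
      _ ≤ L * (M * t) := by gcongr
      _ ≤ L * (M + 1) * t := by nlinarith [mul_nonneg hL0 ht0]
  · refine (hL x y (hx.norm_le hM ht hR) (hy.norm_le hM ht hR)).trans ?_
    gcongr
    nlinarith

theorem exists_kint_bound (lam : ℕ) {p : State → ℝ} (hp : ContDiff ℝ 1 p)
    (hp0 : ∀ x, p (0, 0, x) = 0) (hM : 0 ≤ M) (hm : 0 < m) (B : ℝ)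
    (hρ : Weight (rate lam m / 2) A ρ) (hR : ∀ Y, ρ Y ≤ R) :
    ∃ C, 0 ≤ C ∧
      (∀ w, Adm ρ M m B w → ∀ s Y,
        |kint s (fun y => ptW lam (w y)) (fun y => p (w y)) Y| ≤ C * ρ Y) ∧
      ∀ w w', Adm ρ M m B w → Adm ρ M m B w' → ∀ d, 0 ≤ d → (∀ᵐ Y, ‖w Y - w' Y‖ ≤ d * ρ Y) →
        ∀ s Y, |kint s (fun y => ptW lam (w y)) (fun y => p (w y)) Y -
          kint s (fun y => ptW lam (w' y)) (fun y => p (w' y)) Y| ≤ C * d * ρ Y := by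
  have hR0 : 0 ≤ R := (hρ.pos 0).le.trans (hR 0)
  have hA := hρ.nonneg_const
  have hc := rate_pos lam hm
  obtain ⟨L, hL0, hL1, hL2⟩ := exists_density_bound hp hp0 hM hR0
  obtain ⟨K, hK0, hK⟩ := exists_lipschitz_bound (contDiff_ptW lam) (M * (R + 1))
  set c := rate lam m
  have hf : ∀ w, Adm ρ M m B w → ∀ᵐ Y, |p (w Y)| ≤ L * ρ Y := fun w hw => by
    filter_upwards [hw.bound] with Y hY using hL1 _ _ (hρ.pos Y).le (hR Y) hY
  -- These are the constants of `Coercive.abs_kint_le` and `Coercive.abs_kint_sub_le`; the kernel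
  -- densities differ by at most `K * R * d` uniformly, because `ρ ≤ R`.
  set C₁ := Real.exp (c * B) * L * A
  set C₂ := Real.exp (c * B) * (2 / c * (K * R) * L + L) * A
  refine ⟨C₁ + C₂, by positivity, fun w hw s Y => ?_, fun w w' hw hw' d hd hww s Y => ?_⟩
  · refine ((hw.coercive hm).abs_kint_le hc hρ hL0 (hf w hw) s Y).trans ?_
    have := (hρ.pos Y).le
    have : 0 ≤ C₂ * ρ Y := by positivity
    nlinarith
  · have h1 : ∀ᵐ s, |ptW lam (w s) - ptW lam (w' s)| ≤ K * R * d := by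
      filter_upwards [hw.bound, hw'.bound, hww] with Y h1 h2 h3
      refine (hK _ _ (h1.norm_le hM (hR Y) hR0) (h2.norm_le hM (hR Y) hR0)).trans ?_
      rw [mul_assoc]
      refine mul_le_mul_of_nonneg_left (h3.trans ?_) hK0
      rw [mul_comm]
      exact mul_le_mul_of_nonneg_right (hR Y) hd
    have h2 : ∀ᵐ s, |p (w s) - p (w' s)| ≤ (L * d) * ρ s := by
      filter_upwards [hw.bound, hw'.bound, hww] with Y h1 h2 h3
      refine (hL2 _ _ _ (hR Y) h1 h2).trans ?_
      rw [mul_assoc]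
      exact mul_le_mul_of_nonneg_left h3 hL0
    have h3 := (hw.coercive hm).abs_kint_sub_le hc hρ (hw'.coercive hm)
      (hp.continuous.comp_aestronglyMeasurable hw.aesm)
      (hp.continuous.comp_aestronglyMeasurable hw'.aesm) hL0 (hf w hw) (hf w' hw') h1
      (by positivity) h2 s Y
    have h4 := (hρ.pos Y).le
    have h5 : 0 ≤ C₁ * d * ρ Y := by positivity
    refine h3.trans ?_
    have h6 : Real.exp (c * B) * (2 / c * (K * R * d) * L + L * d) * A * ρ Y = C₂ * d * ρ Y := by
      simp only [C₂]; ring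
    rw [h6]
    nlinarith

/-- The vanishing comes from the factor `sin³ (v/2)`; the power `u ^ (lam - 1)` is `1` when `lam =
1`. -/
theorem ptQ_zero (lam : ℕ) (x : ℝ) : ptQ lam (0, 0, x) = 0 := by
  simp [ptQ]

/-- The nonlocal terms are bounded by the weight and Lipschitz relative to it. -/
theorem exists_nonloc_bound (lam : ℕ) (hM : 0 ≤ M) (hm : 0 < m) (B : ℝ)
    (hρ : Weight (rate lam m / 2) A ρ) (hR : ∀ Y, ρ Y ≤ R) :
    ∃ C, 0 ≤ C ∧
      (∀ w, Adm ρ M m B w → ∀ Y, |nonlocV lam w Y| ≤ C * ρ Y ∧ |nonlocU lam w Y| ≤ C * ρ Y) ∧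
      ∀ w w', Adm ρ M m B w → Adm ρ M m B w' → ∀ d, 0 ≤ d → (∀ᵐ Y, ‖w Y - w' Y‖ ≤ d * ρ Y) →
        ∀ Y, |nonlocV lam w Y - nonlocV lam w' Y| ≤ C * d * ρ Y ∧
          |nonlocU lam w Y - nonlocU lam w' Y| ≤ C * d * ρ Y := by
  obtain ⟨C₁, h10, h1b, h1l⟩ := exists_kint_bound lam (contDiff_ptP lam)
    (fun x => by simp [ptP]) hM hm B hρ hR
  obtain ⟨C₂, h20, h2b, h2l⟩ := exists_kint_bound lam (contDiff_ptQ lam)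
    (ptQ_zero lam) hM hm B hρ hR
  have comb₁ : ∀ x y z a b l : ℝ, 0 ≤ l → |x| ≤ a → |y| ≤ b → |z| ≤ b →
      |1 / 2 * x + l / 4 * (y - z)| ≤ a + l * b := by
    intro x y z a b l hl hx hy hz
    have h1 : |1 / 2 * x| ≤ a := by rw [abs_mul, abs_of_pos one_half_pos]; linarith [abs_nonneg x]
    have h2 : |l / 4 * (y - z)| ≤ l * b := by
      rw [abs_mul, abs_of_nonneg (by positivity)]
      have := (abs_sub y z).trans (add_le_add hy hz)
      have := (abs_nonneg y).trans hy
      calc l / 4 * |y - z| ≤ l / 4 * (b + b) := by gcongr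
        _ ≤ l * b := by nlinarith [mul_nonneg hl this]
    exact (abs_add_le _ _).trans (add_le_add h1 h2)
  have comb₂ : ∀ x y z a b l : ℝ, 0 ≤ l → |x| ≤ a → |y| ≤ a → |z| ≤ b →
      |1 / 2 * (x - y) + l / 4 * z| ≤ a + l * b := by
    intro x y z a b l hl hx hy hz
    have h1 : |1 / 2 * (x - y)| ≤ a := by
      rw [abs_mul, abs_of_pos one_half_pos]
      linarith [(abs_sub x y).trans (add_le_add hx hy)]
    have h2 : |l / 4 * z| ≤ l * b := by
      rw [abs_mul, abs_of_nonneg (by positivity)]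
      have := (abs_nonneg z).trans hz
      calc l / 4 * |z| ≤ l / 4 * b := by gcongr
        _ ≤ l * b := by nlinarith [mul_nonneg hl this]
    exact (abs_add_le _ _).trans (add_le_add h1 h2)
  have hl : (0 : ℝ) ≤ lam := Nat.cast_nonneg _
  refine ⟨C₁ + lam * C₂, by positivity, fun w hw Y => ?_, fun w w' hw hw' d hd hww Y => ?_⟩
  · rw [nonlocV_eq, nonlocU_eq, show (C₁ + lam * C₂) * ρ Y = C₁ * ρ Y + lam * (C₂ * ρ Y) by ring]
    exact ⟨comb₁ _ _ _ _ _ _ hl (h1b w hw _ Y) (h2b w hw _ Y) (h2b w hw _ Y),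
      comb₂ _ _ _ _ _ _ hl (h1b w hw _ Y) (h1b w hw _ Y) (h2b w hw _ Y)⟩
  · have e1 := h1l w w' hw hw' d hd hww
    have e2 := h2l w w' hw hw' d hd hww
    rw [nonlocV_eq, nonlocU_eq, nonlocV_eq, nonlocU_eq,
      show (C₁ + lam * C₂) * d * ρ Y = C₁ * d * ρ Y + lam * (C₂ * d * ρ Y) by ring]
    constructor
    · convert comb₁ _ _ _ _ _ _ hl (e1 univ Y) (e2 (Ioi Y) Y) (e2 (Iio Y) Y) using 2
      ring
    · convert comb₂ _ _ _ _ _ _ hl (e1 (Ioi Y) Y) (e1 (Iio Y) Y) (e2 univ Y) using 2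
      ring

/-- The right-hand side is bounded by the weight and Lipschitz relative to it. -/
theorem exists_field_bound (lam : ℕ) (hlam : 1 ≤ lam) (hM : 0 ≤ M) (hm : 0 < m) (B : ℝ)
    (hρ : Weight (rate lam m / 2) A ρ) (hR : ∀ Y, ρ Y ≤ R) :
    ∃ C, 0 ≤ C ∧
      (∀ w, Adm ρ M m B w → ∀ Y, PtBound M (ρ Y) (w Y) → ‖field lam w Y‖ ≤ C * ρ Y) ∧
      ∀ w w', Adm ρ M m B w → Adm ρ M m B w' → ∀ d, 0 ≤ d → (∀ᵐ Y, ‖w Y - w' Y‖ ≤ d * ρ Y) →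
        ∀ Y, PtBound M (ρ Y) (w Y) → PtBound M (ρ Y) (w' Y) → ‖w Y - w' Y‖ ≤ d * ρ Y →
          ‖field lam w Y - field lam w' Y‖ ≤ C * d * ρ Y := by
  have hR0 : 0 ≤ R := (hρ.pos 0).le.trans (hR 0)
  obtain ⟨N, hN0, hNb, hNl⟩ := exists_nonloc_bound lam hM hm B hρ hR
  obtain ⟨L, hL0, hL⟩ := exists_lipschitz_bound (contDiff_ptRhs lam) (M * (R + 1) + N * R)
  have hbd : ∀ w, Adm ρ M m B w → ∀ Y, PtBound M (ρ Y) (w Y) →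
      ‖((w Y, nonlocV lam w Y, nonlocU lam w Y) : State × ℝ × ℝ)‖ ≤ M * (R + 1) + N * R := by
    intro w hw Y hY
    have h1 := hY.norm_le hM (hR Y) hR0
    have h2 := hNb w hw Y
    have h3 : N * ρ Y ≤ N * R := mul_le_mul_of_nonneg_left (hR Y) hN0
    have h4 : 0 ≤ M * (R + 1) := by positivity
    have h5 : 0 ≤ N * R := by positivity
    refine max_le (by linarith) (max_le ?_ ?_)
    · exact h2.1.trans (by linarith)
    · exact h2.2.trans (by linarith)
  refine ⟨L * (M + N + 1), by positivity, fun w hw Y hY => ?_,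
    fun w w' hw hw' d hd hww Y hY hY' hwY => ?_⟩
  · have hρY := (hρ.pos Y).le
    -- As for the densities, the comparison point keeps `ξ` and sets everything else to zero; the
    -- distance to it is controlled by the weight.
    have h0 : ptRhs lam ((0, 0, (w Y).2.2), 0, 0) = 0 := by
      simp [ptRhs, zero_pow (show lam ≠ 0 by omega)]
    have hz : ‖(((0, 0, (w Y).2.2), 0, 0) : State × ℝ × ℝ)‖ ≤ M * (R + 1) + N * R := by
      have h1 : PtBound M (ρ Y) (0, 0, (w Y).2.2) := ⟨by simpa using by positivity,
        by simpa using by positivity, hY.2.2⟩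
      have h2 := h1.norm_le hM (hR Y) hR0
      have h5 : 0 ≤ N * R := by positivity
      refine max_le (by linarith) ?_
      simpa using by positivity
    have h1 := hL _ _ (hbd w hw Y hY) hz
    rw [h0, sub_zero, ← field_eq] at h1
    refine h1.trans ?_
    have h2 : ‖((w Y, nonlocV lam w Y, nonlocU lam w Y) : State × ℝ × ℝ) -
        ((0, 0, (w Y).2.2), 0, 0)‖ ≤ (M + N + 1) * ρ Y := by
      have h3 := hNb w hw Y
      have h4 : 0 ≤ N * ρ Y := by positivity
      have h5 : 0 ≤ M * ρ Y := by positivity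
      refine max_le (max_le ?_ (max_le ?_ ?_)) (max_le ?_ ?_)
      · simpa using hY.1.trans (by nlinarith)
      · simpa using hY.2.1.trans (by nlinarith)
      · simpa using by positivity
      · simpa using h3.1.trans (by nlinarith)
      · simpa using h3.2.trans (by nlinarith)
    rw [mul_assoc]
    exact mul_le_mul_of_nonneg_left h2 hL0
  · rw [field_eq, field_eq]
    refine (hL _ _ (hbd w hw Y hY) (hbd w' hw' Y hY')).trans ?_
    have hρY := (hρ.pos Y).le
    have h3 := hNl w w' hw hw' d hd hww Y
    have h4 : 0 ≤ N * d * ρ Y := by positivity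
    have h5 : 0 ≤ M * d * ρ Y := by positivity
    have h6 : 0 ≤ d * ρ Y := by positivity
    have h2 : ‖((w Y, nonlocV lam w Y, nonlocU lam w Y) : State × ℝ × ℝ) -
        (w' Y, nonlocV lam w' Y, nonlocU lam w' Y)‖ ≤ (M + N + 1) * d * ρ Y := by
      refine max_le ?_ (max_le ?_ ?_)
      · exact hwY.trans (by nlinarith)
      · exact h3.1.trans (by nlinarith)
      · exact h3.2.trans (by nlinarith)
    calc _ ≤ L * ((M + N + 1) * d * ρ Y) := mul_le_mul_of_nonneg_left h2 hL0
      _ = _ := by ring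

end LambdaFamily
end

/-! ### A priori bounds for solutions. -/

noncomputable section

namespace LambdaFamily

theorem integrable_exp_neg_mul_abs_sub {r : ℝ} (hr : 0 < r) (Y : ℝ) :
    Integrable fun Y' => Real.exp (-(r * |Y' - Y|)) := by
  have h1 : IntegrableOn (fun x => Real.exp (-(r * |x|))) (Ioi 0) :=
    (integrableOn_exp_mul_Ioi (neg_lt_zero.2 hr) 0).congr_fun (fun x hx => by
      simp only [abs_of_pos (mem_Ioi.1 hx), neg_mul]) measurableSet_Ioi
  have h0 : IntegrableOn (fun x => Real.exp (-(r * |x|))) (Iic 0) :=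
    (integrableOn_exp_mul_Iic hr 0).congr_fun (fun x hx => by
      simp only [abs_of_nonpos (mem_Iic.1 hx), mul_neg, neg_neg]) measurableSet_Iic
  have h2 : Integrable (fun x => Real.exp (-(r * |x|))) := by
    rw [← integrableOn_univ, ← Iic_union_Ioi (a := (0 : ℝ))]
    exact h0.union h1
  exact h2.comp_sub_right Y

theorem integral_exp_neg_mul_abs_sub {r : ℝ} (hr : 0 < r) (Y : ℝ) :
    ∫ Y', Real.exp (-(r * |Y' - Y|)) = 2 / r := by
  rw [integral_sub_right_eq_self (fun x => Real.exp (-(r * |x|))) Y,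
    integral_comp_abs (f := fun x => Real.exp (-(r * x)))]
  have := integral_exp_mul_Ioi (neg_lt_zero.2 hr) 0
  simp only [neg_mul, mul_zero, Real.exp_zero] at this
  rw [this]
  field_simp

/-- The weight used for uniqueness: with it, estimates relative to the weight become estimates in
`L^∞`. -/
theorem weight_one {r : ℝ} (hr : 0 < r) : Weight r (2 / r) (fun _ => 1) where
  pos _ := one_pos
  aesm := aestronglyMeasurable_const
  integrable Y := by simpa using integrable_exp_neg_mul_abs_sub hr Y
  le Y := by simpa using (integral_exp_neg_mul_abs_sub hr Y).le

theorem integral_sq_eq_eLpNorm {f : ℝ → ℝ} (hf : MemLp f 2 volume) :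
    ∫ x, f x ^ 2 = (eLpNorm f 2 volume).toReal ^ 2 := by
  have h := hf.eLpNorm_eq_integral_rpow_norm (by norm_num) (by norm_num)
  have h0 : 0 ≤ ∫ x, f x ^ 2 := integral_nonneg fun x => sq_nonneg _
  simp only [ENNReal.toReal_ofNat, Real.rpow_ofNat, Real.norm_eq_abs, sq_abs] at h
  rw [h, ENNReal.toReal_ofReal (by positivity), ← Real.rpow_natCast, ← Real.rpow_mul h0]
  norm_num

/-- A function on a compact interval that is locally bounded is bounded. -/
theorem exists_bound_Icc {T₀ : ℝ} {N : ℝ → ℝ≥0∞} {e : ℝ → ℝ → ℝ≥0∞}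
    (hN : ∀ T ∈ Icc 0 T₀, N T ≠ ⊤)
    (he : ∀ T ∈ Icc 0 T₀, Tendsto (e T) (𝓝[Icc 0 T₀] T) (𝓝 0))
    (h : ∀ T ∈ Icc 0 T₀, ∀ S ∈ Icc 0 T₀, N S ≤ N T + e T S) :
    ∃ K : ℝ≥0∞, K ≠ ⊤ ∧ ∀ T ∈ Icc 0 T₀, N T ≤ K := by
  have := isCompact_Icc (a := (0 : ℝ)) (b := T₀)
  refine this.induction_on (p := fun s => ∃ K : ℝ≥0∞, K ≠ ⊤ ∧ ∀ T ∈ s, N T ≤ K)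
    ⟨0, by simp, by simp⟩ ?_ ?_ ?_
  · rintro s t hst ⟨K, hK, hb⟩
    exact ⟨K, hK, fun T hT => hb T (hst hT)⟩
  · rintro s t ⟨K, hK, hb⟩ ⟨K', hK', hb'⟩
    refine ⟨max K K', by simp [hK, hK'], ?_⟩
    rintro T (hT | hT)
    · exact (hb T hT).trans (le_max_left _ _)
    · exact (hb' T hT).trans (le_max_right _ _)
  · intro T hT
    refine ⟨Icc 0 T₀ ∩ {S | e T S < 1}, ?_, N T + 1, by simp [hN T hT], fun S hS => ?_⟩
    · exact inter_mem self_mem_nhdsWithin ((he T hT).eventually (gt_mem_nhds zero_lt_one))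
    · exact (h T hT S hS.1).trans (by gcongr; exact hS.2.le)

/-- For continuous curves, a bound at each time almost everywhere holds almost everywhere at
all times. -/
theorem ae_forall_le {T₀ : ℝ} {φ : ℝ → ℝ → ℝ} {g : ℝ → ℝ} (hg : Continuous g)
    (hφ : ∀ᵐ Y, ContinuousOn (fun t => φ t Y) (Icc 0 T₀))
    (h : ∀ T ∈ Icc 0 T₀, ∀ᵐ Y, φ T Y ≤ g T) :
    ∀ᵐ Y, ∀ T ∈ Icc 0 T₀, φ T Y ≤ g T := by
  -- Only countably many null sets are discarded, one for each time in a dense set; continuity in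
  -- time does the rest.
  obtain ⟨D, hDc, hDd⟩ := TopologicalSpace.exists_countable_dense (Icc (0 : ℝ) T₀)
  have h1 : ∀ᵐ Y, ∀ t ∈ D, φ t Y ≤ g t := (ae_ball_iff hDc).2 fun t _ => h t t.2
  filter_upwards [h1, hφ] with Y hY hc T hT
  have hcl : IsClosed {t : Icc (0 : ℝ) T₀ | φ t Y ≤ g t} :=
    isClosed_le (continuousOn_iff_continuous_domRestrict.1 hc) (hg.comp continuous_subtype_val)
  have := hcl.closure_subset_iff.2 (fun t ht => hY t ht : D ⊆ _)
  rw [hDd.closure_eq] at this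
  exact this (mem_univ (⟨T, hT⟩ : Icc (0 : ℝ) T₀))

theorem weakDeriv_sub_ae_eq {f g : ℝ → ℝ} {p q : ℝ≥0∞} (hf : MemW1 p f) (hg : MemW1 q g) :
    weakDeriv (f - g) =ᵐ[volume] weakDeriv f - weakDeriv g := by
  obtain ⟨-, f', hf', -⟩ := hf
  obtain ⟨-, g', hg', -⟩ := hg
  have h := (weakDeriv_spec hf').sub (weakDeriv_spec hg')
  exact (weakDeriv_spec h).ae_eq h

theorem MemW1.memLp_weakDeriv {f : ℝ → ℝ} {p : ℝ≥0∞} (hf : MemW1 p f) :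
    MemLp (weakDeriv f) p volume := by
  obtain ⟨-, g, hg, hgp⟩ := hf
  exact hgp.ae_eq (hg.ae_eq (weakDeriv_spec hg))

theorem eLpNorm_le_add_sub {f g : ℝ → ℝ} {p : ℝ≥0∞} (hp : 1 ≤ p)
    (hf : AEStronglyMeasurable f volume) (hg : AEStronglyMeasurable g volume) :
    eLpNorm f p volume ≤ eLpNorm g p volume + eLpNorm (f - g) p volume := by
  have := eLpNorm_add_le hg (hf.sub hg) hp
  rwa [add_sub_cancel] at this

variable {lam : ℕ} {u₀ : ℝ → ℝ} {T₀ : ℝ} {u v ξ : ℝ → ℝ → ℝ}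

/-- Continuity into `X` on a compact time interval. The `W^{1,k}` part of the norm is dropped, since
the `H¹` part already bounds `u`. -/
theorem IsSolution.exists_norm_bound (h : IsSolution lam u₀ T₀ u v ξ) :
    ∃ K : ℝ≥0∞, K ≠ ⊤ ∧ ∀ T ∈ Icc 0 T₀, eLpNorm (u T) 2 volume +
      eLpNorm (weakDeriv (u T)) 2 volume + eLpNorm (v T) 2 volume + eLpNorm (v T) ∞ volume +
        eLpNorm (ξ T) ∞ volume ≤ K := by
  refine exists_bound_Icc (e := fun T S => normX lam (u S - u T) (v S - v T) (ξ S - ξ T)) ?_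
    (fun T hT => h.cont T hT) ?_
  · intro T hT
    obtain ⟨⟨h1, -⟩, ⟨h2, h3⟩, h4⟩ := h.mem T hT
    exact ENNReal.add_ne_top.2 ⟨ENNReal.add_ne_top.2 ⟨ENNReal.add_ne_top.2 ⟨ENNReal.add_ne_top.2
      ⟨h1.1.2.ne, h1.memLp_weakDeriv.2.ne⟩, h2.2.ne⟩, h3.2.ne⟩, h4.2.ne⟩
  · intro T hT S hS
    obtain ⟨⟨h1, -⟩, ⟨h2, h3⟩, h4⟩ := h.mem T hT
    obtain ⟨⟨g1, -⟩, ⟨g2, g3⟩, g4⟩ := h.mem S hS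
    have e1 := eLpNorm_le_add_sub (p := 2) one_le_two g1.1.1 h1.1.1
    have e2 := eLpNorm_le_add_sub (p := 2) one_le_two g1.memLp_weakDeriv.1 h1.memLp_weakDeriv.1
    rw [← eLpNorm_congr_ae (weakDeriv_sub_ae_eq g1 h1)] at e2
    have e3 := eLpNorm_le_add_sub (p := 2) one_le_two g2.1 h2.1
    have e4 := eLpNorm_le_add_sub (p := ⊤) le_top g2.1 h2.1
    have e5 := eLpNorm_le_add_sub (p := ⊤) le_top g4.1 h4.1
    refine (add_le_add (add_le_add (add_le_add (add_le_add e1 e2) e3) e4) e5).trans ?_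
    rw [normX, normW1]
    set a := eLpNorm (u T) 2 volume
    set b := eLpNorm (weakDeriv (u T)) 2 volume
    set c := eLpNorm (v T) 2 volume
    set d := eLpNorm (v T) ∞ volume
    set f := eLpNorm (ξ T) ∞ volume
    refine le_of_eq_of_le (b := (a + b + c + d + f) + (eLpNorm (u S - u T) 2 volume +
      eLpNorm (weakDeriv (u S - u T)) 2 volume + (eLpNorm (v S - v T) 2 volume +
      eLpNorm (v S - v T) ∞ volume) + eLpNorm (ξ S - ξ T) ∞ volume)) (by ring) ?_
    refine add_le_add_right (add_le_add_left (add_le_add_left ?_ _) _) _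
    exact le_self_add

theorem ae_abs_le_of_eLpNorm_top {f : ℝ → ℝ} {K : ℝ≥0∞} (hK : K ≠ ⊤)
    (h : eLpNorm f ∞ volume ≤ K) : ∀ᵐ Y, |f Y| ≤ K.toReal := by
  rw [eLpNorm_exponent_top] at h
  filter_upwards [enorm_ae_le_eLpNormEssSup f volume] with Y hY
  have := ENNReal.toReal_mono hK (hY.trans h)
  simpa using this

/-- Uniform bounds for a solution. -/
theorem IsSolution.exists_bound (h : IsSolution lam u₀ T₀ u v ξ) :
    ∃ M B, 0 ≤ M ∧ ∀ T ∈ Icc 0 T₀,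
      (∀ᵐ Y, |u T Y| ≤ M) ∧ (∀ᵐ Y, |v T Y| ≤ M) ∧ (∀ᵐ Y, |ξ T Y| ≤ M) ∧
      (Integrable fun Y => u T Y ^ 2) ∧ (Integrable fun Y => v T Y ^ 2) ∧
      (∫ Y, u T Y ^ 2) ≤ B ∧ (∫ Y, v T Y ^ 2) ≤ B := by
  obtain ⟨K, hK, hb⟩ := h.exists_norm_bound
  set k := K.toReal
  have hk : 0 ≤ k := ENNReal.toReal_nonneg
  -- `2 + k² + k²` is the bound of `HasACDeriv.abs_le_of_integrable_sq` for `u`, and `k` bounds the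
  -- sup norms of `v` and `ξ`.
  refine ⟨2 + k ^ 2 + k ^ 2 + k, k ^ 2, by positivity, fun T hT => ?_⟩
  have hT' := hb T hT
  obtain ⟨⟨h1, -⟩, ⟨h2, h3⟩, h4⟩ := h.mem T hT
  have b1 : eLpNorm (u T) 2 volume ≤ K :=
    le_trans (by simp only [add_assoc]; exact le_self_add) hT'
  have b2 : eLpNorm (weakDeriv (u T)) 2 volume ≤ K :=
    le_trans (by simp only [add_assoc]; exact le_add_left le_self_add) hT'
  have b3 : eLpNorm (v T) 2 volume ≤ K :=
    le_trans (le_add_right (le_add_right (le_add_left le_rfl))) hT'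
  have b4 : eLpNorm (v T) ∞ volume ≤ K :=
    le_trans (le_add_right (le_add_left le_rfl)) hT'
  have b5 : eLpNorm (ξ T) ∞ volume ≤ K := le_trans (le_add_left le_rfl) hT'
  have sq : ∀ f : ℝ → ℝ, MemLp f 2 volume → eLpNorm f 2 volume ≤ K → ∫ Y, f Y ^ 2 ≤ k ^ 2 := by
    intro f hf hfK
    rw [integral_sq_eq_eLpNorm hf]
    exact pow_le_pow_left₀ ENNReal.toReal_nonneg (ENNReal.toReal_mono hK hfK) 2
  have c1 := sq _ h1.1 b1
  have c2 := sq _ h1.memLp_weakDeriv b2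
  have c3 := sq _ h2 b3
  have hksq := sq_nonneg k
  refine ⟨?_, ?_, ?_, h1.1.integrable_sq, h2.integrable_sq, c1, c3⟩
  · obtain ⟨g, hg, -⟩ := h1.2
    obtain ⟨F, hF, hae⟩ := (weakDeriv_spec hg).exists_hasACDeriv
    have hFi : Integrable fun Y => F Y ^ 2 :=
      h1.1.integrable_sq.congr (hae.mono fun x hx => by simp only [hx])
    have hFe : ∫ Y, F Y ^ 2 = ∫ Y, u T Y ^ 2 :=
      integral_congr_ae (hae.mono fun x hx => by simp only [hx])
    filter_upwards [hae] with Y hY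
    have := hF.abs_le_of_integrable_sq hFi h1.memLp_weakDeriv.integrable_sq Y
    rw [hY]
    linarith
  · filter_upwards [ae_abs_le_of_eLpNorm_top hK b4] with Y hY
    exact hY.trans (by linarith)
  · filter_upwards [ae_abs_le_of_eLpNorm_top hK b5] with Y hY
    exact hY.trans (by linarith)

end LambdaFamily
end

/-! ### Lower bound for `ξ`, and uniqueness. -/

noncomputable section

namespace LambdaFamily

variable {lam : ℕ} {u₀ : ℝ → ℝ} {T₀ : ℝ} {u v ξ u' v' ξ' : ℝ → ℝ → ℝ}

/-- Only `expKer ≤ 1` is used. Nothing is asked of the kernel density, so the bound is available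
before `ξ` is known to be positive. -/
theorem abs_kint_le_integral (s : Set ℝ) (q : ℝ → ℝ) {f g : ℝ → ℝ} (hg : Integrable g)
    (hg0 : ∀ Y, 0 ≤ g Y) (hf : ∀ᵐ Y, |f Y| ≤ g Y) (Y : ℝ) : |kint s q f Y| ≤ ∫ Y', g Y' := by
  calc |kint s q f Y| ≤ ∫ Y' in s, g Y' := by
        refine norm_integral_le_of_norm_le (f := fun Y' => expKer q Y Y' * f Y')
          hg.integrableOn (ae_restrict_of_ae ?_)
        filter_upwards [hf] with Y' hY'
        rw [Real.norm_eq_abs, abs_mul, abs_of_pos (expKer_pos _ _ _)]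
        nlinarith [expKer_le_one q Y Y', expKer_pos q Y Y', abs_nonneg (f Y')]
    _ ≤ ∫ Y', g Y' := setIntegral_le_integral hg (Eventually.of_forall hg0)

/-- The densities are bounded by a multiple of `u² + v²` for bounded states. -/
theorem exists_quadratic_bound (lam : ℕ) {M : ℝ} (hM : 0 ≤ M) :
    ∃ C, 0 ≤ C ∧ ∀ x : State, |x.1| ≤ M → |x.2.1| ≤ M → |x.2.2| ≤ M →
      |ptP lam x| ≤ C * (x.1 ^ 2 + x.2.1 ^ 2) ∧ |ptQ lam x| ≤ C * (x.1 ^ 2 + x.2.1 ^ 2) := by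
  set a := (2 * (lam : ℝ) + 1) / 2
  have ha : 0 ≤ a := by positivity
  refine ⟨(a + 1) * M ^ lam * M + M ^ (lam - 1) * M, by positivity, fun x hu hv hξ => ?_⟩
  obtain ⟨u, v, ξ⟩ := x
  simp only at hu hv hξ ⊢
  have hsin : Real.sin (v / 2) ^ 2 ≤ v ^ 2 := by
    have h1 := Real.abs_sin_le_abs (x := v / 2)
    rw [← sq_abs, ← sq_abs v]
    refine pow_le_pow_left₀ (abs_nonneg _) (h1.trans ?_) 2
    rw [abs_div, abs_two]
    linarith [abs_nonneg v]
  have hcos : ∀ n, |Real.cos (v / 2)| ^ n ≤ 1 := fun n =>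
    pow_le_one₀ (abs_nonneg _) (Real.abs_cos_le_one _)
  have hpow : ∀ n, |u| ^ n ≤ M ^ n := fun n => pow_le_pow_left₀ (abs_nonneg _) hu n
  have hX : 0 ≤ M ^ lam * M * (u ^ 2 + v ^ 2) := by positivity
  have hY : 0 ≤ M ^ (lam - 1) * M * (u ^ 2 + v ^ 2) := by positivity
  constructor
  · have e1 : |a * u ^ lam * Real.sin (v / 2) ^ 2 * Real.cos (v / 2) ^ (expo lam - 2)| ≤
        a * M ^ lam * v ^ 2 * 1 := by
      rw [abs_mul, abs_mul, abs_mul, abs_of_nonneg ha, abs_pow, abs_pow _ (expo lam - 2),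
        abs_of_nonneg (sq_nonneg (Real.sin (v / 2)))]
      gcongr
      exact hcos _
    have e2 : |u ^ (lam + 2) * Real.cos (v / 2) ^ expo lam| ≤ M ^ lam * u ^ 2 * 1 := by
      rw [abs_mul, abs_pow, abs_pow, pow_add, sq_abs]
      gcongr
      exact hcos _
    have e3 := (abs_add_le _ _).trans (add_le_add e1 e2)
    calc |ptP lam (u, v, ξ)| ≤ (a * M ^ lam * v ^ 2 * 1 + M ^ lam * u ^ 2 * 1) * M := by
          rw [ptP, abs_mul]; gcongr
      _ ≤ _ := by
        have h1 : 0 ≤ a * (M ^ lam * M) * u ^ 2 := by positivity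
        have h2 : 0 ≤ M ^ lam * M * v ^ 2 := by positivity
        nlinarith
  · have e1 : |ptQ lam (u, v, ξ)| ≤ M ^ (lam - 1) * v ^ 2 * 1 * M := by
      rw [ptQ, abs_mul, abs_mul, abs_mul, abs_pow, abs_pow, abs_pow]
      have hs : |Real.sin (v / 2)| ^ 3 ≤ v ^ 2 := by
        refine le_trans ?_ hsin
        rw [← sq_abs]
        exact pow_le_pow_of_le_one (abs_nonneg _) (Real.abs_sin_le_one _) (by norm_num)
      gcongr
      exact hcos _
    refine e1.trans ?_
    have h1 : 0 ≤ a * (M ^ lam * M * (u ^ 2 + v ^ 2)) := by positivity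
    have h2 : 0 ≤ M ^ (lam - 1) * M * u ^ 2 := by positivity
    nlinarith

/-- The profile `Y ↦ (u, v, ξ)(T, Y)`. -/
def profile (u v ξ : ℝ → ℝ → ℝ) (T Y : ℝ) : State := (u T Y, v T Y, ξ T Y)

theorem IsSolution.hasDerivWithinAt (h : IsSolution lam u₀ T₀ u v ξ) :
    ∀ᵐ Y, ∀ T ∈ Icc 0 T₀, HasDerivWithinAt (fun t => profile u v ξ t Y)
      (field lam (profile u v ξ T) Y) (Icc 0 T₀) T := by
  filter_upwards [h.eq_u, h.eq_v, h.eq_ξ] with Y h1 h2 h3 T hT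
  exact (h1 T hT).prodMk ((h2 T hT).prodMk (h3 T hT))

theorem IsSolution.ae_bound (h : IsSolution lam u₀ T₀ u v ξ) {M : ℝ}
    (hM : ∀ T ∈ Icc 0 T₀, (∀ᵐ Y, |u T Y| ≤ M) ∧ (∀ᵐ Y, |v T Y| ≤ M) ∧ ∀ᵐ Y, |ξ T Y| ≤ M) :
    ∀ᵐ Y, ∀ T ∈ Icc 0 T₀, PtBound M 1 (profile u v ξ T Y) := by
  have c1 : ∀ᵐ Y, ContinuousOn (fun t => |u t Y|) (Icc 0 T₀) := h.eq_u.mono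
    fun Y hY => ContinuousOn.abs fun T hT => (hY T hT).continuousWithinAt
  have c2 : ∀ᵐ Y, ContinuousOn (fun t => |v t Y|) (Icc 0 T₀) := h.eq_v.mono
    fun Y hY => ContinuousOn.abs fun T hT => (hY T hT).continuousWithinAt
  have c3 : ∀ᵐ Y, ContinuousOn (fun t => |ξ t Y|) (Icc 0 T₀) := h.eq_ξ.mono
    fun Y hY => ContinuousOn.abs fun T hT => (hY T hT).continuousWithinAt
  filter_upwards [ae_forall_le continuous_const c1 fun T hT => (hM T hT).1,
    ae_forall_le continuous_const c2 fun T hT => (hM T hT).2.1,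
    ae_forall_le continuous_const c3 fun T hT => (hM T hT).2.2] with Y h1 h2 h3 T hT
  exact ⟨(h1 T hT).trans_eq (mul_one M).symm, (h2 T hT).trans_eq (mul_one M).symm, h3 T hT⟩

/-- A solution of `x' = x h` with `|h| ≤ C` and `x 0 = 1` is at least `exp (-C t)`. -/
theorem exp_neg_le_of_deriv_mul {x h : ℝ → ℝ} {C : ℝ} (hx0 : x 0 = 1)
    (hx : ∀ T ∈ Icc 0 T₀, HasDerivWithinAt x (x T * h T) (Icc 0 T₀) T)
    (hh : ∀ T ∈ Icc 0 T₀, |h T| ≤ C) : ∀ T ∈ Icc 0 T₀, Real.exp (-(C * T)) ≤ x T := by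
  have hc : ContinuousOn x (Icc 0 T₀) := fun T hT => (hx T hT).continuousWithinAt
  -- Working with `x²` makes the monotonicity of `g` independent of the sign of `x`. The sign
  -- follows afterwards: `x²` stays positive, so `x` cannot cross zero.
  set g : ℝ → ℝ := fun t => x t ^ 2 * Real.exp (2 * C * t) with hg
  have hexp : ∀ T, HasDerivAt (fun t => Real.exp (2 * C * t)) (Real.exp (2 * C * T) * (2 * C)) T :=
    fun T => by simpa using ((hasDerivAt_id T).const_mul (2 * C)).exp
  have hmono : MonotoneOn g (Icc 0 T₀) := by
    refine monotoneOn_of_hasDerivWithinAt_nonneg (convex_Icc _ _)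
      (f' := fun T => 2 * x T ^ 2 * (h T + C) * Real.exp (2 * C * T)) ?_ ?_ ?_
    · exact (hc.pow 2).mul (Continuous.continuousOn (by fun_prop))
    · intro T hT
      have hT' := interior_subset hT
      have h1 := (((hx T hT').pow 2).mul (hexp T).hasDerivWithinAt).mono
        (interior_subset (s := Icc 0 T₀))
      refine h1.congr_deriv ?_
      simp only [Nat.cast_ofNat, Nat.add_one_sub_one, pow_one, Pi.pow_apply]
      ring
    · intro T hT
      have h2 := abs_le.1 (hh T (interior_subset hT))
      have : 0 ≤ h T + C := by linarith
      positivity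
  have hsq : ∀ T ∈ Icc 0 T₀, Real.exp (-(C * T)) ^ 2 ≤ x T ^ 2 := by
    intro T hT
    have h1 := hmono ⟨le_rfl, hT.1.trans hT.2⟩ hT hT.1
    simp only [hg, hx0, mul_zero, Real.exp_zero, one_pow, mul_one] at h1
    have h2 : Real.exp (-(C * T)) ^ 2 * Real.exp (2 * C * T) = 1 := by
      rw [← Real.exp_nat_mul, ← Real.exp_add]
      ring_nf
      simp
    have h3 := Real.exp_pos (2 * C * T)
    rw [← h2] at h1
    exact le_of_mul_le_mul_right h1 h3
  intro T hT
  have hpos : 0 ≤ x T := by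
    by_contra hneg
    push Not at hneg
    obtain ⟨S, hS, hS0⟩ : (0 : ℝ) ∈ x '' Icc 0 T :=
      intermediate_value_Icc' hT.1 (hc.mono (Icc_subset_Icc_right hT.2))
        ⟨hneg.le, by rw [hx0]; exact zero_le_one⟩
    have h1 := hsq S ⟨hS.1, hS.2.trans hT.2⟩
    rw [hS0] at h1
    have := Real.exp_pos (-(C * S))
    nlinarith
  exact le_of_sq_le_sq (hsq T hT) hpos

/-- The nonlocal term `P + Q_x` of a solution is bounded. -/
theorem exists_nonlocV_bound (lam : ℕ) {M B : ℝ} (hM : 0 ≤ M) :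
    ∃ C, ∀ w : ℝ → State, (∀ᵐ Y, PtBound M 1 (w Y)) →
      (Integrable fun Y => (w Y).1 ^ 2) → (Integrable fun Y => (w Y).2.1 ^ 2) →
      (∫ Y, (w Y).1 ^ 2) ≤ B → (∫ Y, (w Y).2.1 ^ 2) ≤ B → ∀ Y, |nonlocV lam w Y| ≤ C := by
  obtain ⟨C, hC0, hC⟩ := exists_quadratic_bound lam hM
  refine ⟨(1 + lam) * (C * (B + B)), fun w hb hi1 hi2 h1 h2 Y => ?_⟩
  set g : ℝ → ℝ := fun Y => C * ((w Y).1 ^ 2 + (w Y).2.1 ^ 2) with hg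
  have hgi : Integrable g := (hi1.add hi2).const_mul _
  have hg0 : ∀ Y, 0 ≤ g Y := fun Y => by positivity
  have hgB : ∫ Y, g Y ≤ C * (B + B) := by
    rw [hg, integral_const_mul, integral_add hi1 hi2]
    gcongr
  have hP : ∀ᵐ Y, |ptP lam (w Y)| ≤ g Y := hb.mono fun Y hY =>
    (hC _ (by simpa using hY.1) (by simpa using hY.2.1) hY.2.2).1
  have hQ : ∀ᵐ Y, |ptQ lam (w Y)| ≤ g Y := hb.mono fun Y hY =>
    (hC _ (by simpa using hY.1) (by simpa using hY.2.1) hY.2.2).2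
  have e1 := (abs_kint_le_integral univ (fun y => ptW lam (w y)) hgi hg0 hP Y).trans hgB
  have e2 := (abs_kint_le_integral (Ioi Y) (fun y => ptW lam (w y)) hgi hg0 hQ Y).trans hgB
  have e3 := (abs_kint_le_integral (Iio Y) (fun y => ptW lam (w y)) hgi hg0 hQ Y).trans hgB
  have hl : (0 : ℝ) ≤ lam := Nat.cast_nonneg _
  have hD : 0 ≤ C * (B + B) := (abs_nonneg _).trans e1
  rw [nonlocV_eq]
  refine (abs_add_le _ _).trans ?_
  rw [abs_mul, abs_mul, abs_of_pos one_half_pos, abs_of_nonneg (by positivity : (0:ℝ) ≤ lam / 4)]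
  have e4 := mul_le_mul_of_nonneg_left ((abs_sub _ _).trans (add_le_add e2 e3))
    (by positivity : (0:ℝ) ≤ lam / 4)
  nlinarith [mul_nonneg hl hD]

/-- Decay of the kernel requires a lower bound on `ξ`, so the argument cannot start from it. The
kernel is at most `1` and the densities are quadratic in `(u, v)`, so `P + Q_x` is bounded by the
`L²` norms alone; the equation for `ξ` then reads `ξ_T = ξ h` with `|h| ≤ C`, which gives `ξ ≥ exp
(-C T₀)`. -/
theorem IsSolution.exists_adm (hT₀ : 0 ≤ T₀) (h : IsSolution lam u₀ T₀ u v ξ) :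
    ∃ M m B, 0 ≤ M ∧ 0 < m ∧ (∀ T ∈ Icc 0 T₀, Adm (fun _ => 1) M m B (profile u v ξ T)) ∧
      ∀ᵐ Y, ∀ T ∈ Icc 0 T₀, PtBound M 1 (profile u v ξ T Y) := by
  obtain ⟨M, B, hM, hb⟩ := h.exists_bound
  have hpt := h.ae_bound (M := M) fun T hT => ⟨(hb T hT).1, (hb T hT).2.1, (hb T hT).2.2.1⟩
  have hptT : ∀ T ∈ Icc 0 T₀, ∀ᵐ Y, PtBound M 1 (profile u v ξ T Y) := fun T hT =>
    hpt.mono fun Y hY => hY T hT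
  obtain ⟨N, hN⟩ := exists_nonlocV_bound lam (B := B) hM
  have hNT : ∀ T ∈ Icc 0 T₀, ∀ Y, |nonlocV lam (profile u v ξ T) Y| ≤ N := fun T hT =>
    hN _ (hptT T hT) (hb T hT).2.2.2.1 (hb T hT).2.2.2.2.1 (hb T hT).2.2.2.2.2.1
      (hb T hT).2.2.2.2.2.2
  have hN0 : 0 ≤ N := (abs_nonneg _).trans (hNT 0 ⟨le_rfl, hT₀⟩ 0)
  set C := ((lam : ℝ) + 1) * (M ^ lam + M ^ (lam + 2) + N) with hC
  have hC0 : 0 ≤ C := by positivity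
  have hξ : ∀ᵐ Y, ∀ T ∈ Icc 0 T₀, Real.exp (-(C * T₀)) ≤ ξ T Y := by
    filter_upwards [h.eq_ξ, hpt, h.init_ξ] with Y h1 h2 h3 T hT
    refine le_trans (Real.exp_le_exp.2 (neg_le_neg (mul_le_mul_of_nonneg_left hT.2 hC0)))
      (exp_neg_le_of_deriv_mul (x := fun t => ξ t Y) (h := fun t =>
        (((lam : ℝ) + 1) / 2 * u t Y ^ lam + ((lam : ℝ) + 1) * u t Y ^ (lam + 2) -
          ((lam : ℝ) + 1) * nonlocV lam (profile u v ξ t) Y) * Real.sin (v t Y)) h3 ?_ ?_ T hT)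
    · intro S hS
      convert h1 S hS using 1
      simp only [rhsXi, nonlocV, profile]
      ring
    · intro S hS
      have b1 : |u S Y| ≤ M := by simpa [profile] using (h2 S hS).1
      have b2 : ∀ n, |u S Y ^ n| ≤ M ^ n := fun n => by
        rw [abs_pow]; exact pow_le_pow_left₀ (abs_nonneg _) b1 n
      have b3 := hNT S hS Y
      have hl : (0 : ℝ) ≤ (lam : ℝ) + 1 := by positivity
      rw [abs_mul]
      have b4 : |((lam : ℝ) + 1) / 2 * u S Y ^ lam + ((lam : ℝ) + 1) * u S Y ^ (lam + 2) -
          ((lam : ℝ) + 1) * nonlocV lam (profile u v ξ S) Y| ≤ C := by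
        have e : ((lam : ℝ) + 1) / 2 * u S Y ^ lam + ((lam : ℝ) + 1) * u S Y ^ (lam + 2) -
          ((lam : ℝ) + 1) * nonlocV lam (profile u v ξ S) Y = ((lam : ℝ) + 1) *
            (u S Y ^ lam / 2 + u S Y ^ (lam + 2) - nonlocV lam (profile u v ξ S) Y) := by ring
        rw [e, abs_mul, abs_of_nonneg hl, hC]
        refine mul_le_mul_of_nonneg_left ?_ hl
        have c1 := abs_le.1 (b2 lam)
        have c2 := abs_le.1 (b2 (lam + 2))
        have c3 := abs_le.1 b3
        rw [abs_le]
        constructor <;> linarith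
      calc _ ≤ C * 1 := mul_le_mul b4 (Real.abs_sin_le_one _) (abs_nonneg _) hC0
        _ = C := mul_one C
  refine ⟨M, Real.exp (-(C * T₀)), B, hM, Real.exp_pos _, fun T hT => ?_, hpt⟩
  have hmem := h.mem T hT
  exact ⟨hmem.1.1.1.1.prodMk (hmem.2.1.1.1.prodMk hmem.2.2.1), hptT T hT,
    hξ.mono fun Y hY => hY T hT, (hb T hT).2.2.2.2.1, (hb T hT).2.2.2.2.2.2⟩

theorem Adm.mono {ρ : ℝ → ℝ} {M m B M' m' B' : ℝ} {w : ℝ → State} (h : Adm ρ M m B w)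
    (hρ : ∀ Y, 0 ≤ ρ Y) (hM : M ≤ M') (hm : m' ≤ m) (hB : B ≤ B') : Adm ρ M' m' B' w where
  aesm := h.aesm
  bound := h.bound.mono fun Y hY => ⟨hY.1.trans (mul_le_mul_of_nonneg_right hM (hρ Y)),
    hY.2.1.trans (mul_le_mul_of_nonneg_right hM (hρ Y)), hY.2.2.trans hM⟩
  lower := h.lower.mono fun _ hY => hm.trans hY
  integrable_sq := h.integrable_sq
  integral_sq_le := h.integral_sq_le.trans hB

theorem hasDerivWithinAt_Ici_of_Icc {E : Type*} [NormedAddCommGroup E] [NormedSpace ℝ E]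
    {f : ℝ → E} {f' : E} {T : ℝ} (hT : T ∈ Ico 0 T₀)
    (h : HasDerivWithinAt f f' (Icc 0 T₀) T) : HasDerivWithinAt f f' (Ici T) T := by
  refine h.mono_of_mem_nhdsWithin ?_
  exact mem_of_superset (Icc_mem_nhdsGE hT.2) (Icc_subset_Icc_left hT.1)

/-- The rate of change of the difference at one `Y` depends on the difference at almost all points,
so Gronwall's inequality cannot be used for a single `Y`. Instead a bound `D n T` valid for almost
every `Y` is inserted in the Lipschitz estimate and integrated in time from equal data, which gives
`D (n + 1) T`; the factorial drives the bounds to zero. -/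
theorem IsSolution.ae_eq (hlam : 1 ≤ lam) (hT₀ : 0 ≤ T₀) (h : IsSolution lam u₀ T₀ u v ξ)
    (h' : IsSolution lam u₀ T₀ u' v' ξ') :
    ∀ᵐ Y, ∀ T ∈ Icc 0 T₀, profile u v ξ T Y = profile u' v' ξ' T Y := by
  obtain ⟨M₁, m₁, B₁, hM₁, hm₁, ha, hp⟩ := h.exists_adm hT₀
  obtain ⟨M₂, m₂, B₂, hM₂, hm₂, ha', hp'⟩ := h'.exists_adm hT₀
  set M := max M₁ M₂
  set m := min m₁ m₂
  set B := max B₁ B₂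
  have hM : 0 ≤ M := hM₁.trans (le_max_left _ _)
  have hm : 0 < m := lt_min hm₁ hm₂
  have ptm : ∀ {K : ℝ} {x : State}, K ≤ M → PtBound K 1 x → PtBound M 1 x := by
    intro K x hK hx
    exact ⟨hx.1.trans (by linarith), hx.2.1.trans (by linarith), hx.2.2.trans hK⟩
  replace ha : ∀ T ∈ Icc 0 T₀, Adm (fun _ => 1) M m B (profile u v ξ T) := fun T hT =>
    (ha T hT).mono (fun _ => zero_le_one) (le_max_left _ _) (min_le_left _ _) (le_max_left _ _)
  replace ha' : ∀ T ∈ Icc 0 T₀, Adm (fun _ => 1) M m B (profile u' v' ξ' T) := fun T hT =>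
    (ha' T hT).mono (fun _ => zero_le_one) (le_max_right _ _) (min_le_right _ _) (le_max_right _ _)
  obtain ⟨C, hC0, -, hC⟩ := exists_field_bound lam hlam hM hm B
    (weight_one (half_pos (rate_pos lam hm))) (R := 1) (fun _ => le_rfl)
  -- Each profile has norm at most `M * (1 + 1)` by `PtBound.norm_le` with weight `1`, which gives
  -- `D 0`; the derivative of `D (n + 1)` is `C * D n`.
  set D : ℕ → ℝ → ℝ := fun n T => 2 * (M * (1 + 1)) * ((C * T) ^ n / n.factorial) with hD
  have key : ∀ n, ∀ᵐ Y, ∀ T ∈ Icc 0 T₀,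
      ‖profile u v ξ T Y - profile u' v' ξ' T Y‖ ≤ D n T := by
    intro n
    induction n with
    | zero =>
      filter_upwards [hp, hp'] with Y h1 h2 T hT
      have e1 := (ptm (le_max_left _ _) (h1 T hT)).norm_le hM le_rfl zero_le_one
      have e2 := (ptm (le_max_right _ _) (h2 T hT)).norm_le hM le_rfl zero_le_one
      simp only [hD, pow_zero, Nat.factorial_zero, Nat.cast_one, div_one, mul_one]
      exact (norm_sub_le _ _).trans (by linarith)
    | succ n ih =>
      filter_upwards [ih, hp, hp', h.hasDerivWithinAt, h'.hasDerivWithinAt, h.init_u, h.init_v,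
        h.init_ξ, h'.init_u, h'.init_v, h'.init_ξ] with Y h1 h2 h3 h4 h5 i1 i2 i3 j1 j2 j3
      have hder : ∀ T, HasDerivAt (D (n + 1)) (C * D n T) T := by
        intro T
        have := ((((hasDerivAt_id T).const_mul C).pow (n + 1)).div_const
          ((n + 1).factorial : ℝ)).const_mul (2 * (M * (1 + 1)))
        refine this.congr_deriv ?_
        have hf : ((n + 1).factorial : ℝ) = (n + 1) * n.factorial := by
          rw [Nat.factorial_succ]; push_cast; ring
        have hn : (n.factorial : ℝ) ≠ 0 := by positivity
        simp only [hD, hf, id, Nat.add_sub_cancel]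
        push_cast
        field_simp
      refine fun T hT => image_norm_le_of_norm_deriv_right_le_deriv_boundary'
        (f := fun T => profile u v ξ T Y - profile u' v' ξ' T Y)
        (f' := fun T => field lam (profile u v ξ T) Y - field lam (profile u' v' ξ' T) Y)
        (B := D (n + 1)) (B' := fun T => C * D n T) ?_ ?_ ?_ ?_ ?_ ?_ hT
      · exact fun S hS => ((h4 S hS).sub (h5 S hS)).continuousWithinAt
      · exact fun S hS => hasDerivWithinAt_Ici_of_Icc hS
          ((h4 S (Ico_subset_Icc_self hS)).sub (h5 S (Ico_subset_Icc_self hS)))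
      · simp [profile, i1, i2, i3, j1, j2, j3, hD]
      · exact fun S _ => (hder S).continuousAt.continuousWithinAt
      · exact fun S _ => (hder S).hasDerivWithinAt
      · intro S hS
        have hS' := Ico_subset_Icc_self hS
        have hDn : 0 ≤ D n S := by
          have := hS.1
          positivity
        have := hC _ _ (ha S hS') (ha' S hS') (D n S) hDn
          (ih.mono fun Y' hY' => by simpa using hY' S hS') Y
          (ptm (le_max_left _ _) (h2 S hS')) (ptm (le_max_right _ _) (h3 S hS'))
          (by simpa using h1 S hS')
        simpa using this
  filter_upwards [ae_all_iff.2 key] with Y hY T hT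
  have hlim : Tendsto (fun n => D n T) atTop (𝓝 0) := by
    simpa using (FloorSemiring.tendsto_pow_div_factorial_atTop (C * T)).const_mul
      (2 * (M * (1 + 1)))
  have := ge_of_tendsto' hlim fun n => hY n T hT
  exact sub_eq_zero.1 (norm_le_zero_iff.1 this)

end LambdaFamily
end

/-! ### The change of variables at time zero and the initial data. -/

noncomputable section

namespace LambdaFamily

variable {lam : ℕ} {u₀ : ℝ → ℝ}

/-- The derivative of the characteristic coordinate at time zero. -/
def labelDensity (lam : ℕ) (u₀ : ℝ → ℝ) (s : ℝ) : ℝ := (1 + weakDeriv u₀ s ^ 2) ^ (lam + 1)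

theorem one_le_labelDensity (lam : ℕ) (u₀ : ℝ → ℝ) (s : ℝ) : 1 ≤ labelDensity lam u₀ s :=
  one_le_pow₀ (by nlinarith [sq_nonneg (weakDeriv u₀ s)])

theorem labelDensity_le (lam : ℕ) (u₀ : ℝ → ℝ) (s : ℝ) :
    labelDensity lam u₀ s ≤ 2 ^ lam * (1 + weakDeriv u₀ s ^ expo lam) := by
  have h2 := add_pow_le (zero_le_one' ℝ) (sq_nonneg (weakDeriv u₀ s)) (lam + 1)
  have h3 : (weakDeriv u₀ s ^ 2) ^ (lam + 1) = weakDeriv u₀ s ^ expo lam := by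
    rw [← pow_mul]; rfl
  rw [labelDensity]
  simpa [h3] using h2

theorem even_expo (lam : ℕ) : Even (expo lam) := ⟨lam + 1, by simp [expo]; ring⟩

section

variable (h : MemW1 (expo lam) u₀)
include h

theorem aestronglyMeasurable_labelDensity :
    AEStronglyMeasurable (labelDensity lam u₀) volume :=
  (((h.memLp_weakDeriv.1.pow 2).const_add 1)).pow (lam + 1)

theorem integrable_weakDeriv_pow : Integrable fun s => weakDeriv u₀ s ^ expo lam := by
  refine (h.memLp_weakDeriv.integrable_norm_pow (by simp [expo])).congr
    (Eventually.of_forall fun s => ?_)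
  simp [(even_expo lam).pow_abs]

theorem intervalIntegrable_labelDensity (a b : ℝ) :
    IntervalIntegrable (labelDensity lam u₀) volume a b := by
  have hdom : IntervalIntegrable (fun s => 2 ^ lam * (1 + weakDeriv u₀ s ^ expo lam)) volume a b :=
    (intervalIntegrable_const.add (integrable_weakDeriv_pow h).intervalIntegrable).const_mul _
  refine hdom.mono_fun (aestronglyMeasurable_labelDensity h).restrict
    (Eventually.of_forall fun s => ?_)
  change ‖labelDensity lam u₀ s‖ ≤ ‖_‖
  rw [Real.norm_of_nonneg (zero_le_one.trans (one_le_labelDensity lam u₀ s))]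
  exact (labelDensity_le lam u₀ s).trans (le_abs_self _)

theorem label_sub (a b : ℝ) :
    label lam u₀ b - label lam u₀ a = ∫ s in a..b, labelDensity lam u₀ s :=
  intervalIntegral.integral_interval_sub_left (intervalIntegrable_labelDensity h 0 b)
    (intervalIntegrable_labelDensity h 0 a)

theorem strictMono_label : StrictMono (label lam u₀) := by
  intro a b hab
  have h1 := intervalIntegral.integral_mono_on hab.le intervalIntegrable_const
    (intervalIntegrable_labelDensity h a b) fun s _ => one_le_labelDensity lam u₀ s
  rw [← label_sub h] at h1
  simp at h1
  linarith

theorem label_x₀ (Y : ℝ) : label lam u₀ (x₀ lam u₀ Y) = Y :=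
  Function.rightInverse_invFun (label_bijective h).2 Y

theorem x₀_label (x : ℝ) : x₀ lam u₀ (label lam u₀ x) = x :=
  Function.leftInverse_invFun (label_bijective h).1 x

theorem strictMono_x₀ : StrictMono (x₀ lam u₀) := by
  intro a b hab
  rw [← (strictMono_label h).lt_iff_lt, label_x₀ h, label_x₀ h]
  exact hab

theorem continuous_x₀ : Continuous (x₀ lam u₀) :=
  (strictMono_x₀ h).monotone.continuous_of_surjective fun x => ⟨_, x₀_label h x⟩

/-- The preimage of an interval under `x₀` is the interval between the labels of its endpoints,
whose length is the integral of `labelDensity`; agreement on rational intervals determines the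
measure. All transfers of null sets and integrals between `Y` and `x` rest on this. -/
theorem map_x₀ : (volume : Measure ℝ).map (x₀ lam u₀) =
    volume.withDensity fun s => ENNReal.ofReal (labelDensity lam u₀ s) := by
  have hm := (continuous_x₀ h).measurable
  have hpre : ∀ p q, x₀ lam u₀ ⁻¹' Ioo p q = Ioo (label lam u₀ p) (label lam u₀ q) := by
    intro p q
    ext Y
    simp only [mem_preimage, mem_Ioo]
    rw [← (strictMono_label h).lt_iff_lt, ← (strictMono_label h).lt_iff_lt (a := x₀ lam u₀ Y),
      label_x₀ h]
  have hval : ∀ p q, (volume : Measure ℝ).map (x₀ lam u₀) (Ioo p q) =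
      ENNReal.ofReal (label lam u₀ q - label lam u₀ p) := by
    intro p q
    rw [Measure.map_apply hm measurableSet_Ioo, hpre, Real.volume_Ioo]
  have : IsLocallyFiniteMeasure ((volume : Measure ℝ).map (x₀ lam u₀)) :=
    ⟨fun x => ⟨Ioo (x - 1) (x + 1), Ioo_mem_nhds (by linarith) (by linarith), by
      rw [hval]; exact ENNReal.ofReal_lt_top⟩⟩
  refine Real.measure_ext_Ioo_rat fun p q => ?_
  rw [hval, withDensity_apply _ measurableSet_Ioo]
  rcases le_or_gt (q : ℝ) p with hpq | hpq
  · rw [Ioo_eq_empty (not_lt.2 hpq)]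
    simp [(strictMono_label h).monotone hpq]
  · have hi : IntegrableOn (labelDensity lam u₀) (Ioo (p : ℝ) q) :=
      ((intervalIntegrable_iff_integrableOn_Ioo_of_le hpq.le).1
        (intervalIntegrable_labelDensity h p q))
    rw [← ofReal_integral_eq_lintegral_ofReal hi (Eventually.of_forall fun s =>
      zero_le_one.trans (one_le_labelDensity lam u₀ s)), label_sub h,
      intervalIntegral.integral_of_le hpq.le, integral_Ioc_eq_integral_Ioo]

theorem map_x₀_absolutelyContinuous : (volume : Measure ℝ).map (x₀ lam u₀) ≪ volume := by
  rw [map_x₀ h]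
  exact withDensity_absolutelyContinuous _ _

theorem aestronglyMeasurable_comp_x₀ {g : ℝ → ℝ} (hg : AEStronglyMeasurable g volume) :
    AEStronglyMeasurable (fun Y => g (x₀ lam u₀ Y)) volume :=
  (hg.mono_ac (map_x₀_absolutelyContinuous h)).comp_aemeasurable
    (continuous_x₀ h).measurable.aemeasurable

theorem integrable_comp_x₀ {g : ℝ → ℝ} (hg : AEStronglyMeasurable g volume)
    (hi : Integrable fun x => labelDensity lam u₀ x * g x) :
    Integrable fun Y => g (x₀ lam u₀ Y) := by
  have hm := (continuous_x₀ h).measurable.aemeasurable (μ := volume)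
  have h1 : Integrable g ((volume : Measure ℝ).map (x₀ lam u₀)) := by
    rw [map_x₀ h, integrable_withDensity_iff_integrable_smul₀'
      (aestronglyMeasurable_labelDensity h).aemeasurable.ennreal_ofReal
      (Eventually.of_forall fun _ => ENNReal.ofReal_lt_top)]
    refine hi.congr (Eventually.of_forall fun x => ?_)
    simp only [smul_eq_mul]
    rw [ENNReal.toReal_ofReal (zero_le_one.trans (one_le_labelDensity lam u₀ x))]
  exact (integrable_map_measure (hg.mono_ac (map_x₀_absolutelyContinuous h)) hm).1 h1

theorem integral_comp_x₀ {g : ℝ → ℝ} (hg : AEStronglyMeasurable g volume) (a b : ℝ) :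
    ∫ Y in a..b, g (x₀ lam u₀ Y) =
      ∫ x in (x₀ lam u₀ a)..(x₀ lam u₀ b), labelDensity lam u₀ x * g x := by
  wlog hab : a ≤ b generalizing a b
  · rw [intervalIntegral.integral_symm, this b a (le_of_not_ge hab),
      ← intervalIntegral.integral_symm]
  have hm := (continuous_x₀ h).measurable.aemeasurable (μ := volume)
  have hpre : x₀ lam u₀ ⁻¹' Ioc (x₀ lam u₀ a) (x₀ lam u₀ b) = Ioc a b := by
    ext Y
    simp only [mem_preimage, mem_Ioc, (strictMono_x₀ h).lt_iff_lt, (strictMono_x₀ h).le_iff_le]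
  rw [intervalIntegral.integral_of_le hab,
    intervalIntegral.integral_of_le ((strictMono_x₀ h).monotone hab), ← hpre,
    ← setIntegral_map measurableSet_Ioc (hg.mono_ac (map_x₀_absolutelyContinuous h)) hm,
    map_x₀ h, setIntegral_withDensity_eq_setIntegral_toReal_smul₀
      (aestronglyMeasurable_labelDensity h).aemeasurable.ennreal_ofReal.restrict
      (Eventually.of_forall fun _ => ENNReal.ofReal_lt_top) _ measurableSet_Ioc]
  refine integral_congr_ae (Eventually.of_forall fun x => ?_)
  simp only [smul_eq_mul]
  rw [ENNReal.toReal_ofReal (zero_le_one.trans (one_le_labelDensity lam u₀ x))]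

end

theorem abs_arctan_le (x : ℝ) : |Real.arctan x| ≤ |x| := by
  wlog hx : 0 ≤ x generalizing x
  · have := this (-x) (by linarith)
    rwa [Real.arctan_neg, abs_neg, abs_neg] at this
  have h1 : 0 ≤ Real.arctan x := Real.arctan_nonneg.2 hx
  have h2 := Real.le_tan h1 (Real.arctan_lt_pi_div_two x)
  rw [Real.tan_arctan] at h2
  rwa [abs_of_nonneg h1, abs_of_nonneg hx]

theorem abs_arctan_le_two (x : ℝ) : |Real.arctan x| ≤ 2 := by
  rw [abs_le]
  have h1 := Real.arctan_lt_pi_div_two x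
  have h2 := Real.neg_pi_div_two_lt_arctan x
  have h3 := Real.pi_le_four
  constructor <;> linarith

/-- With `v = 2 arctan u_x`, the right side is `u_x` divided by the derivative of the label, that
is, the derivative of `u` in `Y`; the left side is the same quantity in terms of `v`. -/
theorem sin_arctan_mul_cos_arctan_pow (n : ℕ) (x : ℝ) :
    Real.sin (Real.arctan x) * Real.cos (Real.arctan x) ^ (2 * n + 1) =
      x / (1 + x ^ 2) ^ (n + 1) := by
  have h0 : 0 < 1 + x ^ 2 := by positivity
  have h1 : Real.sqrt (1 + x ^ 2) ^ 2 = 1 + x ^ 2 := Real.sq_sqrt h0.le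
  rw [Real.sin_arctan, Real.cos_arctan, one_div_pow, div_mul_div_comm, mul_one, ← pow_succ',
    show 2 * n + 1 + 1 = 2 * (n + 1) by ring, pow_mul, h1]

/-- The data of the Cauchy problem in the characteristic coordinate: `u` has an absolutely
continuous representative whose derivative is a function of `v`. -/
theorem exists_initial_data (h2 : MemW1 2 u₀) (hk : MemW1 (expo lam) u₀) :
    ∃ U V : ℝ → ℝ, U =ᵐ[volume] (fun Y => u₀ (x₀ lam u₀ Y)) ∧
      (∀ Y, V Y = 2 * Real.arctan (weakDeriv u₀ (x₀ lam u₀ Y))) ∧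
      HasACDeriv U (fun Y => Real.sin (V Y / 2) * Real.cos (V Y / 2) ^ (2 * lam + 1)) ∧
      AEStronglyMeasurable V volume ∧ (∃ M, ∀ Y, |U Y| ≤ M) ∧ (∃ M, ∀ Y, |V Y| ≤ M) ∧
      (Integrable fun Y => U Y ^ 2) ∧ Integrable fun Y => V Y ^ 2 := by
  obtain ⟨g, hg, -⟩ := h2.2
  obtain ⟨F, hF, hae⟩ := (weakDeriv_spec hg).exists_hasACDeriv
  set W := weakDeriv u₀ with hW
  have hWm : AEStronglyMeasurable W volume := h2.memLp_weakDeriv.1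
  have hW2 : Integrable fun x => W x ^ 2 := h2.memLp_weakDeriv.integrable_sq
  have hWk : Integrable fun x => W x ^ expo lam := integrable_weakDeriv_pow hk
  have hF2 : Integrable fun x => F x ^ 2 :=
    h2.1.integrable_sq.congr (hae.mono fun x hx => by simp only [hx])
  set K := 2 + (∫ x, F x ^ 2) + ∫ x, W x ^ 2
  have hK : ∀ x, |F x| ≤ K := hF.abs_le_of_integrable_sq hF2 hW2
  have hV : AEStronglyMeasurable (fun Y => 2 * Real.arctan (W (x₀ lam u₀ Y))) volume :=
    (Real.continuous_arctan.comp_aestronglyMeasurable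
      (aestronglyMeasurable_comp_x₀ hk hWm)).const_mul 2
  have hwk0 : ∀ x, 0 ≤ W x ^ expo lam := fun x => (even_expo lam).pow_nonneg _
  have hdens : ∀ x, labelDensity lam u₀ x ≤ 2 ^ lam * (1 + W x ^ expo lam) := labelDensity_le lam u₀
  have hdens0 : ∀ x, 0 ≤ labelDensity lam u₀ x := fun x =>
    zero_le_one.trans (one_le_labelDensity lam u₀ x)
  refine ⟨fun Y => F (x₀ lam u₀ Y), fun Y => 2 * Real.arctan (W (x₀ lam u₀ Y)), ?_, fun _ => rfl,
    ?_, hV, ⟨K, fun Y => hK _⟩, ⟨4, fun Y => ?_⟩, ?_, ?_⟩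
  -- `u₀` and its continuous representative differ on a null set in `x`, whose preimage under `x₀`
  -- is null by absolute continuity of the image measure.
  · have h1 : ∀ᵐ x ∂((volume : Measure ℝ).map (x₀ lam u₀)), u₀ x = F x :=
      (map_x₀_absolutelyContinuous hk).ae_le hae
    exact (ae_of_ae_map (continuous_x₀ hk).measurable.aemeasurable h1).mono fun Y hY => hY.symm
  · have hz : ∀ Y, Real.sin (2 * Real.arctan (W (x₀ lam u₀ Y)) / 2) *
        Real.cos (2 * Real.arctan (W (x₀ lam u₀ Y)) / 2) ^ (2 * lam + 1) =
        W (x₀ lam u₀ Y) / labelDensity lam u₀ (x₀ lam u₀ Y) := fun Y => by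
      rw [mul_div_cancel_left₀ _ two_ne_zero, sin_arctan_mul_cos_arctan_pow]
      rfl
    have hb : ∀ Y, |Real.sin (2 * Real.arctan (W (x₀ lam u₀ Y)) / 2) *
        Real.cos (2 * Real.arctan (W (x₀ lam u₀ Y)) / 2) ^ (2 * lam + 1)| ≤ 1 := fun Y => by
      rw [abs_mul, abs_pow]
      exact mul_le_one₀ (Real.abs_sin_le_one _) (by positivity)
        (pow_le_one₀ (abs_nonneg _) (Real.abs_cos_le_one _))
    refine HasACDeriv.of_primitive (fun a b => ?_) fun x => ?_
    · refine (intervalIntegrable_const (c := (1 : ℝ))).mono_fun ?_ (Eventually.of_forall fun Y => ?_)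
      · have hc : Continuous fun y : ℝ => Real.sin (y / 2) * Real.cos (y / 2) ^ (2 * lam + 1) := by
          fun_prop
        exact (hc.comp_aestronglyMeasurable hV).restrict
      · simpa using hb Y
    -- Passing to the variable `x` cancels `labelDensity` and leaves the integral of the weak
    -- derivative of `u₀`.
    · simp_rw [hz]
      rw [integral_comp_x₀ hk (g := fun x => W x / labelDensity lam u₀ x)
        (hWm.aemeasurable.div
          (aestronglyMeasurable_labelDensity hk).aemeasurable).aestronglyMeasurable,
        ← hF.integral_eq_sub]
      refine intervalIntegral.integral_congr fun x _ => ?_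
      have := zero_lt_one.trans_le (one_le_labelDensity lam u₀ x)
      field_simp
  · rw [abs_mul, abs_two]
    linarith [abs_arctan_le_two (W (x₀ lam u₀ Y))]
  -- The label density is at most `2^lam (1 + W^k)`. The first term uses `F ∈ L²`, the second `F`
  -- bounded and `W ∈ L^k`; this is where the `W^{1,k}` assumption enters.
  · refine integrable_comp_x₀ hk (g := fun x => F x ^ 2)
      (hF.continuous.pow 2).aestronglyMeasurable ?_
    refine ((hF2.add (hWk.const_mul (K ^ 2))).const_mul (2 ^ lam)).mono'
      ((aestronglyMeasurable_labelDensity hk).mul (hF.continuous.pow 2).aestronglyMeasurable)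
      (Eventually.of_forall fun x => ?_)
    have e1 : F x ^ 2 ≤ K ^ 2 := by
      rw [← sq_abs]; exact pow_le_pow_left₀ (abs_nonneg _) (hK x) 2
    rw [Real.norm_of_nonneg (mul_nonneg (hdens0 x) (sq_nonneg _))]
    calc labelDensity lam u₀ x * F x ^ 2 ≤ 2 ^ lam * (1 + W x ^ expo lam) * F x ^ 2 :=
          mul_le_mul_of_nonneg_right (hdens x) (sq_nonneg _)
      _ = 2 ^ lam * (F x ^ 2 + F x ^ 2 * W x ^ expo lam) := by ring
      _ ≤ 2 ^ lam * (F x ^ 2 + K ^ 2 * W x ^ expo lam) := by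
          have := hwk0 x
          gcongr
  -- Here `|arctan W| ≤ |W|` is used against the constant term of the density bound, and `|arctan W|
  -- ≤ 2` against `W^k`.
  · have hm : AEStronglyMeasurable (fun x => (2 * Real.arctan (W x)) ^ 2) volume :=
      ((Real.continuous_arctan.comp_aestronglyMeasurable hWm).const_mul 2).pow 2
    refine integrable_comp_x₀ hk (g := fun x => (2 * Real.arctan (W x)) ^ 2) hm ?_
    refine (((hW2.const_mul 4).add (hWk.const_mul 16)).const_mul (2 ^ lam)).mono'
      ((aestronglyMeasurable_labelDensity hk).mul hm) (Eventually.of_forall fun x => ?_)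
    have e1 : (2 * Real.arctan (W x)) ^ 2 ≤ 4 * W x ^ 2 := by
      have := pow_le_pow_left₀ (abs_nonneg _) (abs_arctan_le (W x)) 2
      rw [sq_abs, sq_abs] at this
      nlinarith
    have e2 : (2 * Real.arctan (W x)) ^ 2 ≤ 16 := by
      have := pow_le_pow_left₀ (abs_nonneg _) (abs_arctan_le_two (W x)) 2
      rw [sq_abs] at this
      nlinarith
    rw [Real.norm_of_nonneg (mul_nonneg (hdens0 x) (sq_nonneg _))]
    calc labelDensity lam u₀ x * (2 * Real.arctan (W x)) ^ 2
        ≤ 2 ^ lam * (1 + W x ^ expo lam) * (2 * Real.arctan (W x)) ^ 2 :=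
          mul_le_mul_of_nonneg_right (hdens x) (sq_nonneg _)
      _ = 2 ^ lam * ((2 * Real.arctan (W x)) ^ 2 +
            (2 * Real.arctan (W x)) ^ 2 * W x ^ expo lam) := by ring
      _ ≤ 2 ^ lam * (4 * W x ^ 2 + 16 * W x ^ expo lam) := by
          have := hwk0 x
          gcongr

end LambdaFamily
end

/-! ### Construction of the weight. -/

noncomputable section

namespace LambdaFamily

section

variable {H : ℝ → ℝ} {α : ℝ}

theorem integrable_exp_mul_prod (hα : 0 < α) (hH : Integrable H) :
    Integrable (fun p : ℝ × ℝ => Real.exp (-(α * |p.2 - p.1|)) * H p.2)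
      (volume.prod volume) := by
  have hm : AEStronglyMeasurable (fun p : ℝ × ℝ => Real.exp (-(α * |p.2 - p.1|)) * H p.2)
      (volume.prod volume) :=
    (Continuous.aestronglyMeasurable (by fun_prop)).mul hH.1.comp_snd
  have hsymm : ∀ Z, (fun Y => Real.exp (-(α * |Z - Y|))) = fun Y => Real.exp (-(α * |Y - Z|)) :=
    fun Z => funext fun Y => by rw [abs_sub_comm]
  rw [integrable_prod_iff' hm]
  constructor
  · refine Eventually.of_forall fun Z => ?_
    simp only
    refine Integrable.mul_const ?_ _
    rw [hsymm]
    exact integrable_exp_neg_mul_abs_sub hα Z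
  · have : (fun Z => ∫ Y, ‖Real.exp (-(α * |Z - Y|)) * H Z‖) = fun Z => 2 / α * ‖H Z‖ := by
      funext Z
      simp_rw [norm_mul, Real.norm_of_nonneg (Real.exp_pos _).le]
      rw [integral_mul_const, hsymm, integral_exp_neg_mul_abs_sub hα]
    simp only
    rw [this]
    exact hH.norm.const_mul _

/-- The convolution of `exp (-α |·|)` with `H`. -/
def expConv (α : ℝ) (H : ℝ → ℝ) (Y : ℝ) : ℝ := ∫ Z, Real.exp (-(α * |Z - Y|)) * H Z

theorem integrable_expConv (hα : 0 < α) (hH : Integrable H) : Integrable (expConv α H) :=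
  (integrable_exp_mul_prod hα hH).integral_prod_left

theorem integrable_exp_mul (hα : 0 < α) (hH : Integrable H) (Y : ℝ) :
    Integrable fun Z => Real.exp (-(α * |Z - Y|)) * H Z := by
  refine hH.norm.mono' ((Continuous.aestronglyMeasurable (by fun_prop)).mul hH.1)
    (Eventually.of_forall fun Z => ?_)
  rw [norm_mul, Real.norm_of_nonneg (Real.exp_pos _).le]
  exact mul_le_of_le_one_left (norm_nonneg _)
    (Real.exp_le_one_iff.2 (neg_nonpos.2 (by positivity)))

theorem expConv_nonneg (hH0 : ∀ Y, 0 ≤ H Y) (Y : ℝ) : 0 ≤ expConv α H Y :=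
  integral_nonneg fun Z => mul_nonneg (Real.exp_pos _).le (hH0 Z)

/-- Half of the faster rate `2α` moves the centre of the slower kernel from `Y'` to `Y` by the
triangle inequality; the other half is integrated in `Y'` and gives `2 / α`. -/
theorem expConv_expConv_le (hα : 0 < α) (hH : Integrable H) (hH0 : ∀ Y, 0 ≤ H Y) (Y : ℝ) :
    expConv (2 * α) (expConv α H) Y ≤ 2 / α * expConv α H Y := by
  set F : ℝ × ℝ → ℝ := fun p =>
    Real.exp (-(2 * α * |p.1 - Y|)) * (Real.exp (-(α * |p.2 - p.1|)) * H p.2) with hF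
  have hi : Integrable F (volume.prod volume) := by
    have h1 := integrable_exp_mul_prod hα hH
    refine h1.mono ((Continuous.aestronglyMeasurable (by fun_prop)).mul h1.1)
      (Eventually.of_forall fun p => ?_)
    simp only [hF]
    rw [norm_mul, Real.norm_of_nonneg (Real.exp_pos _).le]
    exact mul_le_of_le_one_left (norm_nonneg _)
      (Real.exp_le_one_iff.2 (neg_nonpos.2 (by positivity)))
  have hpt : ∀ Y' Z, F (Y', Z) ≤
      Real.exp (-(α * |Y' - Y|)) * (Real.exp (-(α * |Z - Y|)) * H Z) := by
    intro Y' Z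
    simp only [hF]
    rw [← mul_assoc, ← mul_assoc]
    refine mul_le_mul_of_nonneg_right ?_ (hH0 Z)
    rw [← Real.exp_add, ← Real.exp_add]
    refine Real.exp_le_exp.2 ?_
    have h1 : |Z - Y| ≤ |Z - Y'| + |Y' - Y| := abs_sub_le _ _ _
    nlinarith
  calc expConv (2 * α) (expConv α H) Y = ∫ Y', ∫ Z, F (Y', Z) := by
        simp only [expConv, hF, integral_const_mul]
    _ = ∫ Z, ∫ Y', F (Y', Z) := integral_integral_swap hi
    _ ≤ ∫ Z, ∫ Y', Real.exp (-(α * |Y' - Y|)) * (Real.exp (-(α * |Z - Y|)) * H Z) := by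
        refine integral_mono_of_nonneg
          (Eventually.of_forall fun Z => integral_nonneg fun Y' => ?_) ?_
          (Eventually.of_forall fun Z => ?_)
        · exact mul_nonneg (Real.exp_pos _).le (mul_nonneg (Real.exp_pos _).le (hH0 Z))
        · simp_rw [integral_mul_const]
          exact (integrable_exp_mul hα hH Y).const_mul _
        · refine integral_mono_of_nonneg (Eventually.of_forall fun Y' => ?_)
            ((integrable_exp_neg_mul_abs_sub hα Y).mul_const _)
            (Eventually.of_forall fun Y' => hpt Y' Z)
          exact mul_nonneg (Real.exp_pos _).le (mul_nonneg (Real.exp_pos _).le (hH0 Z))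
    _ = _ := by
        simp_rw [integral_mul_const, integral_exp_neg_mul_abs_sub hα]
        rw [integral_const_mul, expConv]

/-- A square integrable weight dominating a given square integrable function. -/
theorem exists_weight {r b : ℝ} (hr : 0 < r) (hH : Integrable H) (hH0 : ∀ Y, 0 < H Y)
    (hb : ∀ Y, H Y ≤ b) :
    ∃ ρ A R, Weight r A ρ ∧ (∀ Y, ρ Y ≤ R) ∧ (Integrable fun Y => ρ Y ^ 2) ∧
      ∀ Y, H Y ≤ ρ Y ^ 2 := by
  obtain ⟨α, rfl⟩ : ∃ α, r = 2 * α := ⟨r / 2, by ring⟩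
  have hα : 0 < α := by linarith
  have hH0' : ∀ Y, 0 ≤ H Y := fun Y => (hH0 Y).le
  -- Adding the convolution at the slower rate `α` makes `Ω` an almost subsolution for the rate
  -- `2α`, while it stays integrable, bounded and above `H`.
  set Ω : ℝ → ℝ := fun Y => H Y + expConv α H Y with hΩ
  have hG0 := expConv_nonneg (α := α) hH0'
  have hΩpos : ∀ Y, 0 < Ω Y := fun Y => add_pos_of_pos_of_nonneg (hH0 Y) (hG0 Y)
  have hGi := integrable_expConv hα hH
  have hΩi : Integrable Ω := hH.add hGi
  have hb0 : 0 ≤ b := (hH0' 0).trans (hb 0)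
  have hΩb : ∀ Y, Ω Y ≤ b + 2 / α * b := by
    intro Y
    refine add_le_add (hb Y) ?_
    rw [← integral_exp_neg_mul_abs_sub hα Y, ← integral_mul_const]
    refine integral_mono (integrable_exp_mul hα hH Y)
      ((integrable_exp_neg_mul_abs_sub hα Y).mul_const b) fun Z => ?_
    exact mul_le_mul_of_nonneg_left (hb Z) (Real.exp_pos _).le
  have hconv : ∀ Y, ∫ Z, Real.exp (-(2 * α * |Z - Y|)) * Ω Z ≤ (1 + 2 / α) * Ω Y := by
    intro Y
    have h1 : ∫ Z, Real.exp (-(2 * α * |Z - Y|)) * Ω Z =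
        (∫ Z, Real.exp (-(2 * α * |Z - Y|)) * H Z) + expConv (2 * α) (expConv α H) Y := by
      simp only [hΩ, mul_add, expConv]
      exact integral_add (integrable_exp_mul (by positivity) hH Y)
        (integrable_exp_mul (by positivity) hGi Y)
    have h2 : ∫ Z, Real.exp (-(2 * α * |Z - Y|)) * H Z ≤ expConv α H Y := by
      refine integral_mono (integrable_exp_mul (by positivity) hH Y)
        (integrable_exp_mul hα hH Y) fun Z => ?_
      refine mul_le_mul_of_nonneg_right (Real.exp_le_exp.2 ?_) (hH0' Z)
      nlinarith [mul_nonneg hα.le (abs_nonneg (Z - Y))]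
    have h3 := expConv_expConv_le hα hH hH0' Y
    have h4 : 0 ≤ 2 / α * H Y := mul_nonneg (by positivity) (hH0' Y)
    have h5 := hH0' Y
    rw [h1]
    calc _ ≤ expConv α H Y + 2 / α * expConv α H Y := add_le_add h2 h3
      _ ≤ (1 + 2 / α) * (H Y + expConv α H Y) := by linarith
  -- The square root of an integrable function is in `L²`. The convolution inequality survives it:
  -- `ρ Z ≤ t/2 + ρ Z² / (2t)` with `t = ρ Y`, so the inequality for `Ω = ρ²` applies and returns a
  -- multiple of `t`.
  set ρ : ℝ → ℝ := fun Y => Real.sqrt (Ω Y) with hρ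
  have hρ2 : ∀ Y, ρ Y ^ 2 = Ω Y := fun Y => Real.sq_sqrt (hΩpos Y).le
  have hρpos : ∀ Y, 0 < ρ Y := fun Y => Real.sqrt_pos.2 (hΩpos Y)
  have hρm : AEStronglyMeasurable ρ volume :=
    Real.continuous_sqrt.comp_aestronglyMeasurable hΩi.1
  have hei := integrable_exp_neg_mul_abs_sub (r := 2 * α) (by positivity)
  have hint : ∀ Y, Integrable fun Z => Real.exp (-(2 * α * |Z - Y|)) * ρ Z := by
    intro Y
    refine ((hei Y).add (integrable_exp_mul (by positivity) hΩi Y)).mono'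
      ((Continuous.aestronglyMeasurable (by fun_prop)).mul hρm) (Eventually.of_forall fun Z => ?_)
    have h1 := Real.exp_pos (-(2 * α * |Z - Y|))
    rw [Real.norm_of_nonneg (mul_nonneg h1.le (hρpos Z).le), Pi.add_apply, ← hρ2]
    nlinarith [sq_nonneg (ρ Z - 1), hρpos Z]
  refine ⟨ρ, 1 / (2 * α) + (1 + 2 / α) / 2, Real.sqrt (b + 2 / α * b),
    ⟨hρpos, hρm, hint, fun Y => ?_⟩, fun Y => Real.sqrt_le_sqrt (hΩb Y),
    hΩi.congr (Eventually.of_forall fun Y => (hρ2 Y).symm), fun Y => ?_⟩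
  · have ht := hρpos Y
    set t := ρ Y
    have h1 : ∫ Z, Real.exp (-(2 * α * |Z - Y|)) * ρ Z ≤
        ∫ Z, (t / 2 * Real.exp (-(2 * α * |Z - Y|)) +
          1 / (2 * t) * (Real.exp (-(2 * α * |Z - Y|)) * Ω Z)) := by
      refine integral_mono (hint Y) (((hei Y).const_mul _).add
        ((integrable_exp_mul (by positivity) hΩi Y).const_mul _)) fun Z => ?_
      have h2 := Real.exp_pos (-(2 * α * |Z - Y|))
      have h3 : ρ Z ≤ t / 2 + 1 / (2 * t) * ρ Z ^ 2 := by
        have : t / 2 + 1 / (2 * t) * ρ Z ^ 2 - ρ Z = (t - ρ Z) ^ 2 / (2 * t) := by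
          field_simp
          ring
        have h4 : 0 ≤ (t - ρ Z) ^ 2 / (2 * t) := by positivity
        linarith
      simp only
      rw [← hρ2 Z]
      nlinarith
    rw [integral_add ((hei Y).const_mul _)
      ((integrable_exp_mul (by positivity) hΩi Y).const_mul _), integral_const_mul,
      integral_const_mul, integral_exp_neg_mul_abs_sub (by positivity)] at h1
    refine h1.trans ?_
    have h5 := mul_le_mul_of_nonneg_left (hconv Y) (by positivity : 0 ≤ 1 / (2 * t))
    rw [← hρ2 Y] at h5
    refine (add_le_add_right h5 _).trans (le_of_eq ?_)
    change t / 2 * (2 / (2 * α)) + 1 / (2 * t) * ((1 + 2 / α) * t ^ 2) = _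
    field_simp
  · rw [hρ2]
    linarith [hG0 Y]

end

end LambdaFamily
end

/-! ### Picard–Lindelöf relative to a weight. -/

noncomputable section

namespace LambdaFamily

/-- Bounded, almost everywhere strongly measurable functions with values in `State`, with the
supremum norm. -/
def bddMeas : Submodule ℝ (lp (fun _ : ℝ => State) ⊤) where
  carrier := {b | AEStronglyMeasurable (fun Y => b Y) volume}
  add_mem' ha hb := AEStronglyMeasurable.add ha hb
  zero_mem' := aestronglyMeasurable_const (b := (0 : State))
  smul_mem' c _ hb := AEStronglyMeasurable.const_smul hb c

/-- Convergence in the sup norm is pointwise at every `Y`, and pointwise limits of sequences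
preserve measurability. -/
theorem isClosed_bddMeas : IsClosed (bddMeas : Set (lp (fun _ : ℝ => State) ⊤)) := by
  refine IsSeqClosed.isClosed fun b a hb hlim => ?_
  refine aestronglyMeasurable_of_tendsto_ae atTop (f := fun n Y => b n Y) hb
    (Eventually.of_forall fun Y => ?_)
  exact ((lp.lipschitzWith_one_eval (E := fun _ : ℝ => State) ⊤ Y).continuous.tendsto a).comp hlim

instance : CompleteSpace bddMeas := isClosed_bddMeas.completeSpace_coe

theorem bddMeas_norm_apply_le (b : bddMeas) (Y : ℝ) : ‖b.1 Y‖ ≤ ‖b‖ :=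
  lp.norm_apply_le_norm ENNReal.top_ne_zero b.1 Y

theorem bddMeas_norm_le {b : bddMeas} {C : ℝ} (h : ∀ Y, ‖b.1 Y‖ ≤ C) : ‖b‖ ≤ C :=
  lp.norm_le_of_forall_le' C h

open Classical in
/-- The element of `bddMeas` given by a function, or `0` when it is not bounded or not
measurable. -/
def toBddMeas (G : ℝ → State) : bddMeas :=
  if h : AEStronglyMeasurable G volume ∧ ∃ C, ∀ Y, ‖G Y‖ ≤ C then
    ⟨⟨G, memℓp_infty ⟨h.2.choose, by rintro _ ⟨Y, rfl⟩; exact h.2.choose_spec Y⟩⟩, h.1⟩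
  else 0

theorem toBddMeas_apply {G : ℝ → State} (hG : AEStronglyMeasurable G volume) {C : ℝ}
    (hC : ∀ Y, ‖G Y‖ ≤ C) (Y : ℝ) : (toBddMeas G).1 Y = G Y := by
  rw [toBddMeas, dif_pos ⟨hG, C, hC⟩]

/-- Evaluation at a point. -/
def bddMeasEval (Y : ℝ) : bddMeas →L[ℝ] State :=
  LinearMap.mkContinuous
    { toFun := fun b => b.1 Y, map_add' := fun _ _ => rfl, map_smul' := fun _ _ => rfl } 1
    fun b => by rw [one_mul]; exact bddMeas_norm_apply_le b Y

/-- Local solvability of an autonomous ordinary differential equation started at `0`. -/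
theorem exists_solution_of_lipschitz {E : Type*} [NormedAddCommGroup E] [NormedSpace ℝ E]
    [CompleteSpace E] {F : E → E} {a C : ℝ} (ha : 0 < a) (hC : 0 ≤ C)
    (hFn : ∀ b, ‖b‖ ≤ a → ‖F b‖ ≤ C)
    (hFl : ∀ b b', ‖b‖ ≤ a → ‖b'‖ ≤ a → ‖F b - F b'‖ ≤ C * ‖b - b'‖) :
    ∃ ε > 0, ∃ β : ℝ → E, β 0 = 0 ∧ ∀ T ∈ Ioo (-ε) ε, ‖β T‖ ≤ a ∧ HasDerivAt β (F (β T)) T := by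
  -- Speed at most `C` for a time `δ` covers a distance `C * δ ≤ a`; the `+ 1` covers `C = 0`.
  set δ := a / (C + 1) with hδ
  have hδ0 : 0 < δ := by positivity
  have hPL : IsPicardLindelof (fun _ : ℝ => F) (tmin := -δ) (tmax := δ)
      ⟨0, by constructor <;> linarith⟩ 0 ⟨a, ha.le⟩ 0 ⟨C, hC⟩ ⟨C, hC⟩ := by
    refine IsPicardLindelof.of_time_independent (fun b hb => hFn b (mem_closedBall_zero_iff.1 hb)) ?_ ?_
    · refine LipschitzOnWith.of_dist_le_mul fun b hb b' hb' => ?_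
      rw [dist_eq_norm, dist_eq_norm]
      exact hFl b b' (mem_closedBall_zero_iff.1 hb) (mem_closedBall_zero_iff.1 hb')
    · have : C * δ ≤ a := by
        rw [hδ, mul_div_assoc', div_le_iff₀ (by positivity)]
        nlinarith
      simpa [NNReal.coe_mk] using! this
  obtain ⟨β, hβ0, hβ⟩ := hPL.exists_eq_forall_mem_Icc_hasDerivWithinAt₀
  simp only at hβ0 hβ
  have hβd : ∀ T ∈ Ioo (-δ) δ, HasDerivAt β (F (β T)) T := fun T hT =>
    (hβ T (Ioo_subset_Icc_self hT)).hasDerivAt (Icc_mem_nhds hT.1 hT.2)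
  have hcont : ContinuousAt β 0 := (hβd 0 ⟨by linarith, hδ0⟩).continuousAt
  obtain ⟨η, hη0, hη⟩ := Metric.continuousAt_iff.1 hcont a ha
  refine ⟨min δ η, lt_min hδ0 hη0, β, hβ0, fun T hT => ?_⟩
  have hTη : |T| < η :=
    abs_lt.2 ⟨by linarith [hT.1, min_le_right δ η], hT.2.trans_le (min_le_right _ _)⟩
  have hTδ : T ∈ Ioo (-δ) δ :=
    ⟨by linarith [hT.1, min_le_left δ η], hT.2.trans_le (min_le_left _ _)⟩
  refine ⟨?_, hβd T hTδ⟩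
  have h1 := hη (x := T) (by simpa using hTη)
  rw [hβ0, dist_zero_right] at h1
  exact h1.le

/-- Local solvability of an ordinary differential equation for functions whose distance from
the datum is controlled by a weight. -/
theorem exists_weighted_solution {ρ : ℝ → ℝ} (hρ : ∀ Y, 0 < ρ Y)
    (hρm : AEStronglyMeasurable ρ volume) {w₀ : ℝ → State}
    (hw₀ : AEStronglyMeasurable w₀ volume) {a C : ℝ} (ha : 0 < a) (hC : 0 ≤ C)
    {Φ : (ℝ → State) → ℝ → State}
    (hΦ : ∀ w, AEStronglyMeasurable w volume → (∀ Y, ‖w Y - w₀ Y‖ ≤ a * ρ Y) →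
      AEStronglyMeasurable (Φ w) volume ∧ ∀ Y, ‖Φ w Y‖ ≤ C * ρ Y)
    (hL : ∀ w w', AEStronglyMeasurable w volume → (∀ Y, ‖w Y - w₀ Y‖ ≤ a * ρ Y) →
      AEStronglyMeasurable w' volume → (∀ Y, ‖w' Y - w₀ Y‖ ≤ a * ρ Y) →
      ∀ d, 0 ≤ d → (∀ Y, ‖w Y - w' Y‖ ≤ d * ρ Y) → ∀ Y, ‖Φ w Y - Φ w' Y‖ ≤ C * d * ρ Y) :
    ∃ ε > 0, ∃ w : ℝ → ℝ → State, w 0 = w₀ ∧ ∀ T ∈ Ioo (-ε) ε,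
      AEStronglyMeasurable (w T) volume ∧ (∀ Y, ‖w T Y - w₀ Y‖ ≤ a * ρ Y) ∧
      ∀ Y, HasDerivAt (fun t => w t Y) (Φ (w T) Y) T := by
  -- The unknown is `b = (w - w₀) / ρ`. Its equation has right-hand side `ρ⁻¹ Φ`, bounded and
  -- Lipschitz in the plain sup norm.
  set prof : bddMeas → ℝ → State := fun b Y => w₀ Y + ρ Y • b.1 Y with hprof
  have pm : ∀ b, AEStronglyMeasurable (prof b) volume := fun b => hw₀.add (hρm.smul b.2)
  have pd : ∀ b b' Y, ‖prof b Y - prof b' Y‖ ≤ ‖b - b'‖ * ρ Y := fun b b' Y => by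
    have h1 : prof b Y - prof b' Y = ρ Y • (b - b').1 Y := by
      change (w₀ Y + ρ Y • b.1 Y) - (w₀ Y + ρ Y • b'.1 Y) = ρ Y • (b.1 Y - b'.1 Y)
      rw [smul_sub]
      abel
    rw [h1, norm_smul, Real.norm_of_nonneg (hρ Y).le, mul_comm]
    exact mul_le_mul_of_nonneg_right (bddMeas_norm_apply_le _ Y) (hρ Y).le
  have p0 : prof 0 = w₀ := by
    funext Y
    change w₀ Y + ρ Y • (0 : State) = w₀ Y
    simp
  have pb : ∀ b, ‖b‖ ≤ a → ∀ Y, ‖prof b Y - w₀ Y‖ ≤ a * ρ Y := fun b hb Y => by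
    have h1 := pd b 0 Y
    rw [p0, sub_zero] at h1
    exact h1.trans (mul_le_mul_of_nonneg_right hb (hρ Y).le)
  set F : bddMeas → bddMeas := fun b => toBddMeas fun Y => (ρ Y)⁻¹ • Φ (prof b) Y with hF
  have hbd : ∀ (t : ℝ) (x : State) (Y : ℝ), ‖x‖ ≤ t * ρ Y → ‖(ρ Y)⁻¹ • x‖ ≤ t := by
    intro t x Y hx
    rw [norm_smul, norm_inv, Real.norm_of_nonneg (hρ Y).le, inv_mul_le_iff₀ (hρ Y), mul_comm]
    exact hx
  have hFapp : ∀ b, ‖b‖ ≤ a → ∀ Y, (F b).1 Y = (ρ Y)⁻¹ • Φ (prof b) Y := by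
    intro b hb Y
    obtain ⟨h1, h2⟩ := hΦ _ (pm b) (pb b hb)
    exact toBddMeas_apply (hρm.aemeasurable.inv.aestronglyMeasurable.smul h1)
      (fun Y => hbd C _ Y (h2 Y)) Y
  have hFn : ∀ b, ‖b‖ ≤ a → ‖F b‖ ≤ C := fun b hb => bddMeas_norm_le fun Y => by
    rw [hFapp b hb]
    exact hbd C _ Y ((hΦ _ (pm b) (pb b hb)).2 Y)
  have hFl : ∀ b b', ‖b‖ ≤ a → ‖b'‖ ≤ a → ‖F b - F b'‖ ≤ C * ‖b - b'‖ := by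
    intro b b' hb hb'
    refine bddMeas_norm_le fun Y => ?_
    change ‖(F b).1 Y - (F b').1 Y‖ ≤ _
    rw [hFapp b hb, hFapp b' hb', ← smul_sub]
    exact hbd _ _ Y (hL _ _ (pm b) (pb b hb) (pm b') (pb b' hb') _ (norm_nonneg _) (pd b b') Y)
  obtain ⟨ε, hε, β, hβ0, hβ⟩ := exists_solution_of_lipschitz ha hC hFn hFl
  refine ⟨ε, hε, fun T => prof (β T), by
    change prof (β 0) = w₀
    rw [hβ0, p0], fun T hT => ?_⟩
  obtain ⟨hn, hd⟩ := hβ T hT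
  refine ⟨pm _, pb _ hn, fun Y => ?_⟩
  -- Elements of `bddMeas` are functions rather than classes, so evaluation is a continuous linear
  -- map and the equation holds at every `Y`.
  have h1 : HasDerivAt (fun t => (β t).1 Y) ((F (β T)).1 Y) T :=
    (bddMeasEval Y).hasFDerivAt.comp_hasDerivAt T hd
  have h2 := (h1.const_smul (ρ Y)).const_add (w₀ Y)
  rw [hFapp _ hn, smul_inv_smul₀ (hρ Y).ne'] at h2
  exact h2

end LambdaFamily
end

/-! ### Derivatives in `Y` of the nonlocal terms and the evolution of `u_Y`. -/

noncomputable section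

namespace LambdaFamily

variable {lam : ℕ} {ρ : ℝ → ℝ} {M m B A R : ℝ} {w : ℝ → State}

theorem Coercive.kint_univ {c C : ℝ} {q f : ℝ → ℝ} (hc : 0 < c) (hρ : Weight (c / 2) A ρ)
    (h : Coercive c C q) (hfm : AEStronglyMeasurable f volume) {F : ℝ}
    (hf : ∀ᵐ s, |f s| ≤ F * ρ s) (Y : ℝ) :
    kint univ q f Y = kint (Ioi Y) q f Y + kint (Iio Y) q f Y := by
  have hi := h.integrable_expKer_mul hc hρ hfm hf Y
  rw [kint, kint, kint, Measure.restrict_univ, ← integral_Iic_eq_integral_Iio, add_comm,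
    intervalIntegral.integral_Iic_add_Ioi hi.integrableOn hi.integrableOn]

/-- The derivative in `Y` of the nonlocal term `P_x + Q`, and continuity of `P + Q_x`. -/
theorem Adm.hasACDeriv_nonlocU (hM : 0 ≤ M) (hm : 0 < m) (hρ : Weight (rate lam m / 2) A ρ)
    (hR : ∀ Y, ρ Y ≤ R) (hw : Adm ρ M m B w) :
    HasACDeriv (nonlocU lam w) (fun Y => ptW lam (w Y) * nonlocV lam w Y - ptP lam (w Y)) ∧
      Continuous (nonlocV lam w) := by
  have hc := rate_pos lam hm
  have hR0 : 0 ≤ R := (hρ.pos 0).le.trans (hR 0)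
  have hco := hw.coercive (lam := lam) hm
  have hq : ∀ᵐ Y, 0 ≤ ptW lam (w Y) := hw.lower.mono fun Y hY =>
    mul_nonneg ((even_expo lam).pow_nonneg _) (hm.le.trans hY)
  obtain ⟨L₁, -, hL₁, -⟩ := exists_density_bound (contDiff_ptP lam) (fun x => by simp [ptP]) hM hR0
  obtain ⟨L₂, -, hL₂, -⟩ := exists_density_bound (contDiff_ptQ lam) (ptQ_zero lam) hM hR0
  have hP : ∀ᵐ Y, |ptP lam (w Y)| ≤ L₁ * ρ Y := hw.bound.mono fun Y hY =>
    hL₁ _ _ (hρ.pos Y).le (hR Y) hY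
  have hQ : ∀ᵐ Y, |ptQ lam (w Y)| ≤ L₂ * ρ Y := hw.bound.mono fun Y hY =>
    hL₂ _ _ (hρ.pos Y).le (hR Y) hY
  have mP : AEStronglyMeasurable (fun Y => ptP lam (w Y)) volume :=
    (contDiff_ptP lam).continuous.comp_aestronglyMeasurable hw.aesm
  have mQ : AEStronglyMeasurable (fun Y => ptQ lam (w Y)) volume :=
    (contDiff_ptQ lam).continuous.comp_aestronglyMeasurable hw.aesm
  have dP1 := hco.hasACDeriv_kint_Ioi hc hρ hq mP hP
  have dP2 := hco.hasACDeriv_kint_Iio hc hρ hq mP hP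
  have dQ1 := hco.hasACDeriv_kint_Ioi hc hρ hq mQ hQ
  have dQ2 := hco.hasACDeriv_kint_Iio hc hρ hq mQ hQ
  have eP := hco.kint_univ hc hρ mP hP
  have eQ := hco.kint_univ hc hρ mQ hQ
  constructor
  -- In the difference of the two half-line integrals for `P_x` the local terms add up to `-2 ptP`;
  -- in the sum for `Q` they cancel. The kernel density multiplies what remains, which is `P + Q_x`.
  · have h1 := ((dP1.sub dP2).const_mul (1 / 2)).add ((dQ1.add dQ2).const_mul ((lam : ℝ) / 4))
    have h2 : nonlocU lam w = fun Y => _ := funext fun Y => nonlocU_eq lam w Y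
    simp_rw [eQ] at h2
    rw [h2]
    refine h1.congr_deriv (Eventually.of_forall fun Y => ?_)
    simp only [nonlocV_eq, eP]
    ring
  · have h2 : nonlocV lam w = fun Y => _ := funext fun Y => nonlocV_eq lam w Y
    simp_rw [eP] at h2
    rw [h2]
    exact ((dP1.continuous.add dP2.continuous).const_mul _).add
      ((dQ1.continuous.sub dQ2.continuous).const_mul _)

theorem Adm.aestronglyMeasurable_field (hM : 0 ≤ M) (hm : 0 < m)
    (hρ : Weight (rate lam m / 2) A ρ) (hR : ∀ Y, ρ Y ≤ R) (hw : Adm ρ M m B w) :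
    AEStronglyMeasurable (field lam w) volume := by
  obtain ⟨h1, h2⟩ := hw.hasACDeriv_nonlocU hM hm hρ hR
  have h3 : field lam w = fun Y => ptRhs lam (w Y, nonlocV lam w Y, nonlocU lam w Y) :=
    funext fun Y => field_eq lam w Y
  rw [h3]
  exact (contDiff_ptRhs lam).continuous.comp_aestronglyMeasurable
    (hw.aesm.prodMk (h2.aestronglyMeasurable.prodMk h1.continuous.aestronglyMeasurable))

/-- The spatial derivative of `u` as a function of the state. -/
def ptZ (lam : ℕ) (x : State) : ℝ :=
  Real.sin (x.2.1 / 2) * Real.cos (x.2.1 / 2) ^ (2 * lam + 1) * x.2.2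

theorem contDiff_ptZ (lam : ℕ) : ContDiff ℝ 1 (ptZ lam) := by
  unfold ptZ; fun_prop

/-- Along the flow, `sin (v/2) cos^{k-1} (v/2) ξ` solves the equation obtained by differentiating
the equation for `u` in `Y`. -/
theorem hasDerivAt_ptZ {γ : ℝ → State} {T N N' : ℝ}
    (h : HasDerivAt γ (ptRhs lam (γ T, N, N')) T) :
    HasDerivAt (fun t => ptZ lam (γ t)) (ptP lam (γ T) - ptW lam (γ T) * N) T := by
  have hv : HasDerivAt (fun t => (γ t).2.1) (ptRhs lam (γ T, N, N')).2.1 T := h.snd.fst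
  have hξ : HasDerivAt (fun t => (γ t).2.2) (ptRhs lam (γ T, N, N')).2.2 T := h.snd.snd
  have h1 := ((hv.div_const 2).sin.mul ((hv.div_const 2).cos.pow (2 * lam + 1))).mul hξ
  refine h1.congr_deriv ?_
  simp only [ptRhs, ptP, ptW, Pi.pow_apply, Pi.mul_apply, expo]
  set x := (γ T).1
  set ξ := (γ T).2.2
  have hs : Real.sin (γ T).2.1 = 2 * Real.sin ((γ T).2.1 / 2) * Real.cos ((γ T).2.1 / 2) := by
    rw [← Real.sin_two_mul]; ring_nf
  rw [hs]
  set s := Real.sin ((γ T).2.1 / 2)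
  set c := Real.cos ((γ T).2.1 / 2)
  have hsc : s ^ 2 + c ^ 2 = 1 := Real.sin_sq_add_cos_sq _
  have e1 : 2 * (lam + 1) - 2 = 2 * lam := by omega
  have e2 : 2 * lam + 1 - 1 = 2 * lam := by omega
  rw [e1, e2, show 2 * (lam + 1) = 2 * lam + 2 by ring, pow_add c (2 * lam) 2,
    pow_add c (2 * lam) 1, pow_one, pow_add x lam 2]
  set C := c ^ (2 * lam)
  set X := x ^ lam
  push_cast
  -- Both sides are polynomials in `s`, `c` and the remaining quantities, equal modulo `s² + c² =
  -- 1`.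
  linear_combination (2 * (lam : ℝ) + 1) / 2 * X * s ^ 2 * C * ξ * hsc +
    (X * x ^ 2 - N) * c ^ 2 * C * ξ * hsc

/-- Bounded square integrable functions belong to every `L^p` with `p ≥ 2`. -/
theorem memLp_of_sq_integrable {n : ℕ} (hn : 2 ≤ n) (hm : AEStronglyMeasurable ρ volume)
    (h0 : ∀ Y, 0 ≤ ρ Y) (hR : ∀ Y, ρ Y ≤ R) (hi : Integrable fun Y => ρ Y ^ 2) :
    MemLp ρ n volume := by
  rw [← integrable_norm_rpow_iff hm (by simp; omega) (by simp)]
  refine (hi.const_mul (R ^ (n - 2))).mono' ?_ (Eventually.of_forall fun Y => ?_)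
  · simp only [ENNReal.toReal_natCast, Real.rpow_natCast]
    exact hm.norm.pow n
  · have h1 : ρ Y ^ n = ρ Y ^ (n - 2) * ρ Y ^ 2 := by rw [← pow_add]; congr 1; omega
    simp only [ENNReal.toReal_natCast, Real.rpow_natCast]
    rw [Real.norm_of_nonneg (by positivity), Real.norm_of_nonneg (h0 Y), h1]
    exact mul_le_mul_of_nonneg_right (pow_le_pow_left₀ (h0 Y) (hR Y) _) (sq_nonneg _)

end LambdaFamily
end

/-! ### The local flow and its membership in the solution space. -/

noncomputable section

namespace LambdaFamily

variable {lam : ℕ} {u₀ U V ρ : ℝ → ℝ} {A R B C ε : ℝ} {w : ℝ → ℝ → State}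

/-- A solution of the semilinear system on `(-ε, ε)` dominated by a weight. -/
structure LocalFlow (lam : ℕ) (ρ : ℝ → ℝ) (A R B C ε : ℝ) (w : ℝ → ℝ → State) : Prop where
  weight : Weight (rate lam (1 / 2) / 2) A ρ
  weight_le : ∀ Y, ρ Y ≤ R
  integrable_sq : Integrable fun Y => ρ Y ^ 2
  adm : ∀ T ∈ Ioo (-ε) ε, Adm ρ 2 (1 / 2) B (w T)
  bound : ∀ T ∈ Ioo (-ε) ε, ∀ Y, PtBound 2 (ρ Y) (w T Y)
  hasDerivAt : ∀ T ∈ Ioo (-ε) ε, ∀ Y, HasDerivAt (fun t => w t Y) (field lam (w T) Y) T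
  field_nonneg : 0 ≤ C
  field_le : ∀ T ∈ Ioo (-ε) ε, ∀ Y, ‖field lam (w T) Y‖ ≤ C * ρ Y

/-- `a ≤ 1` lets the bounds on `u` and `v` at most double, and `a * t ≤ 1 / 2` keeps `ξ` between `1
/ 2` and `3 / 2`. -/
theorem ptBound_of_near {a t u v : ℝ} {x : State} (ht : 0 ≤ t) (ha : a ≤ 1) (hat : a * t ≤ 1 / 2)
    (hu : |u| ≤ t) (hv : |v| ≤ t) (h : ‖x - (u, v, 1)‖ ≤ a * t) :
    PtBound 2 t x ∧ 1 / 2 ≤ x.2.2 := by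
  have h1 : |x.1 - u| ≤ a * t := (norm_fst_le (x - (u, v, 1))).trans h
  have h2 : |x.2.1 - v| ≤ a * t :=
    ((norm_fst_le (x - (u, v, 1)).2).trans (norm_snd_le (x - (u, v, 1)))).trans h
  have h3 : |x.2.2 - 1| ≤ a * t :=
    ((norm_snd_le (x - (u, v, 1)).2).trans (norm_snd_le (x - (u, v, 1)))).trans h
  have h4 : a * t ≤ t := by nlinarith
  rw [abs_le] at h1 h2 h3 hu hv
  refine ⟨⟨abs_le.2 ?_, abs_le.2 ?_, abs_le.2 ?_⟩, by linarith⟩ <;> constructor <;> linarith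

/-- The weight is fixed before the flow: staying near the datum guarantees `ξ ≥ 1 / 2`, so the decay
rate of the kernel is known in advance. -/
theorem exists_localFlow (lam : ℕ) (hlam : 1 ≤ lam) (hUm : AEStronglyMeasurable U volume)
    (hVm : AEStronglyMeasurable V volume) (hU : ∃ M, ∀ Y, |U Y| ≤ M) (hV : ∃ M, ∀ Y, |V Y| ≤ M)
    (hU2 : Integrable fun Y => U Y ^ 2) (hV2 : Integrable fun Y => V Y ^ 2) :
    ∃ ρ A R B C ε w, 0 < ε ∧ LocalFlow lam ρ A R B C ε w ∧ w 0 = fun Y => (U Y, V Y, 1) := by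
  obtain ⟨M₁, hM₁⟩ := hU
  obtain ⟨M₂, hM₂⟩ := hV
  have hr := rate_pos lam (m := 1 / 2) (by norm_num)
  -- The exponential makes `H` strictly positive where the data vanish.
  set H : ℝ → ℝ := fun Y => U Y ^ 2 + V Y ^ 2 + Real.exp (-(1 * |Y - 0|)) with hH
  have hHi : Integrable H := (hU2.add hV2).add (integrable_exp_neg_mul_abs_sub one_pos 0)
  have hH0 : ∀ Y, 0 < H Y := fun Y => by positivity
  have hHb : ∀ Y, H Y ≤ M₁ ^ 2 + M₂ ^ 2 + 1 := fun Y => by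
    have h1 : U Y ^ 2 ≤ M₁ ^ 2 := sq_le_sq' (by linarith [(abs_le.1 (hM₁ Y)).1])
      (abs_le.1 (hM₁ Y)).2
    have h2 : V Y ^ 2 ≤ M₂ ^ 2 := sq_le_sq' (by linarith [(abs_le.1 (hM₂ Y)).1])
      (abs_le.1 (hM₂ Y)).2
    have h3 : Real.exp (-(1 * |Y - 0|)) ≤ 1 := Real.exp_le_one_iff.2 (by simp)
    exact add_le_add (add_le_add h1 h2) h3
  obtain ⟨ρ, A, R, hρ, hR, hρ2, hHρ⟩ := exists_weight (half_pos hr) hHi hH0 hHb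
  have hR0 : 0 < R := (hρ.pos 0).trans_le (hR 0)
  have hUρ : ∀ Y, |U Y| ≤ ρ Y := fun Y => by
    refine abs_le_of_sq_le_sq ?_ (hρ.pos Y).le
    have h1 : U Y ^ 2 + V Y ^ 2 + Real.exp (-(1 * |Y - 0|)) ≤ ρ Y ^ 2 := hHρ Y
    linarith [sq_nonneg (V Y), Real.exp_pos (-(1 * |Y - 0|))]
  have hVρ : ∀ Y, |V Y| ≤ ρ Y := fun Y => by
    refine abs_le_of_sq_le_sq ?_ (hρ.pos Y).le
    have h1 : U Y ^ 2 + V Y ^ 2 + Real.exp (-(1 * |Y - 0|)) ≤ ρ Y ^ 2 := hHρ Y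
    linarith [sq_nonneg (U Y), Real.exp_pos (-(1 * |Y - 0|))]
  set a : ℝ := 1 / (2 * (R + 1)) with ha
  have ha0 : 0 < a := by positivity
  have ha1 : a ≤ 1 := by rw [ha, div_le_one (by positivity)]; linarith
  have haR : ∀ Y, a * ρ Y ≤ 1 / 2 := fun Y => by
    rw [ha, div_mul_eq_mul_div, div_le_div_iff₀ (by positivity) (by norm_num)]
    linarith [hR Y]
  set w₀ : ℝ → State := fun Y => (U Y, V Y, 1) with hw₀
  have hw₀m : AEStronglyMeasurable w₀ volume :=
    hUm.prodMk (hVm.prodMk aestronglyMeasurable_const)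
  -- `|v| ≤ 2 ρ` for every profile near the datum, so this bounds the `L²` norm of `v` uniformly.
  set B : ℝ := ∫ Y, 4 * ρ Y ^ 2
  have hbd : ∀ w : ℝ → State, (∀ Y, ‖w Y - w₀ Y‖ ≤ a * ρ Y) →
      ∀ Y, PtBound 2 (ρ Y) (w Y) ∧ 1 / 2 ≤ (w Y).2.2 := fun w hw Y =>
    ptBound_of_near (hρ.pos Y).le ha1 (haR Y) (hUρ Y) (hVρ Y) (hw Y)
  have hadm : ∀ w : ℝ → State, AEStronglyMeasurable w volume → (∀ Y, ‖w Y - w₀ Y‖ ≤ a * ρ Y) →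
      Adm ρ 2 (1 / 2) B w := fun w hwm hw => by
    have hle : ∀ Y, (w Y).2.1 ^ 2 ≤ 4 * ρ Y ^ 2 := fun Y => by
      have h1 := abs_le.1 (hbd w hw Y).1.2.1
      nlinarith [sq_le_sq' h1.1 h1.2]
    have hi : Integrable fun Y => (w Y).2.1 ^ 2 := by
      refine (hρ2.const_mul 4).mono' (hwm.snd.fst.pow 2) (Eventually.of_forall fun Y => ?_)
      rw [Real.norm_of_nonneg (sq_nonneg _)]
      exact hle Y
    exact ⟨hwm, Eventually.of_forall fun Y => (hbd w hw Y).1,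
      Eventually.of_forall fun Y => (hbd w hw Y).2, hi,
      integral_mono hi (hρ2.const_mul 4) hle⟩
  obtain ⟨C, hC0, hC, hL⟩ := exists_field_bound lam hlam (M := 2) (by norm_num)
    (by norm_num) B hρ hR
  obtain ⟨ε, hε, w, h0, hw⟩ := exists_weighted_solution hρ.pos hρ.aesm hw₀m ha0 hC0
    (Φ := field lam)
    (fun w hwm hw => ⟨(hadm w hwm hw).aestronglyMeasurable_field (by norm_num) (by norm_num) hρ hR,
      fun Y => hC w (hadm w hwm hw) Y (hbd w hw Y).1⟩)
    (fun w w' hwm hw hwm' hw' d hd h Y => hL w w' (hadm w hwm hw) (hadm w' hwm' hw') d hd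
      (Eventually.of_forall h) Y (hbd w hw Y).1 (hbd w' hw' Y).1 (h Y))
  exact ⟨ρ, A, R, B, C, ε, w, hε, ⟨hρ, hR, hρ2, fun T hT => hadm _ (hw T hT).1 (hw T hT).2.1,
    fun T hT Y => (hbd _ (hw T hT).2.1 Y).1, fun T hT => (hw T hT).2.2, hC0,
    fun T hT Y => hC _ (hadm _ (hw T hT).1 (hw T hT).2.1) Y (hbd _ (hw T hT).2.1 Y).1⟩, h0⟩

namespace LocalFlow

theorem norm_sub_le (h : LocalFlow lam ρ A R B C ε w) {S T : ℝ} (hS : S ∈ Ioo (-ε) ε)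
    (hT : T ∈ Ioo (-ε) ε) (Y : ℝ) : ‖w S Y - w T Y‖ ≤ C * |S - T| * ρ Y := by
  have := (convex_Ioo (-ε) ε).norm_image_sub_le_of_norm_hasDerivWithin_le
    (f := fun t => w t Y) (fun t ht => (h.hasDerivAt t ht Y).hasDerivWithinAt)
    (fun t ht => h.field_le t ht Y) hT hS
  rw [Real.norm_eq_abs] at this
  linarith

theorem hasDerivAt_ptZ (h : LocalFlow lam ρ A R B C ε w) {T : ℝ} (hT : T ∈ Ioo (-ε) ε) (Y : ℝ) :
    HasDerivAt (fun t => ptZ lam (w t Y))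
      (ptP lam (w T Y) - ptW lam (w T Y) * nonlocV lam (w T) Y) T := by
  refine LambdaFamily.hasDerivAt_ptZ (N' := nonlocU lam (w T) Y) ?_
  rw [← field_eq]
  exact h.hasDerivAt T hT Y

theorem hasDerivAt_fst (h : LocalFlow lam ρ A R B C ε w) {T : ℝ} (hT : T ∈ Ioo (-ε) ε) (Y : ℝ) :
    HasDerivAt (fun t => (w t Y).1) (- nonlocU lam (w T) Y) T := by
  have h1 := h.hasDerivAt T hT Y
  rw [field_eq] at h1
  exact h1.fst

theorem exists_ptZ_bound (h : LocalFlow lam ρ A R B C ε w) :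
    ∃ L, 0 ≤ L ∧ (∀ T ∈ Ioo (-ε) ε, ∀ Y, |ptZ lam (w T Y)| ≤ L * ρ Y) ∧
      ∀ S ∈ Ioo (-ε) ε, ∀ T ∈ Ioo (-ε) ε, ∀ Y,
        |ptZ lam (w S Y) - ptZ lam (w T Y)| ≤ L * ‖w S Y - w T Y‖ := by
  have hR0 : 0 ≤ R := (h.weight.pos 0).le.trans (h.weight_le 0)
  obtain ⟨L, hL0, hL1, hL2⟩ := exists_density_bound (M := 2) (contDiff_ptZ lam)
    (fun x => by simp [ptZ]) (by norm_num) hR0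
  exact ⟨L, hL0, fun T hT Y => hL1 _ _ (h.weight.pos Y).le (h.weight_le Y) (h.bound T hT Y),
    fun S hS T hT Y => hL2 _ _ _ (h.weight_le Y) (h.bound S hS Y) (h.bound T hT Y)⟩

theorem aesm_ptZ (h : LocalFlow lam ρ A R B C ε w) {T : ℝ} (hT : T ∈ Ioo (-ε) ε) :
    AEStronglyMeasurable (fun Y => ptZ lam (w T Y)) volume :=
  (contDiff_ptZ lam).continuous.comp_aestronglyMeasurable (h.adm T hT).aesm

theorem intervalIntegrable_ptZ (h : LocalFlow lam ρ A R B C ε w) {T : ℝ} (hT : T ∈ Ioo (-ε) ε)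
    (a b : ℝ) : IntervalIntegrable (fun Y => ptZ lam (w T Y)) volume a b := by
  obtain ⟨L, hL0, hL, -⟩ := h.exists_ptZ_bound
  refine (intervalIntegrable_const (c := L * R)).mono_fun (h.aesm_ptZ hT).restrict
    (Eventually.of_forall fun Y => ?_)
  exact ((hL T hT Y).trans (mul_le_mul_of_nonneg_left (h.weight_le Y) hL0)).trans (le_abs_self _)

/-- The relation `u_Y = sin (v/2) cos^{k-1} (v/2) ξ` is preserved by the flow. -/
theorem hasACDeriv_fst (hε : 0 < ε) (h : LocalFlow lam ρ A R B C ε w)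
    (h0 : HasACDeriv (fun Y => (w 0 Y).1) (fun Y => ptZ lam (w 0 Y))) {T : ℝ}
    (hT : T ∈ Ioo (-ε) ε) : HasACDeriv (fun Y => (w T Y).1) (fun Y => ptZ lam (w T Y)) := by
  refine HasACDeriv.of_primitive (h.intervalIntegrable_ptZ hT) fun x => ?_
  have hR0 : 0 ≤ R := (h.weight.pos 0).le.trans (h.weight_le 0)
  obtain ⟨L₁, hL₁0, hL₁, -⟩ := exists_density_bound (M := 2) (contDiff_ptP lam)
    (fun x => by simp [ptP]) (by norm_num) hR0
  obtain ⟨N, hN0, hN, -⟩ := exists_nonloc_bound lam (M := 2) (m := 1 / 2) (by norm_num)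
    (by norm_num) B h.weight h.weight_le
  have hAC : ∀ t ∈ Ioo (-ε) ε, _ := fun t ht =>
    (h.adm t ht).hasACDeriv_nonlocU (lam := lam) (by norm_num) (by norm_num) h.weight h.weight_le
  -- The defect in `u(x) - u(0) = ∫ ptZ` is constant in time: differentiating under the integral
  -- gives minus the `Y`-derivative of `nonlocU`, whose integral cancels the time derivative of
  -- `u(x) - u(0)`.
  have hder : ∀ t ∈ Ioo (-ε) ε, HasDerivAt
      (fun t => (w t x).1 - (w t 0).1 - ∫ Y in (0 : ℝ)..x, ptZ lam (w t Y)) 0 t := by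
    intro t ht
    have hi := intervalIntegral.hasDerivAt_integral_of_dominated_loc_of_deriv_le
      (μ := volume) (a := 0) (b := x) (F := fun t Y => ptZ lam (w t Y))
      (F' := fun t Y => ptP lam (w t Y) - ptW lam (w t Y) * nonlocV lam (w t) Y)
      (bound := fun _ => L₁ * R + 2 * (N * R)) (Ioo_mem_nhds ht.1 ht.2)
      (by filter_upwards [Ioo_mem_nhds ht.1 ht.2] with s hs using (h.aesm_ptZ hs).restrict)
      (h.intervalIntegrable_ptZ ht 0 x)
      -- Measurability in `Y` is inherited from the integrable derivative of `nonlocU`, of which the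
      -- integrand is the negative.
      (by
        have h1 := ((hAC t ht).1.intervalIntegrable 0 x).neg
        have h2 := h1.def'.aestronglyMeasurable
        refine h2.congr (Eventually.of_forall fun Y => ?_)
        simp)
      (by
        refine Eventually.of_forall fun Y _ s hs => ?_
        have h1 : |ptP lam (w s Y)| ≤ L₁ * R :=
          (hL₁ _ _ (h.weight.pos Y).le (h.weight_le Y) (h.bound s hs Y)).trans
            (mul_le_mul_of_nonneg_left (h.weight_le Y) hL₁0)
        have h2 : |nonlocV lam (w s) Y| ≤ N * R :=
          (hN _ (h.adm s hs) Y).1.trans (mul_le_mul_of_nonneg_left (h.weight_le Y) hN0)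
        have h3 : |ptW lam (w s Y)| ≤ 2 := by
          rw [ptW, abs_mul, abs_pow]
          have := pow_le_one₀ (abs_nonneg _) (Real.abs_cos_le_one ((w s Y).2.1 / 2))
            (n := expo lam)
          calc _ ≤ 1 * 2 := mul_le_mul this (h.bound s hs Y).2.2 (abs_nonneg _) zero_le_one
            _ = 2 := one_mul 2
        calc ‖ptP lam (w s Y) - ptW lam (w s Y) * nonlocV lam (w s) Y‖
            ≤ |ptP lam (w s Y)| + |ptW lam (w s Y) * nonlocV lam (w s) Y| := _root_.norm_sub_le _ _
          _ ≤ L₁ * R + 2 * (N * R) := by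
            rw [abs_mul]
            exact add_le_add h1 (mul_le_mul h3 h2 (abs_nonneg _) (by norm_num)))
      intervalIntegrable_const
      (Eventually.of_forall fun Y _ s hs => h.hasDerivAt_ptZ hs Y)
    have h2 := ((h.hasDerivAt_fst ht x).sub (h.hasDerivAt_fst ht 0)).sub hi.2
    refine h2.congr_deriv ?_
    have h3 := (hAC t ht).1.integral_eq_sub 0 x
    have h4 : ∫ Y in (0 : ℝ)..x, (ptP lam (w t Y) - ptW lam (w t Y) * nonlocV lam (w t) Y) =
        - ∫ Y in (0 : ℝ)..x, (ptW lam (w t Y) * nonlocV lam (w t) Y - ptP lam (w t Y)) := by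
      rw [← intervalIntegral.integral_neg]
      simp
    rw [h4, h3]
    ring
  have h00 : (0 : ℝ) ∈ Ioo (-ε) ε := ⟨by linarith, hε⟩
  have h5 := (convex_Ioo (-ε) ε).norm_image_sub_le_of_norm_hasDerivWithin_le
    (C := 0) (fun t ht => (hder t ht).hasDerivWithinAt) (fun t ht => by simp) h00 hT
  rw [zero_mul, norm_le_zero_iff, h0.integral_eq_sub 0 x] at h5
  linarith

theorem memLp_weight (h : LocalFlow lam ρ A R B C ε w) {n : ℕ} (hn : 2 ≤ n) :
    MemLp ρ n volume :=
  memLp_of_sq_integrable hn h.weight.aesm (fun Y => (h.weight.pos Y).le) h.weight_le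
    h.integrable_sq

theorem memLp_weight_top (h : LocalFlow lam ρ A R B C ε w) : MemLp ρ ⊤ volume :=
  memLp_top_of_bound h.weight.aesm R (Eventually.of_forall fun Y => by
    rw [Real.norm_of_nonneg (h.weight.pos Y).le]; exact h.weight_le Y)

theorem memLp_of_le (h : LocalFlow lam ρ A R B C ε w) {p : ℝ≥0∞} (hp : MemLp ρ p volume)
    {f : ℝ → ℝ} (hf : AEStronglyMeasurable f volume) {K : ℝ} (hK : ∀ Y, |f Y| ≤ K * ρ Y) :
    MemLp f p volume :=
  hp.of_le_mul (c := K) hf (Eventually.of_forall fun Y => by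
    rw [Real.norm_of_nonneg (h.weight.pos Y).le]; exact hK Y)

/-- A single weight in `L² ∩ L^k ∩ L^∞` dominates `u`, `v` and, through `ptZ`, the derivative of
`u`. -/
theorem memX (hε : 0 < ε) (h : LocalFlow lam ρ A R B C ε w)
    (h0 : HasACDeriv (fun Y => (w 0 Y).1) (fun Y => ptZ lam (w 0 Y))) {T : ℝ}
    (hT : T ∈ Ioo (-ε) ε) :
    MemX lam (fun Y => (w T Y).1) (fun Y => (w T Y).2.1) (fun Y => (w T Y).2.2) := by
  have hAC := h.hasACDeriv_fst hε h0 hT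
  obtain ⟨L, -, hL, -⟩ := h.exists_ptZ_bound
  have hm := (h.adm T hT).aesm
  have hW : ∀ p : ℝ≥0∞, MemLp ρ p volume → MemW1 p (fun Y => (w T Y).1) := fun p hp =>
    ⟨h.memLp_of_le hp hm.fst fun Y => (h.bound T hT Y).1, _, hAC.isWeakDeriv,
      h.memLp_of_le hp (h.aesm_ptZ hT) (hL T hT)⟩
  have h2 : MemLp ρ 2 volume := h.memLp_weight le_rfl
  refine ⟨⟨hW 2 h2, hW _ (h.memLp_weight (by simp [expo]))⟩,
    ⟨h.memLp_of_le h2 hm.snd.fst fun Y => (h.bound T hT Y).2.1,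
      h.memLp_of_le h.memLp_weight_top hm.snd.fst fun Y => (h.bound T hT Y).2.1⟩, ?_⟩
  exact memLp_top_of_bound hm.snd.snd 2 (Eventually.of_forall fun Y => (h.bound T hT Y).2.2)

/-- The flow is Lipschitz in time relative to `ρ`, and so is the derivative of `u`, because it is a
Lipschitz function of the state; every norm in `X` is then at most a multiple of `|S - T|`. -/
theorem exists_normX_sub_le (hε : 0 < ε) (h : LocalFlow lam ρ A R B C ε w)
    (h0 : HasACDeriv (fun Y => (w 0 Y).1) (fun Y => ptZ lam (w 0 Y))) :
    ∃ (K : ℝ) (N : ℝ≥0∞), N ≠ ⊤ ∧ ∀ S ∈ Ioo (-ε) ε, ∀ T ∈ Ioo (-ε) ε,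
      normX lam ((fun Y => (w S Y).1) - fun Y => (w T Y).1)
        ((fun Y => (w S Y).2.1) - fun Y => (w T Y).2.1)
        ((fun Y => (w S Y).2.2) - fun Y => (w T Y).2.2) ≤ ENNReal.ofReal (K * |S - T|) * N := by
  obtain ⟨L, hL0, -, hL⟩ := h.exists_ptZ_bound
  have hC0 := h.field_nonneg
  set N₂ := eLpNorm ρ 2 volume
  set Nk := eLpNorm ρ (expo lam) volume
  set Nt := eLpNorm ρ ⊤ volume
  have f2 : N₂ ≠ ⊤ := (h.memLp_weight le_rfl : MemLp ρ 2 volume).2.ne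
  have fk : Nk ≠ ⊤ := (h.memLp_weight (by simp [expo])).2.ne
  have ft : Nt ≠ ⊤ := h.memLp_weight_top.2.ne
  -- `C` is the Lipschitz constant for the components and `L * C` the one for the derivative of `u`.
  refine ⟨C + L * C, ((N₂ + N₂) + (Nk + Nk)) + (N₂ + Nt) + Nt, by finiteness, fun S hS T hT => ?_⟩
  have key : ∀ (p : ℝ≥0∞) (f : ℝ → ℝ), (∀ᵐ Y, |f Y| ≤ (C + L * C) * |S - T| * ρ Y) →
      eLpNorm f p volume ≤ ENNReal.ofReal ((C + L * C) * |S - T|) * eLpNorm ρ p volume :=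
    fun p f hf => eLpNorm_le_mul_eLpNorm_of_ae_le_mul (hf.mono fun Y hY => by
      rwa [Real.norm_of_nonneg (h.weight.pos Y).le]) p
  have hn : ∀ Y, ‖w S Y - w T Y‖ ≤ (C + L * C) * |S - T| * ρ Y := fun Y => by
    refine (h.norm_sub_le hS hT Y).trans ?_
    have := h.weight.pos Y
    gcongr
    linarith [mul_nonneg hL0 hC0]
  have e1 : ∀ᵐ Y, |((fun Y => (w S Y).1) - fun Y => (w T Y).1) Y| ≤
      (C + L * C) * |S - T| * ρ Y := Eventually.of_forall fun Y =>
    (norm_fst_le (w S Y - w T Y)).trans (hn Y)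
  have e2 : ∀ᵐ Y, |((fun Y => (w S Y).2.1) - fun Y => (w T Y).2.1) Y| ≤
      (C + L * C) * |S - T| * ρ Y := Eventually.of_forall fun Y =>
    ((norm_fst_le (w S Y - w T Y).2).trans (norm_snd_le (w S Y - w T Y))).trans (hn Y)
  have e3 : ∀ᵐ Y, |((fun Y => (w S Y).2.2) - fun Y => (w T Y).2.2) Y| ≤
      (C + L * C) * |S - T| * ρ Y := Eventually.of_forall fun Y =>
    ((norm_snd_le (w S Y - w T Y).2).trans (norm_snd_le (w S Y - w T Y))).trans (hn Y)
  have e4 : ∀ᵐ Y, |weakDeriv ((fun Y => (w S Y).1) - fun Y => (w T Y).1) Y| ≤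
      (C + L * C) * |S - T| * ρ Y := by
    have hd : weakDeriv ((fun Y => (w S Y).1) - fun Y => (w T Y).1) =ᵐ[volume]
        fun Y => ptZ lam (w S Y) - ptZ lam (w T Y) :=
      ((h.hasACDeriv_fst hε h0 hS).sub (h.hasACDeriv_fst hε h0 hT)).weakDeriv_ae_eq
    refine hd.mono fun Y hY => ?_
    rw [hY]
    have h1 := hL S hS T hT Y
    have h2 := mul_le_mul_of_nonneg_left (h.norm_sub_le hS hT Y) hL0
    have h3 : 0 ≤ C * |S - T| * ρ Y :=
      mul_nonneg (mul_nonneg hC0 (abs_nonneg _)) (h.weight.pos Y).le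
    linarith
  simp only [normX, normW1, mul_add]
  exact add_le_add (add_le_add (add_le_add (add_le_add (key _ _ e1) (key _ _ e4))
    (add_le_add (key _ _ e1) (key _ _ e4))) (add_le_add (key _ _ e2) (key _ _ e2))) (key _ _ e3)

theorem isSolution (hε : 0 < ε) (h : LocalFlow lam ρ A R B C ε w)
    (h0 : HasACDeriv (fun Y => (w 0 Y).1) (fun Y => ptZ lam (w 0 Y)))
    (hu : ∀ᵐ Y, (w 0 Y).1 = u₀ (x₀ lam u₀ Y))
    (hv : ∀ᵐ Y, (w 0 Y).2.1 = 2 * Real.arctan (weakDeriv u₀ (x₀ lam u₀ Y)))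
    (hξ : ∀ᵐ Y, (w 0 Y).2.2 = 1) :
    IsSolution lam u₀ (ε / 2) (fun T Y => (w T Y).1) (fun T Y => (w T Y).2.1)
      (fun T Y => (w T Y).2.2) := by
  -- The closed time interval lies inside the open one, so two-sided derivatives exist at its
  -- endpoints too.
  have hsub : ∀ T ∈ Icc 0 (ε / 2), T ∈ Ioo (-ε) ε := fun T hT =>
    ⟨by linarith [hT.1], by linarith [hT.2]⟩
  refine ⟨fun T hT => h.memX hε h0 (hsub T hT), fun T hT => ?_, ?_, ?_, ?_, hu, hv, hξ⟩
  · obtain ⟨K, N, hN, hK⟩ := h.exists_normX_sub_le hε h0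
    have hlim : Tendsto (fun S => ENNReal.ofReal (K * |S - T|) * N) (𝓝[Icc 0 (ε / 2)] T) (𝓝 0) := by
      have h1 : Continuous fun S => ENNReal.ofReal (K * |S - T|) * N := by
        refine (ENNReal.continuous_mul_const hN).comp ?_
        exact ENNReal.continuous_ofReal.comp (by fun_prop)
      have h2 := h1.tendsto T
      simp only [sub_self, abs_zero, mul_zero, ENNReal.ofReal_zero, zero_mul] at h2
      exact h2.mono_left nhdsWithin_le_nhds
    refine tendsto_of_tendsto_of_tendsto_of_le_of_le' tendsto_const_nhds hlim
      (Eventually.of_forall fun S => zero_le) ?_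
    filter_upwards [self_mem_nhdsWithin] with S hS using hK S (hsub S hS) T (hsub T hT)
  · refine Eventually.of_forall fun Y T hT => ?_
    have h1 : HasDerivAt (fun t => (w t Y).1) (field lam (w T) Y).1 T :=
      (h.hasDerivAt T (hsub T hT) Y).fst
    exact h1.hasDerivWithinAt
  · refine Eventually.of_forall fun Y T hT => ?_
    have h1 : HasDerivAt (fun t => (w t Y).2.1) (field lam (w T) Y).2.1 T :=
      (h.hasDerivAt T (hsub T hT) Y).snd.fst
    exact h1.hasDerivWithinAt
  · refine Eventually.of_forall fun Y T hT => ?_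
    have h1 : HasDerivAt (fun t => (w t Y).2.2) (field lam (w T) Y).2.2 T :=
      (h.hasDerivAt T (hsub T hT) Y).snd.snd
    exact h1.hasDerivWithinAt

end LocalFlow

theorem exists_isSolution (hlam : 1 ≤ lam) (h2 : MemW1 2 u₀) (hk : MemW1 (expo lam) u₀) :
    ∃ T₀ : ℝ, 0 < T₀ ∧ ∃ u v ξ, IsSolution lam u₀ T₀ u v ξ := by
  obtain ⟨U, V, hU, hV, hAC, hVm, hUb, hVb, hU2, hV2⟩ := exists_initial_data h2 hk
  obtain ⟨ρ, A, R, B, C, ε, w, hε, hw, h0⟩ := exists_localFlow lam hlam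
    hAC.continuous.aestronglyMeasurable hVm hUb hVb hU2 hV2
  refine ⟨ε / 2, half_pos hε, _, _, _, hw.isSolution hε ?_ ?_ ?_ ?_⟩
  · rw [h0]
    exact hAC.congr_deriv (Eventually.of_forall fun Y => by simp [ptZ])
  · rw [h0]; exact hU
  · rw [h0]; exact Eventually.of_forall hV
  · rw [h0]; exact Eventually.of_forall fun _ => rfl

end LambdaFamily
end

theorem proposition4p1 (lam : ℕ) (hlam : 1 ≤ lam) (u₀ : ℝ → ℝ)
    (hu₀ : LambdaFamily.MemW1 2 u₀) (hu₀k : LambdaFamily.MemW1 (LambdaFamily.expo lam) u₀) :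
    ∃ T₀ : ℝ, 0 < T₀ ∧
      (∃ u v ξ : ℝ → ℝ → ℝ, LambdaFamily.IsSolution lam u₀ T₀ u v ξ) ∧
      ∀ u v ξ u' v' ξ' : ℝ → ℝ → ℝ,
        LambdaFamily.IsSolution lam u₀ T₀ u v ξ →
        LambdaFamily.IsSolution lam u₀ T₀ u' v' ξ' →
          ∀ T ∈ Set.Icc 0 T₀,
            u T =ᵐ[MeasureTheory.volume] u' T ∧
            v T =ᵐ[MeasureTheory.volume] v' T ∧
            ξ T =ᵐ[MeasureTheory.volume] ξ' T := by
  obtain ⟨T₀, hT₀, hex⟩ := LambdaFamily.exists_isSolution hlam hu₀ hu₀k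
  refine ⟨T₀, hT₀, hex, fun u v ξ u' v' ξ' h h' T hT => ?_⟩
  have key := h.ae_eq hlam hT₀.le h'
  refine ⟨key.mono fun Y hY => ?_, key.mono fun Y hY => ?_, key.mono fun Y hY => ?_⟩
  · exact congrArg (fun x : LambdaFamily.State => x.1) (hY T hT)
  · exact congrArg (fun x : LambdaFamily.State => x.2.1) (hY T hT)
  · exact congrArg (fun x : LambdaFamily.State => x.2.2) (hY T hT)
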